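/- Let $M$ be a finite-dimensional (Hausdorff) smooth manifold, $\mathfrak g$ a finite-dimensional real Lie algebra and $\rho:\mathfrak g\to\mathfrak X(M)$ a Lie algebra homomorphism (so that $M$ is a $\mathfrak g$-manifold). **The action algebroid.** $A=\mathfrak g\ltimes M$ is the trivial bundle $M\times\mathfrak g$ with anchor $\rho(x,v)=\rho(v)_x$ and bracket $[\alpha,\beta](x)=[\alpha(x),\beta(x)]_{\mathfrak g}+(\mathcal L_{\rho(\alpha)}\beta)(x)-(\mathcal L_{\rho(\beta)}\alpha)(x)$ on $\Gamma(A)=C^\infty(M,\mathfrak g)$. Its canonical flat connection $\nabla^{\rm flat}$ is $\nabla^{\rm flat}_X\alpha=\mathcal L_X\alpha$, for which constant sections are flat. **The Weil algebra of a Lie algebroid.** Let $A$ be a Lie algebroid over $M$ with anchor $\rho$ and let $\nabla$ be a connection on the vector bundle $A$, with curvature $R_\nabla$. Put $\nabla^{\rm bas}_\alpha\beta=\nabla_{\rho(\beta)}\alpha+[\alpha,\beta]$, $\nabla^{\rm bas}_\alpha X=\rho(\nabla_X\alpha)+[\rho(\alpha),X]$ and $$R^{\rm bas}(\alpha,\beta)X=\nabla_X[\alpha,\beta]-[\nabla_X\alpha,\beta]-[\alpha,\nabla_X\beta]-\nabla_{\nabla^{\rm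 bas}_\beta X}\alpha+\nabla_{\nabla^{\rm bas}_\alpha X}\beta .$$ $W(A;\nabla)$ is the bigraded commutative algebra $\bigoplus_{u,v,w}\Gamma(\Lambda^uT^*M\otimes S^vA^*\otimes\Lambda^wA^*)$, where the summand $(u,v,w)$ has bidegree $(p,q)=(v+w,u+v)$ and total degree $u+2v+w$. An element is described by its components $c(e_1,\dots,e_n;\beta_1,\dots,\beta_v)\in C^\infty(M)$, where $e_i=(X_i,\alpha_i)\in\mathfrak X(M)\oplus\Gamma(A)$, $\beta_j\in\Gamma(A)$ and $n=u+w$; they are $C^\infty(M)$-multilinear, alternating in the $e_i$ and symmetric in the $\beta_j$. The product is the shuffle product. The total differential is $d=d^{\rm hor}_\nabla+d^{\rm ver}_\nabla$, where, with $e_i$ indexed from $0$ and with $\hat{\ }$ denoting omission, $$\begin{aligned}(d^{\rm ver}c)(e;\beta)=&\sum_k c((0,\beta_k),e;\hat\beta_k)+\sum_i(-1)^i\Big(X_i\,c(\hat e_i;\beta)-\sum_k c(\hat e_i;\dots,\nabla_{X_i}\beta_k,\dots)\Big)\\&+\sum_{i<j}(-1)^{i+j}c(([X_i,X_j],\nabla_{X_i}\alpha_j-\nabla_{X_j}\alpha_i),\dots\hat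 e_i\dots\hat e_j\dots;\beta)\\&+\sum_{\sigma\in S_{n+3}}\frac{{\rm sgn}\,\sigma}{2\,n!}c(e_{\sigma(3)},\dots,e_{\sigma(n+2)};R_\nabla(X_{\sigma(0)},X_{\sigma(1)})\alpha_{\sigma(2)},\beta),\\(d^{\rm hor}c)(e;\beta)=&-\sum_k c((\rho(\beta_k),0),e;\hat\beta_k)+\sum_i(-1)^i\Big(\rho(\alpha_i)\,c(\hat e_i;\beta)-\sum_k c(\hat e_i;\dots,\nabla^{\rm bas}_{\alpha_i}\beta_k,\dots)\Big)\\&+\sum_{i<j}(-1)^{i+j}c((\nabla^{\rm bas}_{\alpha_i}X_j-\nabla^{\rm bas}_{\alpha_j}X_i,[\alpha_i,\alpha_j]),\dots\hat e_i\dots\hat e_j\dots;\beta)\\&+\sum_{\sigma\in S_{n+3}}\frac{{\rm sgn}\,\sigma}{2\,n!}c(e_{\sigma(3)},\dots,e_{\sigma(n+2)};R^{\rm bas}(\alpha_{\sigma(0)},\alpha_{\sigma(1)})X_{\sigma(2)},\beta)\end{aligned}$$ (in each of the last sums $n$ is the number of arguments $e$ that remain; the first sums are absent if there are no $\beta$'s).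 **Kalkman's BRST algebra.** Let $(b_a)$ be any basis of $\mathfrak g$ with structure constants $[b_j,b_k]=\sum_i c^i_{jk}b_i$. $W(\mathfrak g)=\Lambda\mathfrak g^*\otimes S\mathfrak g^*$ has generators $\theta^a$ (degree $1$, bidegree $(1,0)$) and $\mu^a$ (degree $2$, bidegree $(1,1)$), dual to $(b_a)$, and its differential $d_W$ is the graded derivation with $d_W\theta^i=\mu^i-\frac12\sum c^i_{jk}\theta^j\theta^k$ and $d_W\mu^i=-\sum c^i_{jk}\theta^j\mu^k$. The BRST algebra is the graded tensor product $W(\mathfrak g,M)=W(\mathfrak g)\otimes\Omega(M)$, with one-forms in bidegree $(0,1)$, and with $$\delta=d_W\otimes1+1\otimes d_{DR}+\sum_a\theta^a\otimes\mathcal L_a-\sum_a\mu^a\otimes\iota_a ,$$ where $\mathcal L_a$, $\iota_a$ are the Lie derivative and the contraction along $\rho(b_a)$, and $x\otimes D$ acts by $(x\otimes D)(y\otimes\omega)=(-1)^{|D||y|}xy\otimes D\omega$. **Proposition.** $W(\mathfrak g,M)=W(\mathfrak g\ltimes M;\nabla^{\rm flat})$ as differential bigraded algebras. That is, there is a linear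 isomorphism $\Phi:W(\mathfrak g,M)\to W(\mathfrak g\ltimes M;\nabla^{\rm flat})$ which is the tautological identification on generators (it sends $1\otimes\omega$ to $\omega\in\Gamma(\Lambda T^*M)$ and, for $\xi\in\mathfrak g^*$, the generators $\theta^\xi\otimes1$, $\mu^\xi\otimes1$ to the constant sections $\xi$ of $\Lambda^1A^*$ and of $S^1A^*$), is multiplicative, identifies the elements of each bidegree $(p,q)$ on both sides, and satisfies $\Phi\circ\delta=(d^{\rm hor}_{\nabla^{\rm flat}}+d^{\rm ver}_{\nabla^{\rm flat}})\circ\Phi$. -/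

import Mathlib

open scoped Manifold ContDiff Bundle TensorProduct DirectSum

set_option linter.unusedSectionVars false

noncomputable section

namespace WeilBRST

section Forms

variable (R L : Type*) [CommRing R] [Algebra ℝ R] [LieRing L] [Module R L] [LieAlgebra ℝ L]
  [LieRingModule L R] [LieRinehartRing R L] [LieRinehartAlgebra ℝ R L]

/-- The forms of degree `k`: alternating `R`-multilinear maps on `L`. For `R = C^∞(M)` and
`L = 𝔛(M)` these are the smooth differential forms of degree `k` on `M`. -/
abbrev Form (k : ℕ) := L [⋀^Fin k]→ₗ[R] R

variable {R L}
variable {k : ℕ}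

theorem lieForm_smul_aux (X : L) (φ : Form R L k) (v : Fin k → L) (i : Fin k) (f : R) (x : L) :
    ∑ j, φ (Function.update (Function.update v i (f • x)) j ⁅X, Function.update v i (f • x) j⁆) =
      f • ∑ j, φ (Function.update (Function.update v i x) j ⁅X, Function.update v i x j⁆) +
        ⁅X, f⁆ * φ (Function.update v i x) := by
  rw [← Finset.add_sum_erase _ _ (Finset.mem_univ i), ← Finset.add_sum_erase _
    (fun j => φ (Function.update (Function.update v i x) j _)) (Finset.mem_univ i)]
  simp only [Function.update_self, Function.update_idem, LieRinehartRing.leibniz_smul_right,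
    φ.map_update_add, φ.map_update_smul, smul_eq_mul]
  have : ∀ j ∈ Finset.univ.erase i,
      φ (Function.update (Function.update v i (f • x)) j ⁅X, Function.update v i (f • x) j⁆) =
      f * φ (Function.update (Function.update v i x) j ⁅X, Function.update v i x j⁆) := by
    intro j hj
    have hji : j ≠ i := (Finset.mem_erase.1 hj).1
    rw [Function.update_of_ne hji, Function.update_of_ne hji, Function.update_comm hji.symm,
      Function.update_comm hji.symm, φ.map_update_smul, smul_eq_mul]
  rw [Finset.sum_congr rfl this, ← Finset.mul_sum]
  ring

theorem lieForm_add_aux (X : L) (φ : Form R L k) (v : Fin k → L) (i : Fin k) (x y : L) :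
    ∑ j, φ (Function.update (Function.update v i (x + y)) j ⁅X, Function.update v i (x + y) j⁆) =
      ∑ j, φ (Function.update (Function.update v i x) j ⁅X, Function.update v i x j⁆) +
      ∑ j, φ (Function.update (Function.update v i y) j ⁅X, Function.update v i y j⁆) := by
  rw [← Finset.sum_add_distrib]
  refine Finset.sum_congr rfl fun j _ => ?_
  by_cases hji : j = i
  · subst hji
    simp only [Function.update_self, Function.update_idem, lie_add, φ.map_update_add]
  · rw [Function.update_of_ne hji, Function.update_of_ne hji, Function.update_of_ne hji,
      Function.update_comm (Ne.symm hji), Function.update_comm (Ne.symm hji),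
      Function.update_comm (Ne.symm hji), φ.map_update_add]

theorem lieForm_eq_zero_aux (X : L) (φ : Form R L k) (v : Fin k → L) (i j : Fin k)
    (hv : v i = v j) (hij : i ≠ j) : ∑ l, φ (Function.update v l ⁅X, v l⁆) = 0 := by
  rw [← Finset.add_sum_erase _ _ (Finset.mem_univ i),
    ← Finset.add_sum_erase _ _ (Finset.mem_erase.2 ⟨hij.symm, Finset.mem_univ j⟩)]
  rw [Finset.sum_eq_zero, add_zero]
  · have h := φ.map_swap (Function.update v i ⁅X, v i⁆) hij
    have h2 : Function.update v i ⁅X, v i⁆ ∘ Equiv.swap i j = Function.update v j ⁅X, v j⁆ := by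
      funext l
      by_cases hi : l = i
      · subst hi
        simp [Function.update_of_ne hij, Function.update_of_ne hij.symm, hv]
      by_cases hj : l = j
      · subst hj
        simp [hv]
      · simp [Equiv.swap_apply_of_ne_of_ne hi hj, Function.update_of_ne hi,
          Function.update_of_ne hj]
    rw [h2] at h
    rw [h, add_neg_cancel]
  · intro l hl
    simp only [Finset.mem_erase, Finset.mem_univ, and_true] at hl
    refine φ.map_eq_zero_of_eq _ (i := i) (j := j) ?_ hij
    rw [Function.update_of_ne hl.2.symm, Function.update_of_ne hl.1.symm, hv]

/-- The Lie derivative `(L_X φ)(Y₁, …, Y_k) = X(φ(Y₁, …, Y_k)) - ∑ φ(Y₁, …, [X, Y_j], …, Y_k)`. -/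
def lieForm (X : L) (φ : Form R L k) : Form R L k where
  toFun v := ⁅X, φ v⁆ - ∑ j, φ (Function.update v j ⁅X, v j⁆)
  map_update_add' := @fun hd v i x y => by
    obtain rfl : hd = instDecidableEqFin k := Subsingleton.elim _ _
    rw [lieForm_add_aux, φ.map_update_add, lie_add]
    ring
  map_update_smul' := @fun hd v i f x => by
    obtain rfl : hd = instDecidableEqFin k := Subsingleton.elim _ _
    rw [lieForm_smul_aux, φ.map_update_smul, smul_eq_mul, LieRinehartRing.leibniz_mul_right]
    simp only [smul_eq_mul]
    ring
  map_eq_zero_of_eq' v i j hv hij := by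
    rw [lieForm_eq_zero_aux X φ v i j hv hij, φ.map_eq_zero_of_eq v hv hij, lie_zero, sub_zero]

theorem lieForm_apply (X : L) (φ : Form R L k) (v : Fin k → L) :
    lieForm X φ v = ⁅X, φ v⁆ - ∑ j, φ (Function.update v j ⁅X, v j⁆) := rfl

/-- The Lie derivative as a linear map. -/
def lieFormₗ (X : L) : Form R L k →ₗ[ℝ] Form R L k where
  toFun := lieForm X
  map_add' φ η := by
    ext v
    simp only [lieForm_apply, AlternatingMap.add_apply, lie_add, Finset.sum_add_distrib]
    ring
  map_smul' r φ := by
    ext v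
    simp only [lieForm_apply, AlternatingMap.smul_apply, LieModule.lie_smul, smul_sub,
      Finset.smul_sum, RingHom.id_apply]

/-- The contraction `(ι_X φ)(Y₂, …, Y_k) = φ(X, Y₂, …, Y_k)`. -/
def contractForm (X : L) : Form R L (k + 1) →ₗ[ℝ] Form R L k where
  toFun φ := φ.curryLeft X
  map_add' _ _ := rfl
  map_smul' _ _ := rfl

theorem contractForm_apply (X : L) (φ : Form R L (k + 1)) (v : Fin k → L) :
    contractForm X φ v = φ (Matrix.vecCons X v) := rfl

/-- The Koszul formula for the de Rham differential,
`(dφ)(Y₀, …, Y_k) = ∑ᵢ (-1)ⁱ Yᵢ(φ(Y₀, …, Ŷᵢ, …, Y_k))`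
`  + ∑_{i < j} (-1)ʲ φ(Y₀, …, [Yᵢ, Yⱼ], …, Ŷⱼ, …, Y_k)` with `[Yᵢ, Yⱼ]` at the place of `Yᵢ`.
In the second sum the pairs `i < j` of indices are written `(i.castSucc, j.succ)` with `i ≤ j`. -/
def koszul (φ : Form R L k) (v : Fin (k + 1) → L) : R :=
  ∑ i : Fin (k + 1), (-1) ^ (i : ℕ) * ⁅v i, φ (i.removeNth v)⁆ +
    ∑ i : Fin k, ∑ j ∈ Finset.Ici i, (-1) ^ ((j : ℕ) + 1) *
      φ (j.succ.removeNth (Function.update v i.castSucc ⁅v i.castSucc, v j.succ⁆))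


/-- A form, seen as an alternating map over `ℝ`. -/
def restrictForm (φ : Form R L k) : L [⋀^Fin k]→ₗ[ℝ] R where
  __ := φ.toMultilinearMap.restrictScalars ℝ
  map_eq_zero_of_eq' v _ _ h hij := φ.map_eq_zero_of_eq v h hij

/-- The map `X ↦ X(φ(·)) + L_X φ`, whose alternation is twice the de Rham differential. -/
def koszulAux (φ : Form R L k) : L →ₗ[ℝ] L [⋀^Fin k]→ₗ[ℝ] R where
  toFun X := (LieModule.toEnd ℝ L R X : R →ₗ[ℝ] R).compAlternatingMap (restrictForm φ) +
    restrictForm (lieForm X φ)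
  map_add' X Y := by
    ext v
    change ⁅X + Y, φ v⁆ + lieForm (X + Y) φ v =
      ⁅X, φ v⁆ + lieForm X φ v + (⁅Y, φ v⁆ + lieForm Y φ v)
    simp only [lieForm_apply, add_lie, φ.map_update_add, Finset.sum_add_distrib]
    ring
  map_smul' r X := by
    ext v
    change ⁅r • X, φ v⁆ + lieForm (r • X) φ v = r • (⁅X, φ v⁆ + lieForm X φ v)
    have h : ∀ x j, φ (Function.update v j (r • x)) = r • φ (Function.update v j x) := by
      intro x j
      rw [← algebraMap_smul R r x, φ.map_update_smul, algebraMap_smul]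
    simp only [lieForm_apply, smul_lie, h, ← Finset.smul_sum, smul_add, smul_sub]

theorem koszulAux_apply (φ : Form R L k) (X : L) (v : Fin k → L) :
    koszulAux φ X v =
      2 * ⁅X, φ v⁆ - ∑ j, φ (Function.update v j ⁅X, v j⁆) := by
  change ⁅X, φ v⁆ + lieForm X φ v = _
  rw [lieForm_apply]
  ring

theorem koszul_pair (φ : Form R L k) (v : Fin (k + 1) → L) :
    ∑ i : Fin (k + 1), ∑ j : Fin k, (-1) ^ (i : ℕ) *
        φ (Function.update (i.removeNth v) j ⁅v i, i.removeNth v j⁆) =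
      - (2 * ∑ i : Fin k, ∑ j ∈ Finset.Ici i, (-1) ^ ((j : ℕ) + 1) *
      φ (j.succ.removeNth (Function.update v i.castSucc ⁅v i.castSucc, v j.succ⁆))) := by
  rw [Fin.sum_sum_eq_sum_triangle_add, Finset.mul_sum, ← Finset.sum_neg_distrib]
  refine Finset.sum_congr rfl fun i _ => ?_
  rw [Finset.mul_sum, ← Finset.sum_neg_distrib]
  refine Finset.sum_congr rfl fun j hj => ?_
  rw [Finset.mem_Ici] at hj
  obtain _ | k := k
  · exact i.elim0
  have H₁ : i.castSucc.succAbove j = j.succ := by simp [Fin.succAbove_of_le_castSucc, hj]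
  have H₂ : j.predAbove i.castSucc = i := by simp [Fin.predAbove_of_le_castSucc, hj]
  have H₃ : j.succ.succAbove i = i.castSucc := by simp [Fin.succAbove_of_castSucc_lt, hj]
  have H₄ : j.succ.removeNth (Function.update v i.castSucc ⁅v i.castSucc, v j.succ⁆) =
      Function.update (j.succ.removeNth v) i ⁅v i.castSucc, v j.succ⁆ := by
    rw [← Fin.removeNth_update_succAbove, H₃]
  rw [H₄]
  have H₅ : i.castSucc.removeNth v j = v j.succ := by rw [Fin.removeNth, H₁]
  have H₆ : j.succ.removeNth v i = v i.castSucc := by rw [Fin.removeNth, H₃]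
  rw [H₅, H₆, ← lie_skew (v i.castSucc) (v j.succ)]
  simp only [← Fin.insertNth_removeNth, AlternatingMap.map_insertNth]
  rw [Fin.removeNth_removeNth_eq_swap, H₁, H₂]
  have h : ∀ (x : L) (w : Fin k → L), φ (Matrix.vecCons (-x) w) = - φ (Matrix.vecCons x w) := by
    intro x w
    have := (φ.curryLeft).map_neg x
    exact congrArg (fun η => η w) this
  rw [h]
  simp only [zsmul_eq_mul, pow_add, Fin.val_castSucc, Fin.val_succ]
  push_cast
  ring

theorem koszul_eq (φ : Form R L k) (v : Fin (k + 1) → L) :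
    (AlternatingMap.alternatizeUncurryFin (koszulAux φ)) v = 2 * koszul φ v := by
  rw [AlternatingMap.alternatizeUncurryFin_apply]
  simp only [koszulAux_apply, zsmul_eq_mul, mul_sub, Finset.sum_sub_distrib]
  simp only [Finset.mul_sum (s := Finset.univ (α := Fin k))]
  push_cast
  rw [koszul_pair, koszul, mul_add, sub_neg_eq_add]
  have h : ∑ i : Fin (k + 1), (-1 : R) ^ (i : ℕ) * (2 * ⁅v i, φ (i.removeNth v)⁆) =
      2 * ∑ i : Fin (k + 1), (-1 : R) ^ (i : ℕ) * ⁅v i, φ (i.removeNth v)⁆ := by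
    rw [Finset.mul_sum]
    exact Finset.sum_congr rfl fun i _ => mul_left_comm _ _ _
  rw [h]

theorem two_mul_koszul_smul (φ : Form R L k) (f : R) (x : L) (w : Fin k → L) :
    2 * koszul φ (Matrix.vecCons (f • x) w) = f * (2 * koszul φ (Matrix.vecCons x w)) := by
  rw [← koszul_eq, ← koszul_eq, AlternatingMap.alternatizeUncurryFin_apply,
    AlternatingMap.alternatizeUncurryFin_apply, Fin.sum_univ_succ, Fin.sum_univ_succ, mul_add]
  have hx : ∀ y : L, Matrix.vecCons y w 0 = y := fun _ => rfl
  have hw : ∀ y : L, Fin.removeNth 0 (Matrix.vecCons y w) = w := fun y => by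
    funext j
    simp [Fin.removeNth]
  have hs : ∀ (y : L) (i : Fin k), Matrix.vecCons y w i.succ = w i := fun _ _ => rfl
  simp only [hx, hw, hs]
  have h0 : koszulAux φ (f • x) w = f * koszulAux φ x w +
      ∑ j, ⁅w j, f⁆ * φ (Function.update w j x) := by
    simp only [koszulAux_apply, LieRinehartRing.lie_smul_eq_mul]
    have : ∀ j, φ (Function.update w j ⁅f • x, w j⁆) =
        f * φ (Function.update w j ⁅x, w j⁆) - ⁅w j, f⁆ * φ (Function.update w j x) := by
      intro j
      have : ⁅f • x, w j⁆ = f • ⁅x, w j⁆ + (-⁅w j, f⁆) • x := by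
        rw [← lie_skew, LieRinehartRing.leibniz_smul_right, ← lie_skew x (w j)]
        module
      rw [this, φ.map_update_add, φ.map_update_smul, φ.map_update_smul]
      simp only [smul_eq_mul]
      ring
    simp only [this, Finset.sum_sub_distrib, mul_sub, Finset.mul_sum]
    ring
  have h1 : ∀ i : Fin k, koszulAux φ (w i) (i.succ.removeNth (Matrix.vecCons (f • x) w)) =
      f * koszulAux φ (w i) (i.succ.removeNth (Matrix.vecCons x w)) +
        ⁅w i, f⁆ * ((-1) ^ (i : ℕ) * φ (Function.update w i x)) := by
    intro i
    obtain _ | k := k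
    · exact i.elim0
    have hc : ∀ y : L, i.succ.removeNth (Matrix.vecCons y w) =
        Function.update (i.succ.removeNth (Matrix.vecCons x w)) 0 y := by
      intro y
      funext j
      refine Fin.cases ?_ (fun j => ?_) j
      · simp [Fin.removeNth]
      · simp [Fin.removeNth]
    have hy : Matrix.vecCons x (i.removeNth w) =
        Function.update (i.succ.removeNth (Matrix.vecCons x w)) 0 x := by
      funext j
      refine Fin.cases ?_ (fun j => ?_) j
      · simp
      · simp [Fin.removeNth]
    have hi : (-1 : R) ^ (i : ℕ) * φ (Function.update w i x) =
        φ (Matrix.vecCons x (i.removeNth w)) := by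
      rw [← Fin.insertNth_removeNth, AlternatingMap.map_insertNth, zsmul_eq_mul]
      push_cast
      rw [← mul_assoc, ← pow_add, Even.neg_one_pow ⟨_, rfl⟩, one_mul]
    have hg : ∀ u : Fin (k + 1) → L,
        koszulAux φ (w i) u = ⁅w i, φ u⁆ + lieForm (w i) φ u := fun _ => rfl
    rw [hi, hy, hg, hg, hc (f • x), (lieForm (w i) φ).map_update_smul, φ.map_update_smul,
      ← hc x, smul_eq_mul, smul_eq_mul, LieRinehartRing.leibniz_mul_right, smul_eq_mul]
    ring
  simp only [h0, h1, zsmul_eq_mul, mul_add, Finset.sum_add_distrib, Finset.mul_sum]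
  have h2 : ∑ i : Fin k, (((-1) ^ ((i.succ : Fin (k + 1)) : ℕ) : ℤ) : R) *
      (⁅w i, f⁆ * ((-1) ^ (i : ℕ) * φ (Function.update w i x))) =
      - ∑ j, ⁅w j, f⁆ * φ (Function.update w j x) := by
    rw [← Finset.sum_neg_distrib]
    refine Finset.sum_congr rfl fun i _ => ?_
    push_cast
    rw [Fin.val_succ, pow_succ]
    have : ((-1 : R) ^ (i : ℕ)) * (-1) ^ (i : ℕ) = 1 := by
      rw [← pow_add, Even.neg_one_pow ⟨_, rfl⟩]
    linear_combination - ⁅w i, f⁆ * φ (Function.update w i x) * this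
  rw [h2]
  simp
  have h3 : ∀ i : Fin k, (-1 : R) ^ ((i : ℕ) + 1) *
      (f * koszulAux φ (w i) (i.succ.removeNth (Matrix.vecCons x w))) =
      f * ((-1 : R) ^ ((i : ℕ) + 1) *
        koszulAux φ (w i) (i.succ.removeNth (Matrix.vecCons x w))) := fun i => by ring
  simp only [h3]
  ring

theorem koszul_smul (φ : Form R L k) (f : R) (x : L) (w : Fin k → L) :
    koszul φ (Matrix.vecCons (f • x) w) = f * koszul φ (Matrix.vecCons x w) := by
  have h := congrArg (fun a => (1 / 2 : ℝ) • a) (two_mul_koszul_smul φ f x w)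
  have h2 : ∀ a : R, (1 / 2 : ℝ) • (2 * a) = a := by
    intro a
    rw [two_mul, ← two_smul ℝ a, smul_smul]
    norm_num
  simpa only [mul_left_comm f 2, h2] using h

/-- The alternating map over `ℝ` given by the Koszul formula. -/
def koszulAlt (φ : Form R L k) : L [⋀^Fin (k + 1)]→ₗ[ℝ] R :=
  (1 / 2 : ℝ) • AlternatingMap.alternatizeUncurryFin (koszulAux φ)

theorem koszulAlt_apply (φ : Form R L k) (v : Fin (k + 1) → L) : koszulAlt φ v = koszul φ v := by
  rw [koszulAlt, AlternatingMap.smul_apply, koszul_eq, two_mul, ← two_smul ℝ (koszul φ v),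
    smul_smul]
  norm_num

/-- The de Rham differential, given by the Koszul formula. -/
def extForm (φ : Form R L k) : Form R L (k + 1) where
  toFun := koszul φ
  map_update_add' := @fun hd v i x y => by
    obtain rfl : hd = instDecidableEqFin _ := Subsingleton.elim _ _
    simp only [← koszulAlt_apply, AlternatingMap.map_update_add]
  map_update_smul' := @fun hd v i f x => by
    obtain rfl : hd = instDecidableEqFin _ := Subsingleton.elim _ _
    have key : ∀ y : L, koszul φ (Function.update v i y) =
        ((-1 : ℤ) ^ (i : ℕ) : ℤ) • koszul φ (Matrix.vecCons y (i.removeNth v)) := by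
      intro y
      rw [← koszulAlt_apply, ← koszulAlt_apply, ← Fin.insertNth_removeNth,
        AlternatingMap.map_insertNth]
    rw [key, key, koszul_smul, smul_eq_mul, mul_smul_comm]
  map_eq_zero_of_eq' v i j h hij := by
    rw [← koszulAlt_apply, AlternatingMap.map_eq_zero_of_eq _ v h hij]

theorem extForm_apply (φ : Form R L k) (v : Fin (k + 1) → L) : extForm φ v = koszul φ v := rfl

/-- The de Rham differential as a linear map. -/
def extFormₗ : Form R L k →ₗ[ℝ] Form R L (k + 1) where
  toFun := extForm
  map_add' φ η := by
    ext v
    simp only [extForm_apply, koszul, AlternatingMap.add_apply, lie_add, mul_add,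
      Finset.sum_add_distrib]
    ring
  map_smul' r φ := by
    ext v
    simp only [extForm_apply, koszul, AlternatingMap.smul_apply, LieModule.lie_smul, mul_smul_comm,
      RingHom.id_apply, smul_add, Finset.smul_sum]

/-- The wedge product
`(φ ∧ η)(Y₁, …, Y_{k+l}) = ∑ sgn(σ) φ(Y_{σ(1)}, …, Y_{σ(k)}) η(Y_{σ(k+1)}, …, Y_{σ(k+l)})`, summed
over the `(k, l)`-shuffles. -/
def wedgeForm (k l : ℕ) : Form R L k →ₗ[ℝ] Form R L l →ₗ[ℝ] Form R L (k + l) :=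
  LinearMap.mk₂ ℝ (fun φ η => ((LinearMap.mul' R R).compAlternatingMap
      (φ.domCoprod η)).domDomCongr finSumFinEquiv)
    (fun φ φ' η => by
      ext v
      change LinearMap.mul' R R (AlternatingMap.domCoprod' ((φ + φ') ⊗ₜ η) _) =
        LinearMap.mul' R R (AlternatingMap.domCoprod' (φ ⊗ₜ η) _) +
        LinearMap.mul' R R (AlternatingMap.domCoprod' (φ' ⊗ₜ η) _)
      rw [TensorProduct.add_tmul, map_add, AlternatingMap.add_apply, map_add])
    (fun r φ η => by
      ext v
      change LinearMap.mul' R R (AlternatingMap.domCoprod' ((r • φ) ⊗ₜ η) _) =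
        r • LinearMap.mul' R R (AlternatingMap.domCoprod' (φ ⊗ₜ η) _)
      have h : r • φ = algebraMap ℝ R r • φ := by
        ext u
        exact (algebraMap_smul R r (φ u)).symm
      rw [h, ← algebraMap_smul R r, ← TensorProduct.smul_tmul', map_smul,
        AlternatingMap.smul_apply, map_smul])
    (fun φ η η' => by
      ext v
      change LinearMap.mul' R R (AlternatingMap.domCoprod' (φ ⊗ₜ (η + η')) _) =
        LinearMap.mul' R R (AlternatingMap.domCoprod' (φ ⊗ₜ η) _) +
        LinearMap.mul' R R (AlternatingMap.domCoprod' (φ ⊗ₜ η') _)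
      rw [TensorProduct.tmul_add, map_add, AlternatingMap.add_apply, map_add])
    (fun r φ η => by
      ext v
      change LinearMap.mul' R R (AlternatingMap.domCoprod' (φ ⊗ₜ (r • η)) _) =
        r • LinearMap.mul' R R (AlternatingMap.domCoprod' (φ ⊗ₜ η) _)
      have h : r • η = algebraMap ℝ R r • η := by
        ext u
        exact (algebraMap_smul R r (η u)).symm
      rw [h, ← algebraMap_smul R r, TensorProduct.tmul_smul, map_smul,
        AlternatingMap.smul_apply, map_smul])

variable (R L) in
/-- The algebra of forms, `Ω = ⨁ₖ Ωᵏ`. -/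
abbrev Forms := ⨁ k, Form R L k

/-- The de Rham differential on `Ω`. -/
def dDR : Forms R L →ₗ[ℝ] Forms R L :=
  DirectSum.toModule ℝ ℕ _ fun k => DirectSum.lof ℝ ℕ (Form R L) (k + 1) ∘ₗ extFormₗ

/-- The Lie derivative on `Ω`. -/
def lieDer (X : L) : Forms R L →ₗ[ℝ] Forms R L :=
  DirectSum.toModule ℝ ℕ _ fun k => DirectSum.lof ℝ ℕ (Form R L) k ∘ₗ lieFormₗ X

/-- The contraction on `Ω`. -/
def contraction (X : L) : Forms R L →ₗ[ℝ] Forms R L :=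
  DirectSum.toModule ℝ ℕ _ fun k => match k with
    | 0 => 0
    | k + 1 => DirectSum.lof ℝ ℕ (Form R L) k ∘ₗ contractForm X

/-- The wedge product on `Ω`. -/
def wedge : Forms R L →ₗ[ℝ] Forms R L →ₗ[ℝ] Forms R L :=
  DirectSum.toModule ℝ ℕ _ fun k => (DirectSum.toModule ℝ ℕ (Form R L k →ₗ[ℝ] Forms R L)
    fun l => ((wedgeForm k l).compr₂ (DirectSum.lof ℝ ℕ (Form R L) (k + l))).flip).flip

/-- The function `1`, as an element of `Ω`. -/
def oneForm : Forms R L :=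
  DirectSum.lof ℝ ℕ (Form R L) 0 (AlternatingMap.constOfIsEmpty R L (Fin 0) 1)

end Forms

section LieWeil

variable (𝔤 : Type*) [LieRing 𝔤] [LieAlgebra ℝ 𝔤]

/-- The Weil algebra `W(𝔤) = Λ𝔤* ⊗ S𝔤*` of a Lie algebra. -/
abbrev LieWeil :=
  ExteriorAlgebra ℝ (Module.Dual ℝ 𝔤) ⊗[ℝ] SymmetricAlgebra ℝ (Module.Dual ℝ 𝔤)

variable {𝔤}

/-- The generator `θ` of degree one given by `ξ ∈ 𝔤*`. -/
def theta (ξ : Module.Dual ℝ 𝔤) : LieWeil 𝔤 := ExteriorAlgebra.ι ℝ ξ ⊗ₜ 1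

/-- The generator `μ` of degree two given by `ξ ∈ 𝔤*`. -/
def mu (ξ : Module.Dual ℝ 𝔤) : LieWeil 𝔤 := 1 ⊗ₜ SymmetricAlgebra.ι ℝ (Module.Dual ℝ 𝔤) ξ

/-- The parity involution of `W(𝔤)`: the identity on even elements, minus the identity on odd
elements. As `S𝔤*` is even, it is the grading involution of `Λ𝔤*`. -/
def weilParity : LieWeil 𝔤 →ₗ[ℝ] LieWeil 𝔤 :=
  TensorProduct.map (CliffordAlgebra.involute
    (Q := (0 : QuadraticForm ℝ (Module.Dual ℝ 𝔤)))).toLinearMap LinearMap.id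

/-- The partial derivative with respect to a generator `θ`: contraction with `u ∈ 𝔤`. -/
def derivTheta (u : 𝔤) : LieWeil 𝔤 →ₗ[ℝ] LieWeil 𝔤 :=
  TensorProduct.map (CliffordAlgebra.contractLeft
    (Q := (0 : QuadraticForm ℝ (Module.Dual ℝ 𝔤))) (Module.Dual.eval ℝ 𝔤 u)) LinearMap.id

variable {ι : Type*} [Fintype ι] [DecidableEq ι] (b : Module.Basis ι ℝ 𝔤)

/-- The partial derivative of a polynomial in the dual basis with respect to its `i`-th variable. -/
def derivSym (i : ι) : SymmetricAlgebra ℝ (Module.Dual ℝ 𝔤) →ₗ[ℝ]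
    SymmetricAlgebra ℝ (Module.Dual ℝ 𝔤) :=
  (SymmetricAlgebra.equivMvPolynomial b.dualBasis).symm.toLinearMap ∘ₗ
    (MvPolynomial.pderiv (R := ℝ) i).toLinearMap ∘ₗ
      (SymmetricAlgebra.equivMvPolynomial b.dualBasis).toLinearMap

/-- The partial derivative with respect to the generator `μⁱ`. -/
def derivMu (i : ι) : LieWeil 𝔤 →ₗ[ℝ] LieWeil 𝔤 :=
  TensorProduct.map LinearMap.id (derivSym b i)

/-- The structure constants, `[b_j, b_k] = ∑ᵢ cⁱ_{jk} b_i`. -/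
def structConst (i j k : ι) : ℝ := b.repr ⁅b j, b k⁆ i

/-- The differential of `W(𝔤)`: the derivation with
`d_W θⁱ = μⁱ - ½ ∑ cⁱ_{jk} θʲ θᵏ` and `d_W μⁱ = - ∑ cⁱ_{jk} θʲ μᵏ`. -/
def dWeil : LieWeil 𝔤 →ₗ[ℝ] LieWeil 𝔤 :=
  (∑ i, LinearMap.mulLeft ℝ (mu (b.coord i) - (1 / 2 : ℝ) • ∑ j, ∑ k,
      structConst b i j k • (theta (b.coord j) * theta (b.coord k))) ∘ₗ derivTheta (b i)) +
    ∑ i, LinearMap.mulLeft ℝ (- ∑ j, ∑ k,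
      structConst b i j k • (theta (b.coord j) * mu (b.coord k))) ∘ₗ derivMu b i

end LieWeil

section BRST

variable (𝔤 : Type*) [LieRing 𝔤] [LieAlgebra ℝ 𝔤]
  (R L : Type*) [CommRing R] [Algebra ℝ R] [LieRing L] [Module R L] [LieAlgebra ℝ L]
  [LieRingModule L R] [LieRinehartRing R L] [LieRinehartAlgebra ℝ R L]

/-- The BRST algebra `W(𝔤) ⊗ Ω`. -/
abbrev BRST := LieWeil 𝔤 ⊗[ℝ] Forms R L

variable {𝔤 R L}

/-- The product of the graded tensor product: `(a ⊗ φ)(b ⊗ η) = (-1)^{|φ||b|} ab ⊗ φ ∧ η`. -/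
def brstMul : BRST 𝔤 R L →ₗ[ℝ] BRST 𝔤 R L →ₗ[ℝ] BRST 𝔤 R L :=
  TensorProduct.lift (DirectSum.toModule ℝ ℕ (LieWeil 𝔤 →ₗ[ℝ] BRST 𝔤 R L →ₗ[ℝ] BRST 𝔤 R L)
    fun k => ((TensorProduct.mapBilinear (RingHom.id ℝ) (LieWeil 𝔤) (Forms R L) (LieWeil 𝔤) (Forms R L)).compl₁₂
      ((LinearMap.lcomp ℝ (LieWeil 𝔤) (weilParity ^ k)) ∘ₗ LinearMap.mul ℝ (LieWeil 𝔤))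
      (wedge ∘ₗ DirectSum.lof ℝ ℕ (Form R L) k)).flip).flip

theorem brstMul_apply (a b : LieWeil 𝔤) (k : ℕ) (φ : Form R L k) (η : Forms R L) :
    brstMul (a ⊗ₜ DirectSum.lof ℝ ℕ (Form R L) k φ) (b ⊗ₜ η) =
      (a * (weilParity ^ k) b) ⊗ₜ wedge (DirectSum.lof ℝ ℕ (Form R L) k φ) η := by
  simp [brstMul]

variable {ι : Type*} [Fintype ι] [DecidableEq ι] (b : Module.Basis ι ℝ 𝔤) (ρ : 𝔤 →ₗ⁅ℝ⁆ L)

/-- The differential `δ = d_W ⊗ 1 + 1 ⊗ d_DR + ∑ₐ θᵃ ⊗ L_a - ∑ₐ μᵃ ⊗ ι_a`. As usual, an operator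
`x ⊗ D` on the graded tensor product acts by `(x ⊗ D)(a ⊗ φ) = (-1)^{|D||a|} x a ⊗ D φ`. -/
def brstDiff : BRST 𝔤 R L →ₗ[ℝ] BRST 𝔤 R L :=
  TensorProduct.map (dWeil b) LinearMap.id + TensorProduct.map weilParity (dDR (R := R) (L := L)) +
    (∑ a, TensorProduct.map (LinearMap.mulLeft ℝ (theta (b.coord a))) (lieDer (R := R) (ρ (b a)))) +
    ∑ a, TensorProduct.map (LinearMap.mulLeft ℝ (- mu (b.coord a)) ∘ₗ weilParity)
      (contraction (R := R) (ρ (b a)))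

/-- The elements of bidegree `(p, q)` of `W(𝔤) ⊗ Ω`, where `θ`, `μ` and the one-forms have
bidegrees `(1, 0)`, `(1, 1)` and `(0, 1)`. -/
def brstBidegree (p q : ℕ) : Submodule ℝ (BRST 𝔤 R L) :=
  Submodule.span ℝ {z | ∃ u v w : ℕ, v + w = p ∧ u + v = q ∧
    ∃ x ∈ LinearMap.range (ExteriorAlgebra.ι ℝ (M := Module.Dual ℝ 𝔤)) ^ w,
    ∃ y ∈ LinearMap.range (SymmetricAlgebra.ι ℝ (Module.Dual ℝ 𝔤)) ^ v,
    ∃ φ : Form R L u, z = (x ⊗ₜ y) ⊗ₜ DirectSum.lof ℝ ℕ (Form R L) u φ}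

end BRST

section WeilCochains

variable (R L G : Type*) [CommRing R] [Algebra ℝ R] [AddCommGroup L] [Module R L]
  [AddCommGroup G] [Module R G]

/-- Families of functions `c n v (e₁, …, e_n) (β₁, …, β_v)` of `n` elements `eᵢ = (Xᵢ, αᵢ)` of
`L × G` and `v` elements `βⱼ` of `G`. -/
abbrev WeilCochain := ∀ n v : ℕ, (Fin n → L × G) → (Fin v → G) → R

/-- The space `⨁_{n, v} Λⁿ(L* ⊕ G*) ⊗ SᵛG*` of families with finitely many nonzero members that are
`R`-multilinear, alternating in the `eᵢ` and symmetric in the `βⱼ`.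
With `L = 𝔛(M)`, `R = C^∞(M)` and `G` the module of sections of a vector bundle `A` this is
`⨁_{u, v, w} Γ(Λᵘ T*M ⊗ Sᵛ A* ⊗ Λʷ A*)`, as `Λⁿ(T*M ⊕ A*) = ⨁_{u + w = n} Λᵘ T*M ⊗ Λʷ A*`. -/
def WeilAlgebra : Submodule ℝ (WeilCochain R L G) where
  carrier := {c |
    (∀ n v β, ∃ F : (L × G) [⋀^Fin n]→ₗ[R] R, ∀ e, F e = c n v e β) ∧
    (∀ n v e, ∃ F : MultilinearMap R (fun _ : Fin v => G) R, ∀ β, F β = c n v e β) ∧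
    (∀ n v e β (σ : Equiv.Perm (Fin v)), c n v e (β ∘ σ) = c n v e β) ∧
    ∃ N, ∀ n v, N ≤ n + v → c n v = 0}
  add_mem' := by
    rintro c c' ⟨h1, h2, h3, N, hN⟩ ⟨h1', h2', h3', N', hN'⟩
    refine ⟨fun n v β => ?_, fun n v e => ?_, fun n v e β σ => ?_, max N N', fun n v h => ?_⟩
    · obtain ⟨F, hF⟩ := h1 n v β
      obtain ⟨F', hF'⟩ := h1' n v β
      exact ⟨F + F', fun e => congrArg₂ (· + ·) (hF e) (hF' e)⟩
    · obtain ⟨F, hF⟩ := h2 n v e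
      obtain ⟨F', hF'⟩ := h2' n v e
      exact ⟨F + F', fun β => congrArg₂ (· + ·) (hF β) (hF' β)⟩
    · exact congrArg₂ (· + ·) (h3 n v e β σ) (h3' n v e β σ)
    · change c n v + c' n v = 0
      rw [hN n v (le_trans (le_max_left _ _) h), hN' n v (le_trans (le_max_right _ _) h), add_zero]
  zero_mem' := ⟨fun _ _ _ => ⟨0, fun _ => rfl⟩, fun _ _ _ => ⟨0, fun _ => rfl⟩,
    fun _ _ _ _ _ => rfl, 0, fun _ _ _ => rfl⟩
  smul_mem' := by
    rintro r c ⟨h1, h2, h3, N, hN⟩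
    refine ⟨fun n v β => ?_, fun n v e => ?_, fun n v e β σ => ?_, N, fun n v h => ?_⟩
    · obtain ⟨F, hF⟩ := h1 n v β
      exact ⟨r • F, fun e => congrArg (r • ·) (hF e)⟩
    · obtain ⟨F, hF⟩ := h2 n v e
      exact ⟨r • F, fun β => congrArg (r • ·) (hF β)⟩
    · exact congrArg (r • ·) (h3 n v e β σ)
    · change r • c n v = 0
      rw [hN n v h, smul_zero]

variable {R L G}

/-- The sign `(-1)^{#{(i, j) ∈ S × Sᶜ, j < i}}` of the shuffle that puts the elements of `S` first. -/
def shuffleSign {n : ℕ} (S : Finset (Fin n)) : ℤ :=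
  (-1) ^ ((S ×ˢ Sᶜ).filter fun p => p.2 < p.1).card

/-- The product of cochains: the wedge product in the `eᵢ`, with signs, and the symmetric product in
the `βⱼ`, both summed over shuffles. -/
def weilMul (a b : WeilCochain R L G) : WeilCochain R L G := fun n v e β =>
  ∑ S : Finset (Fin n), ∑ T : Finset (Fin v), shuffleSign S •
    (a S.card T.card (e ∘ S.orderEmbOfFin rfl) (β ∘ T.orderEmbOfFin rfl) *
      b Sᶜ.card Tᶜ.card (e ∘ Sᶜ.orderEmbOfFin rfl) (β ∘ Tᶜ.orderEmbOfFin rfl))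

/-- The cochains of bidegree `(p, q)`, that is, with values in the sum of the
`Λᵘ L* ⊗ Sᵛ G* ⊗ Λʷ G*` with `p = v + w` and `q = u + v`: the degrees `u` and `w` are those of
homogeneity in the `Xᵢ` and in the `αᵢ`. -/
def HasWeilBidegree (p q : ℕ) (c : WeilCochain R L G) : Prop :=
  ∀ n v : ℕ, (v ≤ p ∧ v ≤ q ∧ n + 2 * v = p + q →
      ∀ (s t : R) (e : Fin n → L × G) (β : Fin v → G),
        c n v (fun i => (s • (e i).1, t • (e i).2)) β =
          s ^ (q - v) * t ^ (p - v) * c n v e β) ∧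
    (¬ (v ≤ p ∧ v ≤ q ∧ n + 2 * v = p + q) → c n v = 0)

/-- A form of degree `k`, seen as a cochain. -/
def weilForm {k : ℕ} (φ : L [⋀^Fin k]→ₗ[R] R) : WeilCochain R L G := fun n v e _ =>
  if h : n = k ∧ v = 0 then φ fun i => (e (Fin.cast h.1.symm i)).1 else 0

/-- The cochain in `Λ¹G*` given by a linear form on `G`. -/
def weilTheta (l : G →ₗ[R] R) : WeilCochain R L G := fun n v e _ =>
  if h : n = 1 ∧ v = 0 then l (e (Fin.cast h.1.symm 0)).2 else 0

/-- The cochain in `S¹G*` given by a linear form on `G`. -/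
def weilMu (l : G →ₗ[R] R) : WeilCochain R L G := fun n v _ β =>
  if h : n = 0 ∧ v = 1 then l (β (Fin.cast h.2.symm 0)) else 0

/-- For `j : G → L × G`, the operator
`c ↦ ∑ₖ c(j(βₖ), e₁, …, e_n ; β₁, …, β̂ₖ, …, β_v)`. -/
def insertTerm (j : G → L × G) (c : WeilCochain R L G) : WeilCochain R L G :=
  fun n v e β => match v, β with
    | 0, _ => 0
    | v + 1, β => ∑ k : Fin (v + 1), c (n + 1) v (Matrix.vecCons (j (β k)) e) (k.removeNth β)

/-- The Koszul formula for the covariant exterior derivative with respect to the operators `act` on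
functions, `cov` on the arguments `βₖ`, and the bracket `br` on the arguments `eᵢ`:
`∑ᵢ (-1)ⁱ (act eᵢ (c(…, êᵢ, … ; β)) - ∑ₖ c(…, êᵢ, … ; β₁, …, cov eᵢ βₖ, …, β_v))`
`  + ∑_{i < j} (-1)ʲ c(…, br eᵢ eⱼ, …, êⱼ, … ; β)` with `br eᵢ eⱼ` at the place of `eᵢ`, for indices
starting from `0`; in the second sum the pairs `i < j` are written `(i.castSucc, j.succ)`. -/
def koszulTerm (act : L × G → R → R) (cov : L × G → G → G) (br : L × G → L × G → L × G)
    (c : WeilCochain R L G) : WeilCochain R L G :=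
  fun n v e β => match n, e with
    | 0, _ => 0
    | n + 1, e =>
      ∑ i : Fin (n + 1), (-1) ^ (i : ℕ) * (act (e i) (c n v (i.removeNth e) β) -
          ∑ k : Fin v, c n v (i.removeNth e) (Function.update β k (cov (e i) (β k)))) +
        ∑ i : Fin n, ∑ j ∈ Finset.Ici i, (-1) ^ ((j : ℕ) + 1) *
          c n v (j.succ.removeNth (Function.update e i.castSucc (br (e i.castSucc) (e j.succ)))) β

/-- For a map `K` with values in `G`, the operator
`c ↦ 1 / (2 n!) ∑_σ sgn(σ) c(e_{σ(3)}, …, e_{σ(n+2)} ; K(e_{σ(0)}, e_{σ(1)}, e_{σ(2)}), β₁, …, β_v)`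
that raises the number of the `eᵢ` by three. -/
def curvatureTerm (K : L × G → L × G → L × G → G) (c : WeilCochain R L G) : WeilCochain R L G :=
  fun n v e β => match n, e with
    | n + 3, e => ((2 * n.factorial : ℝ)⁻¹) • ∑ σ : Equiv.Perm (Fin (n + 3)),
        (Equiv.Perm.sign σ : ℤ) • c n (v + 1) (fun k => e (σ (k.addNat 3)))
          (Matrix.vecCons (K (e (σ 0)) (e (σ 1)) (e (σ 2))) β)
    | _, _ => 0

end WeilCochains

section Geometry

variable {E : Type*} [NormedAddCommGroup E] [NormedSpace ℝ E]
  {H : Type*} [TopologicalSpace H] {I : ModelWithCorners ℝ E H}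
  {M : Type*} [TopologicalSpace M] [ChartedSpace H M]

section Sections

variable {F : Type*} [NormedAddCommGroup F] [NormedSpace ℝ F]
  {V : M → Type*} [TopologicalSpace (Bundle.TotalSpace F V)]
  [∀ x, AddCommGroup (V x)] [∀ x, Module ℝ (V x)] [∀ x, TopologicalSpace (V x)]
  [FiberBundle F V] [VectorBundle ℝ F V]

instance sectionSMul : SMul C^∞⟮I, M; ℝ⟯ Cₛ^∞⟮I; F, V⟯ where
  smul f s := ⟨fun x => f x • s x, f.contMDiff.smul_section s.contMDiff⟩

@[simp] theorem section_smul_apply (f : C^∞⟮I, M; ℝ⟯) (s : Cₛ^∞⟮I; F, V⟯) (x : M) :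
    (f • s) x = f x • s x := rfl

/-- Smooth sections of a vector bundle form a module over the smooth functions. -/
instance sectionModule : Module C^∞⟮I, M; ℝ⟯ Cₛ^∞⟮I; F, V⟯ where
  one_smul s := by ext x; simp
  mul_smul f g s := by ext x; simp [mul_smul]
  smul_zero f := by ext x; simp
  smul_add f s t := by ext x; simp
  add_smul f g s := by ext x; simp [add_smul]
  zero_smul s := by ext x; simp

instance sectionScalarTower : IsScalarTower ℝ C^∞⟮I, M; ℝ⟯ Cₛ^∞⟮I; F, V⟯ where
  smul_assoc r f s := by ext x; simp [mul_smul]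

end Sections

variable [IsManifold I ∞ M] [T2Space M]

variable (I M) in
/-- Smooth vector fields on `M`. -/
abbrev VField := Cₛ^∞⟮I; E, (TangentSpace I : M → Type _)⟯

theorem contMDiff_mvfderiv_apply {F : Type*} [NormedAddCommGroup F] [NormedSpace ℝ F]
    (X : VField I M) {f : M → F} (hf : ContMDiff I 𝓘(ℝ, F) ∞ f) :
    ContMDiff I 𝓘(ℝ, F) ∞ (fun x => mvfderiv I f x (X x)) := by
  have h1 : ContMDiff I.tangent 𝓘(ℝ, F).tangent ∞ (tangentMap I 𝓘(ℝ, F) f) :=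
    hf.contMDiff_tangentMap (by simp)
  exact (contMDiff_snd_tangentBundle_modelSpace F 𝓘(ℝ, F)).comp (h1.comp X.contMDiff)

/-- The derivative `X(f)` of a smooth function along a vector field. -/
def VField.deriv (X : VField I M) (f : C^∞⟮I, M; ℝ⟯) : C^∞⟮I, M; ℝ⟯ :=
  ⟨fun x => mvfderiv I f x (X x), contMDiff_mvfderiv_apply X f.contMDiff⟩

section Bracket
variable [FiniteDimensional ℝ E]

/-- The Lie bracket of vector fields. -/
instance vfieldBracket : Bracket (VField I M) (VField I M) where
  bracket X Y := ⟨VectorField.mlieBracket I X Y, by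
    have : CompleteSpace E := FiniteDimensional.complete ℝ E
    have : IsManifold I (minSmoothness ℝ 2) M := by
      rw [minSmoothness_of_isRCLikeNormedField]; infer_instance
    have : IsManifold I (((⊤ : ℕ∞) : WithTop ℕ∞) + 1) M := ‹IsManifold I ∞ M›
    exact ContDiff.mlieBracket_vectorField (m := ⊤) (n := ⊤) X.contMDiff Y.contMDiff (by simp)⟩

/-- Vector fields act on smooth functions by directional derivatives. -/
instance vfieldBracketFun : Bracket (VField I M) C^∞⟮I, M; ℝ⟯ where
  bracket X f := X.deriv f

theorem vfield_lie_apply (X Y : VField I M) (x : M) :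
    ⁅X, Y⁆ x = VectorField.mlieBracket I X Y x := rfl

theorem vfield_lie_fun_apply (X : VField I M) (f : C^∞⟮I, M; ℝ⟯) (x : M) :
    ⁅X, f⁆ x = mvfderiv I f x (X x) := rfl

theorem vfield_leibniz (X Y Z : VField I M) : ⁅X, ⁅Y, Z⁆⁆ = ⁅⁅X, Y⁆, Z⁆ + ⁅Y, ⁅X, Z⁆⁆ := by
  have : CompleteSpace E := FiniteDimensional.complete ℝ E
  have : IsManifold I (minSmoothness ℝ 3) M := by
    rw [minSmoothness_of_isRCLikeNormedField]; infer_instance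
  have hle : minSmoothness ℝ 2 ≤ (∞ : WithTop ℕ∞) := by
    rw [minSmoothness_of_isRCLikeNormedField]; exact WithTop.coe_le_coe.2 le_top
  ext x
  exact VectorField.leibniz_identity_mlieBracket_apply ((X.contMDiff x).of_le hle)
    ((Y.contMDiff x).of_le hle) ((Z.contMDiff x).of_le hle)

instance vfieldLieRing : LieRing (VField I M) where
  add_lie X Y Z := by
    ext x
    exact VectorField.mlieBracket_add_left X.mdifferentiableAt Y.mdifferentiableAt
  lie_add X Y Z := by
    ext x
    exact VectorField.mlieBracket_add_right Y.mdifferentiableAt Z.mdifferentiableAt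
  lie_self X := by
    ext x
    simp [vfield_lie_apply]
  leibniz_lie := vfield_leibniz

instance vfieldLieAlgebra : LieAlgebra ℝ (VField I M) where
  lie_smul r X Y := by
    ext x
    exact VectorField.mlieBracket_const_smul_right Y.mdifferentiableAt

theorem vfield_lie_smul (X Y : VField I M) (f : C^∞⟮I, M; ℝ⟯) :
    ⁅X, f • Y⁆ = f • ⁅X, Y⁆ + ⁅X, f⁆ • Y := by
  ext x
  have := VectorField.mlieBracket_smul_right (V := X) (W := Y) (f := f) (x := x)
    f.mdifferentiableAt Y.mdifferentiableAt
  rw [add_comm]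
  exact this

/-- Every tangent vector extends to a smooth vector field. -/
theorem exists_vfield_apply_eq (x : M) (v : TangentSpace I x) :
    ∃ Z : VField I M, Z x = v := by
  obtain ⟨s, hs, hsm⟩ := FiberBundle.exists_contMDiffOn_extend (k := ∞) I E v
  obtain ⟨u, hus, huo, hxu⟩ := mem_nhds_iff.1 hs
  obtain ⟨ψ, -, hψ⟩ := (SmoothBumpFunction.nhds_basis_tsupport (I := I) x).mem_iff.1
    (huo.mem_nhds hxu)
  refine ⟨⟨fun y => ψ y • FiberBundle.extend E v y, ?_⟩, ?_⟩
  · exact ContMDiffOn.smul_section_of_tsupport ψ.contMDiff.contMDiffOn huo hψ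
      (hsm.mono hus)
  · change ψ x • FiberBundle.extend E v x = v
    simp

/-- The commutator formula `[X, Y](f) = X(Y(f)) - Y(X(f))`. -/
theorem vfield_lie_lie_fun (X Y : VField I M) (f : C^∞⟮I, M; ℝ⟯) :
    ⁅⁅X, Y⁆, f⁆ = ⁅X, ⁅Y, f⁆⁆ - ⁅Y, ⁅X, f⁆⁆ := by
  ext x
  by_cases hE : Subsingleton E
  · have h0 : ∀ v : TangentSpace I x, v = 0 := fun v => Subsingleton.elim (α := E) v 0
    change mvfderiv I f x _ = mvfderiv I _ x _ - mvfderiv I _ x _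
    rw [h0 (⁅X, Y⁆ x), h0 (X x), h0 (Y x)]
    simp
  rw [not_subsingleton_iff_nontrivial] at hE
  obtain ⟨v, hv⟩ := exists_ne (0 : E)
  obtain ⟨Z, hZ⟩ := exists_vfield_apply_eq (I := I) x v
  have h := vfield_leibniz X Y (f • Z)
  simp only [vfield_lie_smul, lie_add] at h
  have h2 := vfield_leibniz X Y Z
  have h3 : ⁅⁅X, Y⁆, f⁆ • Z = (⁅X, ⁅Y, f⁆⁆ - ⁅Y, ⁅X, f⁆⁆) • Z := by
    linear_combination (norm := module) f • h2 - h
  have h4 := congrArg (fun W : VField I M => W x) h3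
  simp only [section_smul_apply, hZ] at h4
  exact smul_left_injective ℝ hv h4

/-- Vector fields and smooth functions act on one another as Lie-Rinehart algebras do. -/
instance vfieldLieRingModule : LieRingModule (VField I M) C^∞⟮I, M; ℝ⟯ where
  add_lie X Y f := by
    ext x
    exact map_add (mvfderiv I f x) (X x) (Y x)
  lie_add X f g := by
    ext x
    change mvfderiv I (f + g : M → ℝ) x (X x) = _
    rw [mvfderiv_add f.mdifferentiableAt g.mdifferentiableAt]
    rfl
  leibniz_lie X Y f := by
    rw [vfield_lie_lie_fun, sub_add_cancel]

theorem vfield_lie_mul (X : VField I M) (f g : C^∞⟮I, M; ℝ⟯) :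
    ⁅X, f * g⁆ = f * ⁅X, g⁆ + ⁅X, f⁆ * g := by
  ext x
  change mvfderiv I (f * g : M → ℝ) x (X x) = f x * mvfderiv I g x (X x) +
    mvfderiv I f x (X x) * g x
  rw [mvfderiv_mul f.mdifferentiableAt g.mdifferentiableAt]
  simp [mul_comm]

instance vfieldLieRinehartRing : LieRinehartRing C^∞⟮I, M; ℝ⟯ (VField I M) where
  lie_smul_eq_mul' f g X := by
    ext x
    exact map_smul (mvfderiv I g x) (f x) (X x)
  leibniz_mul_right' := vfield_lie_mul
  leibniz_smul_right' X Y f := vfield_lie_smul X Y f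

theorem vfield_lie_const (X : VField I M) (r : ℝ) :
    ⁅X, algebraMap ℝ C^∞⟮I, M; ℝ⟯ r⁆ = 0 := by
  ext x
  change mvfderiv I (fun _ : M => r) x (X x) = 0
  rw [mvfderiv_const]
  rfl

instance vfieldLieModule : LieModule ℝ (VField I M) C^∞⟮I, M; ℝ⟯ where
  smul_lie r X f := by
    ext x
    exact map_smul (mvfderiv I f x) r (X x)
  lie_smul r X f := by
    rw [Algebra.smul_def, vfield_lie_mul, vfield_lie_const, zero_mul, add_zero, Algebra.smul_def]

instance vfieldLieRinehartAlgebra :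
    LieRinehartAlgebra ℝ C^∞⟮I, M; ℝ⟯ (VField I M) where

end Bracket

section Algebroids

variable [FiniteDimensional ℝ E]
variable (I) (F : Type*) [NormedAddCommGroup F] [NormedSpace ℝ F]
  (V : M → Type*) [TopologicalSpace (Bundle.TotalSpace F V)]
  [∀ x, AddCommGroup (V x)] [∀ x, Module ℝ (V x)] [∀ x, TopologicalSpace (V x)]
  [FiberBundle F V] [VectorBundle ℝ F V] [ContMDiffVectorBundle ∞ F V I]

/-- A Lie algebroid structure on the vector bundle `V` over `M`: a bundle map `V → TM` (the anchor)
and a Lie bracket on the smooth sections of `V`, related by the Leibniz identity. -/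
structure LieAlgebroid where
  anchor : ∀ x, V x →ₗ[ℝ] TangentSpace I x
  contMDiff_anchor : ∀ α : Cₛ^∞⟮I; F, V⟯,
    ContMDiff I I.tangent ∞ (fun x => (⟨x, anchor x (α x)⟩ : TangentBundle I M))
  bracket : Cₛ^∞⟮I; F, V⟯ →ₗ[ℝ] Cₛ^∞⟮I; F, V⟯ →ₗ[ℝ] Cₛ^∞⟮I; F, V⟯
  bracket_self : ∀ α, bracket α α = 0
  jacobi : ∀ α β γ,
    bracket α (bracket β γ) = bracket (bracket α β) γ + bracket β (bracket α γ)
  leibniz : ∀ (α β : Cₛ^∞⟮I; F, V⟯) (f : C^∞⟮I, M; ℝ⟯),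
    bracket α (f • β) = f • bracket α β +
      ⁅(⟨fun x => anchor x (α x), contMDiff_anchor α⟩ : VField I M), f⁆ • β

/-- A connection on the vector bundle `V` over `M`. -/
structure Connection where
  cov : VField I M → Cₛ^∞⟮I; F, V⟯ → Cₛ^∞⟮I; F, V⟯
  add_left : ∀ X Y α, cov (X + Y) α = cov X α + cov Y α
  smul_left : ∀ (f : C^∞⟮I, M; ℝ⟯) X α, cov (f • X) α = f • cov X α
  add_right : ∀ X α β, cov X (α + β) = cov X α + cov X β
  leibniz : ∀ X (f : C^∞⟮I, M; ℝ⟯) α, cov X (f • α) = f • cov X α + ⁅X, f⁆ • α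

variable {I F V}

/-- The anchor on sections. -/
def LieAlgebroid.rho (A : LieAlgebroid I F V) (α : Cₛ^∞⟮I; F, V⟯) : VField I M :=
  ⟨fun x => A.anchor x (α x), A.contMDiff_anchor α⟩

/-- The curvature `R_∇(X, Y)α` of a connection. -/
def Connection.curv (D : Connection I F V) (X Y : VField I M) (α : Cₛ^∞⟮I; F, V⟯) :
    Cₛ^∞⟮I; F, V⟯ :=
  D.cov X (D.cov Y α) - D.cov Y (D.cov X α) - D.cov ⁅X, Y⁆ α

variable (A : LieAlgebroid I F V) (D : Connection I F V)

/-- The basic connection on `A`, `∇^bas_α β = ∇_{ρ(β)} α + [α, β]`. -/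
def LieAlgebroid.basic (α β : Cₛ^∞⟮I; F, V⟯) : Cₛ^∞⟮I; F, V⟯ :=
  D.cov (A.rho β) α + A.bracket α β

/-- The basic connection on `TM`, `∇^bas_α X = ρ(∇_X α) + [ρ(α), X]`. -/
def LieAlgebroid.basicTangent (α : Cₛ^∞⟮I; F, V⟯) (X : VField I M) : VField I M :=
  A.rho (D.cov X α) + ⁅A.rho α, X⁆

/-- The basic curvature
`R^bas(α, β)X = ∇_X[α, β] - [∇_X α, β] - [α, ∇_X β] - ∇_{∇^bas_β X} α + ∇_{∇^bas_α X} β`. -/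
def LieAlgebroid.basicCurv (α β : Cₛ^∞⟮I; F, V⟯) (X : VField I M) : Cₛ^∞⟮I; F, V⟯ :=
  D.cov X (A.bracket α β) - A.bracket (D.cov X α) β - A.bracket α (D.cov X β) -
    D.cov (A.basicTangent D β X) α + D.cov (A.basicTangent D α X) β

/-- The vertical differential of the Weil algebra `W(A, ∇)`: the sum of the dual of the identity
`A → A`, of the covariant exterior derivative of `∇`, and of the contribution of its curvature. -/
def Connection.dVer (c : WeilCochain C^∞⟮I, M; ℝ⟯ (VField I M) Cₛ^∞⟮I; F, V⟯) :
    WeilCochain C^∞⟮I, M; ℝ⟯ (VField I M) Cₛ^∞⟮I; F, V⟯ :=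
  insertTerm (fun β => (0, β)) c +
    koszulTerm (fun e f => ⁅e.1, f⁆) (fun e β => D.cov e.1 β)
      (fun e e' => (⁅e.1, e'.1⁆, D.cov e.1 e'.2 - D.cov e'.1 e.2)) c +
    curvatureTerm (fun e e' e'' => D.curv e.1 e'.1 e''.2) c

/-- The horizontal differential of the Weil algebra `W(A, ∇)`: the sum of minus the dual of the
anchor, of the covariant exterior derivative of the basic connections, and of the contribution of
the basic curvature. -/
def LieAlgebroid.dHor (c : WeilCochain C^∞⟮I, M; ℝ⟯ (VField I M) Cₛ^∞⟮I; F, V⟯) :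
    WeilCochain C^∞⟮I, M; ℝ⟯ (VField I M) Cₛ^∞⟮I; F, V⟯ :=
  -insertTerm (fun β => (A.rho β, 0)) c +
    koszulTerm (fun e f => ⁅A.rho e.2, f⁆) (fun e β => A.basic D e.2 β)
      (fun e e' => (A.basicTangent D e.2 e'.1 - A.basicTangent D e'.2 e.1,
        A.bracket e.2 e'.2)) c +
    curvatureTerm (fun e e' e'' => A.basicCurv D e.2 e'.2 e''.1) c

variable (I F V) in
/-- The underlying bigraded algebra of the Weil algebra of a vector bundle `A`, with the product
`weilMul`: `⨁_{u, v, w} Γ(Λᵘ T*M ⊗ Sᵛ A* ⊗ Λʷ A*)`. -/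
abbrev AlgebroidWeil : Submodule ℝ (WeilCochain C^∞⟮I, M; ℝ⟯ (VField I M) Cₛ^∞⟮I; F, V⟯) :=
  WeilAlgebra C^∞⟮I, M; ℝ⟯ (VField I M) Cₛ^∞⟮I; F, V⟯

end Algebroids

section ActionAlgebroid

variable [FiniteDimensional ℝ E]

/-- The Lie algebra `𝔤`, seen as the typical fibre of a vector bundle. -/
def LieFibre (𝔤 : Type*) := 𝔤

variable {𝔤 : Type*} [LieRing 𝔤] [LieAlgebra ℝ 𝔤] [FiniteDimensional ℝ 𝔤]

/-- The norm is the sup norm in the coordinates of some basis; it only serves to express that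
maps to the finite-dimensional space `𝔤` are smooth, and all norms give the same answer. -/
instance : NormedAddCommGroup (LieFibre 𝔤) :=
  NormedAddCommGroup.induced 𝔤 (Fin (Module.finrank ℝ 𝔤) → ℝ)
    (Module.finBasis ℝ 𝔤).equivFun.toLinearMap (Module.finBasis ℝ 𝔤).equivFun.injective

instance : NormedSpace ℝ (LieFibre 𝔤) :=
  NormedSpace.induced ℝ 𝔤 (Fin (Module.finrank ℝ 𝔤) → ℝ)
    (Module.finBasis ℝ 𝔤).equivFun.toLinearMap

/-- The identity map of `𝔤`. -/
def toFibre : 𝔤 ≃ₗ[ℝ] LieFibre 𝔤 where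
  toFun v := v
  invFun v := v
  map_add' _ _ := rfl
  map_smul' _ _ := rfl
  left_inv _ := rfl
  right_inv _ := rfl

instance : FiniteDimensional ℝ (LieFibre 𝔤) :=
  (toFibre (𝔤 := 𝔤)).finiteDimensional

variable (M 𝔤) in
/-- The trivial vector bundle `M × 𝔤` over `M`. -/
def ActionBundle : M → Type _ := Bundle.Trivial M (LieFibre 𝔤)

instance : TopologicalSpace (Bundle.TotalSpace (LieFibre 𝔤) (ActionBundle M 𝔤)) :=
  inferInstanceAs (TopologicalSpace (Bundle.TotalSpace (LieFibre 𝔤) (Bundle.Trivial M (LieFibre 𝔤))))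

instance (x : M) : AddCommGroup (ActionBundle M 𝔤 x) :=
  inferInstanceAs (AddCommGroup (LieFibre 𝔤))

instance (x : M) : Module ℝ (ActionBundle M 𝔤 x) :=
  inferInstanceAs (Module ℝ (LieFibre 𝔤))

instance (x : M) : TopologicalSpace (ActionBundle M 𝔤 x) :=
  inferInstanceAs (TopologicalSpace (LieFibre 𝔤))

instance : FiberBundle (LieFibre 𝔤) (ActionBundle M 𝔤) :=
  inferInstanceAs (FiberBundle (LieFibre 𝔤) (Bundle.Trivial M (LieFibre 𝔤)))

instance : VectorBundle ℝ (LieFibre 𝔤) (ActionBundle M 𝔤) :=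
  inferInstanceAs (VectorBundle ℝ (LieFibre 𝔤) (Bundle.Trivial M (LieFibre 𝔤)))

instance : ContMDiffVectorBundle ∞ (LieFibre 𝔤) (ActionBundle M 𝔤) I :=
  inferInstanceAs (ContMDiffVectorBundle ∞ (LieFibre 𝔤) (Bundle.Trivial M (LieFibre 𝔤)) I)

variable (I M 𝔤) in
/-- The smooth sections of the trivial bundle `M × 𝔤`, that is, the smooth maps from `M` to `𝔤`. -/
abbrev GSection := Cₛ^∞⟮I; LieFibre 𝔤, ActionBundle M 𝔤⟯

theorem contMDiff_trivial_iff (f : M → LieFibre 𝔤) :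
    ContMDiff I (I.prod 𝓘(ℝ, LieFibre 𝔤)) ∞
      (fun x => Bundle.TotalSpace.mk' (LieFibre 𝔤) (E := ActionBundle M 𝔤) x (f x)) ↔
    ContMDiff I 𝓘(ℝ, LieFibre 𝔤) ∞ f := by
  change (∀ x, ContMDiffAt I (I.prod 𝓘(ℝ, LieFibre 𝔤)) ∞ (fun x => Bundle.TotalSpace.mk'
    (LieFibre 𝔤) (E := Bundle.Trivial M (LieFibre 𝔤)) x (f x)) x) ↔ _
  simp only [ContMDiff, Bundle.contMDiffAt_section]
  rfl

/-- The smooth map to `𝔤` underlying a section. -/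
def GSection.toMap (α : GSection I M 𝔤) : M → LieFibre 𝔤 := fun x => α x

theorem GSection.contMDiff_toMap (α : GSection I M 𝔤) :
    ContMDiff I 𝓘(ℝ, LieFibre 𝔤) ∞ α.toMap :=
  (contMDiff_trivial_iff α.toMap).1 α.contMDiff

/-- A smooth map to `𝔤`, as a section. -/
def GSection.ofFun (f : M → LieFibre 𝔤) (hf : ContMDiff I 𝓘(ℝ, LieFibre 𝔤) ∞ f) :
    GSection I M 𝔤 := ⟨f, (contMDiff_trivial_iff f).2 hf⟩

/-- The constant section with value `u`. -/
def GSection.const (u : 𝔤) : GSection I M 𝔤 := .ofFun (fun _ => toFibre u) contMDiff_const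

/-- The derivative of a `𝔤`-valued smooth map along a vector field. -/
def GSection.deriv (X : VField I M) (α : GSection I M 𝔤) : GSection I M 𝔤 :=
  .ofFun (fun x => mvfderiv I α.toMap x (X x))
    (contMDiff_mvfderiv_apply X α.contMDiff_toMap)

/-- The bracket of `𝔤`, as a continuous bilinear map on the fibre. -/
def fibreBracket : LieFibre 𝔤 →L[ℝ] LieFibre 𝔤 →L[ℝ] LieFibre 𝔤 :=
  LinearMap.toContinuousLinearMap (LinearMap.toContinuousLinearMap.toLinearMap ∘ₗ
    (LinearMap.mk₂ ℝ (fun u v : LieFibre 𝔤 => toFibre ⁅toFibre.symm u, toFibre.symm v⁆)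
      (by intros; simp) (by intros; simp) (by intros; simp) (by intros; simp)))

@[simp] theorem fibreBracket_apply (u v : LieFibre 𝔤) :
    fibreBracket u v = toFibre ⁅toFibre.symm u, toFibre.symm v⁆ := rfl

/-- The pointwise bracket of `𝔤`-valued smooth maps. -/
def GSection.pointwise (α β : GSection I M 𝔤) : GSection I M 𝔤 :=
  .ofFun (fun x => toFibre ⁅toFibre.symm (α.toMap x), toFibre.symm (β.toMap x)⁆)
    ((contMDiff_const (c := fibreBracket (𝔤 := 𝔤)).clm_apply α.contMDiff_toMap).clm_apply
      β.contMDiff_toMap)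

theorem GSection.toMap_add (α β : GSection I M 𝔤) : (α + β).toMap = α.toMap + β.toMap := rfl

theorem GSection.toMap_smul (f : C^∞⟮I, M; ℝ⟯) (α : GSection I M 𝔤) :
    (f • α).toMap = (f : M → ℝ) • α.toMap := rfl

theorem GSection.ext_toMap {α β : GSection I M 𝔤} (h : ∀ x, α.toMap x = β.toMap x) : α = β :=
  ContMDiffSection.ext h

theorem GSection.mdifferentiableAt_toMap (α : GSection I M 𝔤) (x : M) :
    MDifferentiableAt I 𝓘(ℝ, LieFibre 𝔤) α.toMap x :=
  α.contMDiff_toMap.mdifferentiable (by simp) x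

theorem GSection.deriv_add_left (X Y : VField I M) (α : GSection I M 𝔤) :
    GSection.deriv (X + Y) α = GSection.deriv X α + GSection.deriv Y α :=
  GSection.ext_toMap fun x => map_add (mvfderiv I α.toMap x) (X x) (Y x)

theorem GSection.deriv_smul_left (f : C^∞⟮I, M; ℝ⟯) (X : VField I M) (α : GSection I M 𝔤) :
    GSection.deriv (f • X) α = f • GSection.deriv X α :=
  GSection.ext_toMap fun x => map_smul (mvfderiv I α.toMap x) (f x) (X x)

theorem GSection.deriv_add (X : VField I M) (α β : GSection I M 𝔤) :
    GSection.deriv X (α + β) = GSection.deriv X α + GSection.deriv X β :=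
  GSection.ext_toMap fun x => by
    change mvfderiv I (α.toMap + β.toMap) x (X x) = _
    rw [mvfderiv_add (α.mdifferentiableAt_toMap x) (β.mdifferentiableAt_toMap x)]
    rfl

theorem GSection.deriv_leibniz (X : VField I M) (f : C^∞⟮I, M; ℝ⟯) (α : GSection I M 𝔤) :
    GSection.deriv X (f • α) = f • GSection.deriv X α + ⁅X, f⁆ • α :=
  GSection.ext_toMap fun x => by
    change mvfderiv I ((f : M → ℝ) • α.toMap) x (X x) = _
    rw [mvfderiv_smul f.mdifferentiableAt (α.mdifferentiableAt_toMap x)]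
    rfl

theorem GSection.deriv_const (X : VField I M) (u : 𝔤) :
    GSection.deriv X (GSection.const u) = 0 :=
  GSection.ext_toMap fun x => by
    change mvfderiv I (fun _ : M => toFibre u) x (X x) = 0
    rw [mvfderiv_const]
    rfl

/-- The canonical flat connection on the trivial bundle `M × 𝔤`. -/
def flatConnection : Connection I (LieFibre 𝔤) (ActionBundle M 𝔤) where
  cov := GSection.deriv
  add_left := GSection.deriv_add_left
  smul_left := GSection.deriv_smul_left
  add_right := GSection.deriv_add
  leibniz := GSection.deriv_leibniz

theorem GSection.pointwise_add_left (α β γ : GSection I M 𝔤) :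
    (α + β).pointwise γ = α.pointwise γ + β.pointwise γ :=
  GSection.ext_toMap fun x => by
    change toFibre ⁅toFibre.symm (α.toMap x + β.toMap x), toFibre.symm (γ.toMap x)⁆ = _
    rw [map_add, add_lie, map_add]
    rfl

theorem GSection.pointwise_add_right (α β γ : GSection I M 𝔤) :
    α.pointwise (β + γ) = α.pointwise β + α.pointwise γ :=
  GSection.ext_toMap fun x => by
    change toFibre ⁅toFibre.symm (α.toMap x), toFibre.symm (β.toMap x + γ.toMap x)⁆ = _
    rw [map_add, lie_add, map_add]
    rfl

theorem GSection.pointwise_smul_left (f : C^∞⟮I, M; ℝ⟯) (α β : GSection I M 𝔤) :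
    (f • α).pointwise β = f • α.pointwise β :=
  GSection.ext_toMap fun x => by
    change toFibre ⁅toFibre.symm (f x • α.toMap x), toFibre.symm (β.toMap x)⁆ = _
    rw [map_smul, smul_lie, map_smul]
    rfl

theorem GSection.pointwise_smul_right (f : C^∞⟮I, M; ℝ⟯) (α β : GSection I M 𝔤) :
    α.pointwise (f • β) = f • α.pointwise β :=
  GSection.ext_toMap fun x => by
    change toFibre ⁅toFibre.symm (α.toMap x), toFibre.symm (f x • β.toMap x)⁆ = _
    rw [map_smul, lie_smul, map_smul]
    rfl

theorem GSection.pointwise_const (u v : 𝔤) :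
    (GSection.const u : GSection I M 𝔤).pointwise (GSection.const v) = GSection.const ⁅u, v⁆ :=
  rfl

theorem GSection.pointwise_self (α : GSection I M 𝔤) : α.pointwise α = 0 :=
  GSection.ext_toMap fun x => by
    change toFibre ⁅toFibre.symm (α.toMap x), toFibre.symm (α.toMap x)⁆ = _
    rw [lie_self, map_zero]
    rfl

theorem GSection.pointwise_jacobi (α β γ : GSection I M 𝔤) :
    α.pointwise (β.pointwise γ) = (α.pointwise β).pointwise γ + β.pointwise (α.pointwise γ) :=
  GSection.ext_toMap fun x => by
    change toFibre ⁅toFibre.symm (α.toMap x), toFibre.symm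
      (toFibre ⁅toFibre.symm (β.toMap x), toFibre.symm (γ.toMap x)⁆)⁆ = toFibre ⁅toFibre.symm
      (toFibre ⁅toFibre.symm (α.toMap x), toFibre.symm (β.toMap x)⁆), toFibre.symm (γ.toMap x)⁆ +
      toFibre ⁅toFibre.symm (β.toMap x), toFibre.symm
      (toFibre ⁅toFibre.symm (α.toMap x), toFibre.symm (γ.toMap x)⁆)⁆
    simp only [LinearEquiv.symm_apply_apply]
    rw [leibniz_lie, map_add]

/-- Every section is a sum of smooth multiples of constant sections. -/
theorem GSection.induction {P : GSection I M 𝔤 → Prop}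
    (h1 : ∀ (f : C^∞⟮I, M; ℝ⟯) (u : 𝔤), P (f • GSection.const u))
    (h2 : ∀ α β, P α → P β → P (α + β)) (α : GSection I M 𝔤) : P α := by
  classical
  let b := Module.finBasis ℝ (LieFibre 𝔤)
  let c : Fin _ → C^∞⟮I, M; ℝ⟯ := fun i =>
    ⟨fun x => LinearMap.toContinuousLinearMap (b.coord i) (α.toMap x),
      (contMDiff_const (c := LinearMap.toContinuousLinearMap (b.coord i))).clm_apply
        α.contMDiff_toMap⟩
  have h0 : P 0 := by
    have := h1 0 0
    rwa [zero_smul] at this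
  have key : ∀ s : Finset (Fin (Module.finrank ℝ (LieFibre 𝔤))),
      P (∑ i ∈ s, c i • GSection.const (toFibre.symm (b i))) := by
    intro s
    induction s using Finset.induction_on with
    | empty => simpa using h0
    | insert a s ha ih => rw [Finset.sum_insert ha]; exact h2 _ _ (h1 _ _) ih
  have hsum : ∀ s : Finset (Fin (Module.finrank ℝ (LieFibre 𝔤))), ∀ x : M,
      GSection.toMap (∑ i ∈ s, c i • GSection.const (toFibre.symm (b i)) : GSection I M 𝔤) x =
        ∑ i ∈ s, b.repr (α.toMap x) i • b i := by
    intro s x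
    induction s using Finset.induction_on with
    | empty => rfl
    | insert a s ha ih =>
      rw [Finset.sum_insert ha, Finset.sum_insert ha, GSection.toMap_add, Pi.add_apply, ih]
      rfl
  have : α = ∑ i, c i • GSection.const (toFibre.symm (b i)) :=
    GSection.ext_toMap fun x => by rw [hsum, b.sum_repr]
  rw [this]
  exact key _


theorem GSection.contMDiff_anchor (ρ : 𝔤 →ₗ⁅ℝ⁆ VField I M) (α : GSection I M 𝔤) :
    ContMDiff I I.tangent ∞
      (fun x => (⟨x, ρ (toFibre.symm (α x)) x⟩ : TangentBundle I M)) := by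
  induction α using GSection.induction with
  | h1 f u =>
    have : ∀ x, ρ (toFibre.symm ((f • GSection.const u : GSection I M 𝔤) x)) x =
        (f • ρ u) x := by
      intro x
      change ρ (toFibre.symm (f x • toFibre u)) x = _
      rw [map_smul, map_smul, LinearEquiv.symm_apply_apply]
      rfl
    simp only [this]
    exact (f • ρ u).contMDiff
  | h2 α β hα hβ =>
    have : ∀ x, ρ (toFibre.symm ((α + β : GSection I M 𝔤) x)) x =
        ((⟨_, hα⟩ + ⟨_, hβ⟩ : VField I M)) x := by
      intro x
      change ρ (toFibre.symm (α.toMap x + β.toMap x)) x = _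
      rw [map_add, map_add]
      rfl
    simp only [this]
    exact (⟨_, hα⟩ + ⟨_, hβ⟩ : VField I M).contMDiff

/-- The anchor of the action algebroid on sections: `(ρα)(x) = ρ(α(x))(x)`. -/
def GSection.anchor (ρ : 𝔤 →ₗ⁅ℝ⁆ VField I M) :
    GSection I M 𝔤 →ₗ[C^∞⟮I, M; ℝ⟯] VField I M where
  toFun α := ⟨fun x => ρ (toFibre.symm (α x)) x, GSection.contMDiff_anchor ρ α⟩
  map_add' α β := by
    ext x
    change ρ (toFibre.symm (α.toMap x + β.toMap x)) x = _
    rw [map_add, map_add]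
    rfl
  map_smul' f α := by
    ext x
    change ρ (toFibre.symm (f x • α.toMap x)) x = _
    rw [map_smul, map_smul]
    rfl

theorem GSection.anchor_const (ρ : 𝔤 →ₗ⁅ℝ⁆ VField I M) (u : 𝔤) :
    GSection.anchor ρ (GSection.const u) = ρ u := rfl

/-- The bracket of the action algebroid. -/
def GSection.actionBracket (ρ : 𝔤 →ₗ⁅ℝ⁆ VField I M) (α β : GSection I M 𝔤) : GSection I M 𝔤 :=
  α.pointwise β + GSection.deriv (GSection.anchor ρ α) β - GSection.deriv (GSection.anchor ρ β) α

theorem GSection.deriv_zero (X : VField I M) : GSection.deriv X (0 : GSection I M 𝔤) = 0 := by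
  have h := GSection.deriv_add X (0 : GSection I M 𝔤) 0
  simpa using h

theorem GSection.deriv_pointwise (X : VField I M) (α β : GSection I M 𝔤) :
    GSection.deriv X (α.pointwise β) =
      (GSection.deriv X α).pointwise β + α.pointwise (GSection.deriv X β) := by
  induction α using GSection.induction with
  | h2 α α' h h' =>
    simp only [GSection.pointwise_add_left, GSection.deriv_add, h, h']
    abel
  | h1 f u =>
    induction β using GSection.induction with
    | h2 β β' h h' =>
      simp only [GSection.pointwise_add_right, GSection.deriv_add, h, h']
      abel
    | h1 g v =>
      simp only [GSection.pointwise_smul_left, GSection.pointwise_smul_right,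
        GSection.pointwise_const, GSection.deriv_leibniz, GSection.deriv_const, smul_zero,
        zero_add, smul_smul, vfield_lie_mul]
      module

theorem GSection.deriv_lie (X Y : VField I M) (α : GSection I M 𝔤) :
    GSection.deriv ⁅X, Y⁆ α =
      GSection.deriv X (GSection.deriv Y α) - GSection.deriv Y (GSection.deriv X α) := by
  induction α using GSection.induction with
  | h2 α α' h h' =>
    simp only [GSection.deriv_add, h, h']
    abel
  | h1 f u =>
    simp only [GSection.deriv_leibniz, GSection.deriv_const, smul_zero, zero_add,
      vfield_lie_lie_fun, sub_smul]

theorem GSection.deriv_sub_left (X Y : VField I M) (α : GSection I M 𝔤) :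
    GSection.deriv (X - Y) α = GSection.deriv X α - GSection.deriv Y α := by
  have h := GSection.deriv_add_left (X - Y) Y α
  rw [sub_add_cancel] at h
  rw [h, add_sub_cancel_right]

theorem GSection.deriv_sub (X : VField I M) (α β : GSection I M 𝔤) :
    GSection.deriv X (α - β) = GSection.deriv X α - GSection.deriv X β := by
  have h := GSection.deriv_add X (α - β) β
  rw [sub_add_cancel] at h
  rw [h, add_sub_cancel_right]

theorem GSection.pointwise_sub_left (α β γ : GSection I M 𝔤) :
    (α - β).pointwise γ = α.pointwise γ - β.pointwise γ := by
  have h := GSection.pointwise_add_left (α - β) β γ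
  rw [sub_add_cancel] at h
  rw [h, add_sub_cancel_right]

theorem GSection.pointwise_sub_right (α β γ : GSection I M 𝔤) :
    α.pointwise (β - γ) = α.pointwise β - α.pointwise γ := by
  have h := GSection.pointwise_add_right α (β - γ) γ
  rw [sub_add_cancel] at h
  rw [h, add_sub_cancel_right]

theorem GSection.pointwise_skew (α β : GSection I M 𝔤) :
    α.pointwise β = - β.pointwise α := by
  have h := GSection.pointwise_self (α + β)
  rw [GSection.pointwise_add_left] at h
  simp only [GSection.pointwise_add_right, GSection.pointwise_self, zero_add, add_zero] at h
  exact eq_neg_of_add_eq_zero_left h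

theorem GSection.anchor_actionBracket (ρ : 𝔤 →ₗ⁅ℝ⁆ VField I M) (α β : GSection I M 𝔤) :
    GSection.anchor ρ (GSection.actionBracket ρ α β) =
      ⁅GSection.anchor ρ α, GSection.anchor ρ β⁆ := by
  unfold GSection.actionBracket
  induction α using GSection.induction with
  | h2 α α' h h' =>
    simp only [GSection.pointwise_add_left, GSection.deriv_add, GSection.deriv_add_left,
      map_add, map_sub, add_lie] at h h' ⊢
    rw [← h, ← h']
    abel
  | h1 f u =>
    induction β using GSection.induction with
    | h2 β β' h h' =>
      simp only [GSection.pointwise_add_right, GSection.deriv_add, GSection.deriv_add_left,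
        map_add, map_sub, lie_add] at h h' ⊢
      rw [← h, ← h']
      abel
    | h1 g v =>
      simp only [GSection.pointwise_smul_left, GSection.pointwise_smul_right,
        GSection.pointwise_const, GSection.deriv_leibniz, GSection.deriv_const, smul_zero,
        zero_add, map_add, map_sub, map_smul, GSection.anchor_const, LieHom.map_lie,
        vfield_lie_smul]
      rw [← lie_skew (f • ρ u) (ρ v), vfield_lie_smul, ← lie_skew (ρ u) (ρ v)]
      have hs : ∀ (a b : C^∞⟮I, M; ℝ⟯) (X : VField I M), ⁅a • X, b⁆ = a * ⁅X, b⁆ := fun a b X =>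
        LieRinehartRing.lie_smul_eq_mul a b X
      simp only [hs]
      module

theorem GSection.action_leibniz (ρ : 𝔤 →ₗ⁅ℝ⁆ VField I M) (α β : GSection I M 𝔤)
    (f : C^∞⟮I, M; ℝ⟯) :
    GSection.actionBracket ρ α (f • β) =
      f • GSection.actionBracket ρ α β + ⁅GSection.anchor ρ α, f⁆ • β := by
  simp only [GSection.actionBracket, GSection.pointwise_smul_right, GSection.deriv_leibniz,
    map_smul, GSection.deriv_smul_left]
  module

theorem GSection.action_jacobi (ρ : 𝔤 →ₗ⁅ℝ⁆ VField I M) (α β γ : GSection I M 𝔤) :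
    GSection.actionBracket ρ α (GSection.actionBracket ρ β γ) =
      GSection.actionBracket ρ (GSection.actionBracket ρ α β) γ +
        GSection.actionBracket ρ β (GSection.actionBracket ρ α γ) := by
  have e : ∀ a b : GSection I M 𝔤, GSection.actionBracket ρ a b =
    a.pointwise b + GSection.deriv (GSection.anchor ρ a) b - GSection.deriv (GSection.anchor ρ b) a :=
    fun _ _ => rfl
  rw [e α (GSection.actionBracket ρ β γ), e (GSection.actionBracket ρ α β) γ,
    e β (GSection.actionBracket ρ α γ)]
  simp only [GSection.anchor_actionBracket, GSection.deriv_lie]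
  simp only [e, GSection.deriv_add, GSection.deriv_sub, GSection.pointwise_add_left,
    GSection.pointwise_add_right, GSection.pointwise_sub_left, GSection.pointwise_sub_right,
    GSection.deriv_pointwise]
  rw [GSection.pointwise_jacobi α β γ]
  rw [GSection.pointwise_skew (GSection.deriv _ β) γ, GSection.pointwise_skew (GSection.deriv _ α) γ,
    GSection.pointwise_skew (GSection.deriv _ α) β]
  abel

/-- The action algebroid `𝔤 ⋉ M` of an infinitesimal action `ρ : 𝔤 → 𝔛(M)`: the trivial bundle
`M × 𝔤` with anchor `(x, v) ↦ ρ(v)(x)` and with the bracket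
`[α, β](x) = [α(x), β(x)] + (ρα)(β)(x) - (ρβ)(α)(x)`, which on constant sections is the bracket
of `𝔤`. -/
def actionAlgebroid (ρ : 𝔤 →ₗ⁅ℝ⁆ VField I M) :
    LieAlgebroid I (LieFibre 𝔤) (ActionBundle M 𝔤) where
  anchor x :=
    { toFun := fun v => ρ (toFibre.symm v) x
      map_add' := fun u v =>
        congrArg (fun X : VField I M => X x) (ρ.map_add (toFibre.symm u) (toFibre.symm v))
      map_smul' := fun r v =>
        congrArg (fun X : VField I M => X x) (ρ.map_smul r (toFibre.symm v)) }
  contMDiff_anchor := GSection.contMDiff_anchor ρ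
  bracket := LinearMap.mk₂ ℝ (GSection.actionBracket ρ)
    (fun α α' β => by
      simp only [GSection.actionBracket, GSection.pointwise_add_left, GSection.deriv_add,
        map_add, GSection.deriv_add_left]
      abel)
    (fun r α β => by
      rw [← algebraMap_smul C^∞⟮I, M; ℝ⟯ r α, ← algebraMap_smul C^∞⟮I, M; ℝ⟯ r]
      simp only [GSection.actionBracket, GSection.pointwise_smul_left, GSection.deriv_leibniz,
        map_smul, GSection.deriv_smul_left, vfield_lie_const, zero_smul, add_zero]
      module)
    (fun α β β' => by
      simp only [GSection.actionBracket, GSection.pointwise_add_right, GSection.deriv_add,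
        map_add, GSection.deriv_add_left]
      abel)
    (fun r α β => by
      rw [← algebraMap_smul C^∞⟮I, M; ℝ⟯ r β, ← algebraMap_smul C^∞⟮I, M; ℝ⟯ r]
      rw [GSection.action_leibniz, vfield_lie_const, zero_smul, add_zero])
  bracket_self α := by
    change GSection.actionBracket ρ α α = 0
    simp [GSection.actionBracket, GSection.pointwise_self]
  jacobi := GSection.action_jacobi ρ
  leibniz := GSection.action_leibniz ρ

/-- The linear form on the sections of `M × 𝔤` given by `ξ ∈ 𝔤*`. -/
def GSection.pair (ξ : Module.Dual ℝ 𝔤) : GSection I M 𝔤 →ₗ[C^∞⟮I, M; ℝ⟯] C^∞⟮I, M; ℝ⟯ where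
  toFun α := ⟨fun x => LinearMap.toContinuousLinearMap (ξ ∘ₗ toFibre.symm.toLinearMap) (α.toMap x),
    (contMDiff_const (c := LinearMap.toContinuousLinearMap
      (ξ ∘ₗ toFibre.symm.toLinearMap))).clm_apply α.contMDiff_toMap⟩
  map_add' α β := by
    ext x
    exact map_add (LinearMap.toContinuousLinearMap (ξ ∘ₗ toFibre.symm.toLinearMap))
      (α.toMap x) (β.toMap x)
  map_smul' f α := by
    ext x
    exact map_smul (LinearMap.toContinuousLinearMap (ξ ∘ₗ toFibre.symm.toLinearMap))
      (f x) (α.toMap x)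

end ActionAlgebroid
end Geometry

end WeilBRST

end

noncomputable section

namespace WeilBRST

section Shuffles

variable {n : ℕ}

/-- The subset of `Fin (n + 1)` given by a subset of `Fin n`, shifted by one. -/
abbrev shiftSet (S : Finset (Fin n)) : Finset (Fin (n + 1)) := S.map (Fin.succEmb n)

/-- The subset of `Fin (n + 1)` given by `0` and a subset of `Fin n`, shifted by one. -/
abbrev consSet (S : Finset (Fin n)) : Finset (Fin (n + 1)) := insert 0 (shiftSet S)

theorem zero_notMem_shiftSet (S : Finset (Fin n)) : 0 ∉ shiftSet S := by
  simp [shiftSet]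

theorem compl_shiftSet (S : Finset (Fin n)) : (shiftSet S)ᶜ = consSet Sᶜ := by
  ext i
  refine Fin.cases ?_ (fun i => ?_) i <;> simp [shiftSet, consSet]

theorem compl_consSet (S : Finset (Fin n)) : (consSet S)ᶜ = shiftSet Sᶜ := by
  rw [← compl_compl (shiftSet Sᶜ), compl_shiftSet, compl_compl]

theorem sum_finset_fin_succ {A : Type*} [AddCommMonoid A] (f : Finset (Fin (n + 1)) → A) :
    ∑ S, f S = ∑ S : Finset (Fin n), f (consSet S) + ∑ S : Finset (Fin n), f (shiftSet S) := by
  classical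
  rw [← Finset.sum_filter_add_sum_filter_not Finset.univ (fun S : Finset (Fin (n + 1)) => 0 ∈ S)]
  congr 1
  · refine Finset.sum_nbij' (fun S => S.preimage Fin.succ (Fin.succ_injective n).injOn)
      consSet ?_ ?_ ?_ ?_ ?_
    · simp
    · simp [consSet]
    · intro S hS
      ext i
      refine Fin.cases ?_ (fun i => ?_) i
      · simpa [consSet] using hS
      · simp [consSet, shiftSet]
    · intro S _
      ext i
      simp [consSet, shiftSet]
    · intro S hS
      congr 1
      ext i
      refine Fin.cases ?_ (fun i => ?_) i
      · simpa [consSet] using hS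
      · simp [consSet, shiftSet]
  · refine Finset.sum_nbij' (fun S => S.preimage Fin.succ (Fin.succ_injective n).injOn)
      shiftSet ?_ ?_ ?_ ?_ ?_
    · simp
    · simp [shiftSet]
    · intro S hS
      ext i
      refine Fin.cases ?_ (fun i => ?_) i
      · simpa [shiftSet] using hS
      · simp [shiftSet]
    · intro S _
      ext i
      simp [shiftSet]
    · intro S hS
      congr 1
      ext i
      refine Fin.cases ?_ (fun i => ?_) i
      · simpa [shiftSet] using hS
      · simp [shiftSet]

theorem card_consSet (S : Finset (Fin n)) : (consSet S).card = S.card + 1 := by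
  rw [Finset.card_insert_of_notMem (zero_notMem_shiftSet S), Finset.card_map]

theorem card_shiftSet (S : Finset (Fin n)) : (shiftSet S).card = S.card := Finset.card_map _

theorem orderEmbOfFin_consSet (S : Finset (Fin n)) {k : ℕ} (h : S.card = k) :
    ⇑((consSet S).orderEmbOfFin ((card_consSet S).trans (congrArg (· + 1) h))) =
      Matrix.vecCons 0 (Fin.succ ∘ S.orderEmbOfFin h) := by
  refine (Finset.orderEmbOfFin_unique _ (fun i => ?_) ?_).symm
  · refine Fin.cases ?_ (fun i => ?_) i
    · simp [consSet]
    · simp [consSet, shiftSet]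
  · intro i j
    refine Fin.cases ?_ (fun i => ?_) i <;> refine Fin.cases ?_ (fun j => ?_) j
    · simp
    · simp
    · simp
    · simp

theorem orderEmbOfFin_shiftSet (S : Finset (Fin n)) {k : ℕ} (h : S.card = k) :
    ⇑((shiftSet S).orderEmbOfFin ((card_shiftSet S).trans h)) =
      Fin.succ ∘ S.orderEmbOfFin h := by
  refine (Finset.orderEmbOfFin_unique _ (fun i => ?_) ?_).symm
  · simp [shiftSet]
  · intro i j
    simp

theorem shuffleSign_consSet (S : Finset (Fin n)) : shuffleSign (consSet S) = shuffleSign S := by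
  unfold shuffleSign
  congr 1
  rw [compl_consSet]
  refine (Finset.card_bij (fun p _ => (p.1.succ, p.2.succ)) ?_ ?_ ?_).symm
  · rintro ⟨i, j⟩
    simp [consSet, shiftSet]
  · rintro ⟨i, j⟩ _ ⟨i', j'⟩ _
    simp
  · rintro ⟨i, j⟩
    refine Fin.cases ?_ (fun i => ?_) i <;> refine Fin.cases ?_ (fun j => ?_) j <;>
      simp [consSet, shiftSet]

theorem shuffleSign_shiftSet (S : Finset (Fin n)) :
    shuffleSign (shiftSet S) = (-1) ^ S.card * shuffleSign S := by
  unfold shuffleSign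
  rw [← pow_add]
  congr 1
  rw [compl_shiftSet]
  let f : Fin n ↪ Fin (n + 1) × Fin (n + 1) :=
    ⟨fun i => (i.succ, 0), fun i j h => by simpa using h⟩
  let g : Fin n × Fin n ↪ Fin (n + 1) × Fin (n + 1) :=
    ⟨fun p => (p.1.succ, p.2.succ), fun p q h => by
      simpa only [Prod.mk.injEq, Fin.succ_inj, ← Prod.ext_iff] using h⟩
  have hf : ∀ i, f i = (i.succ, 0) := fun _ => rfl
  have hg : ∀ p, g p = (p.1.succ, p.2.succ) := fun _ => rfl
  have : ((shiftSet S ×ˢ consSet Sᶜ).filter fun p => p.2 < p.1) =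
      (S.map f).disjUnion (((S ×ˢ Sᶜ).filter fun p => p.2 < p.1).map g) (by
        rw [Finset.disjoint_left]
        rintro x hx hy
        obtain ⟨i, -, rfl⟩ := Finset.mem_map.1 hx
        obtain ⟨p, -, h⟩ := Finset.mem_map.1 hy
        rw [hf, hg] at h
        exact Fin.succ_ne_zero _ (Prod.ext_iff.1 h).2) := by
    ext ⟨i, j⟩
    rw [Finset.mem_disjUnion]
    refine Fin.cases ?_ (fun i => ?_) i <;> refine Fin.cases ?_ (fun j => ?_) j <;>
      simp [shiftSet, consSet, hf, hg, (Fin.succ_ne_zero _).symm]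
  rw [this, Finset.card_disjUnion, Finset.card_map, Finset.card_map]

end Shuffles

section Ring

/-- The cochains, as a ring under the shuffle product. -/
def WeilRing (R L G : Type*) := WeilCochain R L G

variable {R L G : Type*} [CommRing R]

instance : AddCommGroup (WeilRing R L G) := inferInstanceAs (AddCommGroup (WeilCochain R L G))

instance {S : Type*} [Semiring S] [Module S R] : Module S (WeilRing R L G) :=
  inferInstanceAs (Module S (WeilCochain R L G))

instance : Mul (WeilRing R L G) := ⟨weilMul⟩

instance : One (WeilRing R L G) := ⟨fun n v _ _ => if n = 0 ∧ v = 0 then 1 else 0⟩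

namespace WeilRing

/-- The components of a cochain. -/
def comp (c : WeilRing R L G) (n v : ℕ) (e : Fin n → L × G) (β : Fin v → G) : R := c n v e β

@[ext]
theorem ext {c c' : WeilRing R L G} (h : ∀ n v e β, c.comp n v e β = c'.comp n v e β) : c = c' :=
  funext fun n => funext fun v => funext fun e => funext fun β => h n v e β

/-- The contraction of a cochain with an element of `L × G`. -/
def ins (e : L × G) : WeilRing R L G →ₗ[R] WeilRing R L G where
  toFun c := fun n v es βs => c.comp (n + 1) v (Matrix.vecCons e es) βs
  map_add' _ _ := rfl
  map_smul' _ _ := rfl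

/-- The derivative of a cochain in the direction of an element of `G`. -/
def der (β : G) : WeilRing R L G →ₗ[R] WeilRing R L G where
  toFun c := fun n v es βs => c.comp n (v + 1) es (Matrix.vecCons β βs)
  map_add' _ _ := rfl
  map_smul' _ _ := rfl

/-- The parity involution on cochains. -/
def par : WeilRing R L G →ₗ[R] WeilRing R L G where
  toFun c := fun n v es βs => (-1) ^ n * c.comp n v es βs
  map_add' _ _ := by
    funext n v es βs
    exact mul_add _ _ _
  map_smul' r c := by
    funext n v es βs
    exact mul_left_comm _ _ _

theorem apply_succ (c : WeilRing R L G) (n v : ℕ) (es : Fin (n + 1) → L × G) (βs : Fin v → G) :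
    c.comp (n + 1) v es βs = (ins (es 0) c).comp n v (Fin.tail es) βs :=
  congrArg (fun e => c.comp (n + 1) v e βs) (Fin.cons_self_tail es).symm

theorem apply_succ' (c : WeilRing R L G) (n v : ℕ) (es : Fin n → L × G) (βs : Fin (v + 1) → G) :
    c.comp n (v + 1) es βs = (der (βs 0) c).comp n v es (Fin.tail βs) :=
  congrArg (fun e => c.comp n (v + 1) es e) (Fin.cons_self_tail βs).symm

theorem ins_apply (e : L × G) (c : WeilRing R L G) (n v : ℕ) (es : Fin n → L × G)
    (βs : Fin v → G) : (ins e c).comp n v es βs = c.comp (n + 1) v (Matrix.vecCons e es) βs := rfl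

theorem der_apply (β : G) (c : WeilRing R L G) (n v : ℕ) (es : Fin n → L × G)
    (βs : Fin v → G) : (der β c).comp n v es βs = c.comp n (v + 1) es (Matrix.vecCons β βs) := rfl

theorem ins_der (e : L × G) (β : G) (c : WeilRing R L G) : ins e (der β c) = der β (ins e c) := rfl

theorem par_apply (c : WeilRing R L G) (n v : ℕ) (es : Fin n → L × G)
    (βs : Fin v → G) : (par c).comp n v es βs = (-1) ^ n * c.comp n v es βs := rfl

theorem par_par (c : WeilRing R L G) : par (par c) = c := by
  ext n v es βs
  rw [par_apply, par_apply, ← mul_assoc, ← mul_pow]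
  simp

theorem ins_par (e : L × G) (c : WeilRing R L G) : ins e (par c) = - par (ins e c) := by
  ext n v es βs
  change (-1) ^ (n + 1) * c.comp _ _ _ _ = - ((-1) ^ n * c.comp _ _ _ _)
  rw [pow_succ]
  ring

theorem der_par (β : G) (c : WeilRing R L G) : der β (par c) = par (der β c) := rfl

theorem mul_apply (a b : WeilRing R L G) (n v : ℕ) (e : Fin n → L × G) (β : Fin v → G) :
    (a * b).comp n v e β = ∑ S : Finset (Fin n), ∑ T : Finset (Fin v), shuffleSign S •
      (a.comp S.card T.card (e ∘ S.orderEmbOfFin rfl) (β ∘ T.orderEmbOfFin rfl) *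
      b.comp Sᶜ.card Tᶜ.card (e ∘ Sᶜ.orderEmbOfFin rfl) (β ∘ Tᶜ.orderEmbOfFin rfl)) := rfl

theorem apply_congr (c : WeilRing R L G) {n v k l : ℕ} (e : Fin n → L × G) (β : Fin v → G)
    {S S' : Finset (Fin n)} {T T' : Finset (Fin v)} (hS : S = S') (hT : T = T')
    (hk : S'.card = k) (hl : T'.card = l) :
    c.comp S.card T.card (e ∘ S.orderEmbOfFin rfl) (β ∘ T.orderEmbOfFin rfl) =
      c.comp k l (e ∘ S'.orderEmbOfFin hk) (β ∘ T'.orderEmbOfFin hl) := by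
  subst hS hT hk hl
  rfl

theorem vecCons_comp_consSet {X : Type*} {n : ℕ} (x : X) (e : Fin n → X) (S : Finset (Fin n)) :
    (Matrix.vecCons x e : Fin (n + 1) → X) ∘ (consSet S).orderEmbOfFin (card_consSet S) =
      Matrix.vecCons x (e ∘ S.orderEmbOfFin rfl) := by
  rw [orderEmbOfFin_consSet S rfl]
  funext i
  refine Fin.cases ?_ (fun i => ?_) i <;> simp

theorem vecCons_comp_shiftSet {X : Type*} {n : ℕ} (x : X) (e : Fin n → X) (S : Finset (Fin n)) :
    (Matrix.vecCons x e : Fin (n + 1) → X) ∘ (shiftSet S).orderEmbOfFin (card_shiftSet S) =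
      e ∘ S.orderEmbOfFin rfl := by
  rw [orderEmbOfFin_shiftSet S rfl]
  funext i
  simp

theorem ins_mul (e : L × G) (a b : WeilRing R L G) :
    ins e (a * b) = ins e a * b + par a * ins e b := by
  ext n v es βs
  change (a * b).comp (n + 1) v (Matrix.vecCons e es) βs =
    (ins e a * b).comp n v es βs + (par a * ins e b).comp n v es βs
  rw [mul_apply, mul_apply, mul_apply, sum_finset_fin_succ]
  congr 1
  · refine Finset.sum_congr rfl fun S _ => Finset.sum_congr rfl fun T _ => ?_
    rw [shuffleSign_consSet, apply_congr a _ _ rfl rfl (card_consSet S) rfl,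
      apply_congr b _ _ (compl_consSet S) rfl (card_shiftSet Sᶜ) rfl,
      vecCons_comp_consSet, vecCons_comp_shiftSet, ins_apply]
  · refine Finset.sum_congr rfl fun S _ => Finset.sum_congr rfl fun T _ => ?_
    rw [shuffleSign_shiftSet, apply_congr a _ _ rfl rfl (card_shiftSet S) rfl,
      apply_congr b _ _ (compl_shiftSet S) rfl (card_consSet Sᶜ) rfl,
      vecCons_comp_consSet, vecCons_comp_shiftSet, ins_apply, par_apply]
    simp only [zsmul_eq_mul]
    push_cast
    ring

theorem der_mul (β : G) (a b : WeilRing R L G) :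
    der β (a * b) = der β a * b + a * der β b := by
  ext n v es βs
  change (a * b).comp n (v + 1) es (Matrix.vecCons β βs) =
    (der β a * b).comp n v es βs + (a * der β b).comp n v es βs
  rw [mul_apply, mul_apply, mul_apply, ← Finset.sum_add_distrib]
  refine Finset.sum_congr rfl fun S _ => ?_
  rw [sum_finset_fin_succ]
  congr 1
  · refine Finset.sum_congr rfl fun T _ => ?_
    rw [apply_congr a _ _ rfl rfl rfl (card_consSet T),
      apply_congr b _ _ rfl (compl_consSet T) rfl (card_shiftSet Tᶜ),
      vecCons_comp_consSet, vecCons_comp_shiftSet, der_apply]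
  · refine Finset.sum_congr rfl fun T _ => ?_
    rw [apply_congr a _ _ rfl rfl rfl (card_shiftSet T),
      apply_congr b _ _ rfl (compl_shiftSet T) rfl (card_consSet Tᶜ),
      vecCons_comp_consSet, vecCons_comp_shiftSet, der_apply]

theorem mul_apply_zero (a b : WeilRing R L G) (e : Fin 0 → L × G) (β : Fin 0 → G) :
    (a * b).comp 0 0 e β = a.comp 0 0 e β * b.comp 0 0 e β := by
  rw [mul_apply]
  simp only [Finset.univ_unique, Finset.sum_singleton]
  rw [show (default : Finset (Fin 0)) = ∅ from rfl]
  rw [apply_congr a e β rfl rfl (S' := ∅) (T' := ∅) (k := 0) (l := 0) rfl rfl,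
    apply_congr b e β rfl rfl (S' := ∅ᶜ) (T' := ∅ᶜ) (k := 0) (l := 0) rfl rfl]
  rw [show shuffleSign (∅ : Finset (Fin 0)) = 1 from rfl, one_smul]
  congr 2 <;> exact Subsingleton.elim _ _

theorem ext_zero {S : AddSubgroup (WeilRing R L G)} (h0 : ∀ c ∈ S, ∀ e β, c.comp 0 0 e β = 0)
    (h1 : ∀ c ∈ S, ∀ e, ins e c ∈ S) (h2 : ∀ c ∈ S, ∀ β, der β c ∈ S) {c : WeilRing R L G}
    (hc : c ∈ S) : c = 0 := by
  ext n v e β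
  change c.comp n v e β = 0
  induction n generalizing c with
  | succ n ih => rw [apply_succ]; exact ih (h1 c hc _) _
  | zero =>
    induction v generalizing c with
    | succ v ih => rw [apply_succ']; exact ih _ (h2 c hc _)
    | zero => exact h0 c hc _ _

theorem add_apply (a b : WeilRing R L G) (n v : ℕ) (e : Fin n → L × G) (β : Fin v → G) :
    (a + b).comp n v e β = a.comp n v e β + b.comp n v e β := rfl

theorem neg_apply (a : WeilRing R L G) (n v : ℕ) (e : Fin n → L × G) (β : Fin v → G) :
    (-a).comp n v e β = - a.comp n v e β := rfl

theorem sub_apply (a b : WeilRing R L G) (n v : ℕ) (e : Fin n → L × G) (β : Fin v → G) :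
    (a - b).comp n v e β = a.comp n v e β - b.comp n v e β := rfl

theorem smul_apply {S : Type*} [Semiring S] [Module S R] (r : S) (a : WeilRing R L G) (n v : ℕ)
    (e : Fin n → L × G) (β : Fin v → G) : (r • a).comp n v e β = r • a.comp n v e β := rfl

theorem zero_apply (n v : ℕ) (e : Fin n → L × G) (β : Fin v → G) :
    (0 : WeilRing R L G).comp n v e β = 0 := rfl

theorem one_apply (n v : ℕ) (e : Fin n → L × G) (β : Fin v → G) :
    (1 : WeilRing R L G).comp n v e β = if n = 0 ∧ v = 0 then 1 else 0 := rfl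

theorem ins_one (e : L × G) : ins e (1 : WeilRing R L G) = 0 := by
  ext n v es βs
  simp [ins_apply, one_apply, zero_apply]

theorem der_one (β : G) : der β (1 : WeilRing R L G) = 0 := by
  ext n v es βs
  simp [der_apply, one_apply, zero_apply]

theorem weilMul_add (a b c : WeilRing R L G) : a * (b + c) = a * b + a * c := by
  ext n v e β
  simp only [mul_apply, add_apply, mul_add, smul_add, Finset.sum_add_distrib]

theorem add_weilMul (a b c : WeilRing R L G) : (a + b) * c = a * c + b * c := by
  ext n v e β
  simp only [mul_apply, add_apply, add_mul, smul_add, Finset.sum_add_distrib]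

theorem weilMul_zero (a : WeilRing R L G) : a * 0 = 0 := by
  ext n v e β
  simp [mul_apply, zero_apply]

theorem zero_weilMul (a : WeilRing R L G) : 0 * a = 0 := by
  ext n v e β
  simp [mul_apply, zero_apply]

theorem par_mul (a b : WeilRing R L G) : par (a * b) = par a * par b := by
  ext n v e β
  rw [par_apply, mul_apply, mul_apply, Finset.mul_sum]
  refine Finset.sum_congr rfl fun S _ => ?_
  rw [Finset.mul_sum]
  refine Finset.sum_congr rfl fun T _ => ?_
  rw [par_apply, par_apply, zsmul_eq_mul, zsmul_eq_mul]
  have h : (-1 : R) ^ n = (-1) ^ S.card * (-1) ^ Sᶜ.card := by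
    rw [← pow_add, Finset.card_add_card_compl, Fintype.card_fin]
  rw [h]
  ring

theorem weilMul_assoc (a b c : WeilRing R L G) : a * b * c = a * (b * c) := by
  ext n v e β
  induction n generalizing a b c with
  | succ n ih =>
    simp only [apply_succ, ins_mul, add_apply, ih, par_mul, weilMul_add, add_weilMul]
    ring
  | zero =>
    induction v generalizing a b c with
    | succ v ih =>
      simp only [apply_succ', der_mul, add_apply, ih, weilMul_add, add_weilMul]
      ring
    | zero => simp only [mul_apply_zero]; ring

theorem one_weilMul (a : WeilRing R L G) : 1 * a = a := by
  have hp : par (1 : WeilRing R L G) = 1 := by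
    ext n v e β
    rw [par_apply, one_apply]
    split_ifs with h
    · simp [h.1]
    · simp
  ext n v e β
  induction n generalizing a with
  | succ n ih =>
    simp only [apply_succ, ins_mul, add_apply, ins_one, zero_weilMul, zero_apply, zero_add, hp, ih]
  | zero =>
    induction v generalizing a with
    | succ v ih =>
      simp only [apply_succ', der_mul, add_apply, ih, der_one, zero_weilMul, zero_apply, zero_add]
    | zero => simp only [mul_apply_zero, one_apply]; simp

theorem weilMul_one (a : WeilRing R L G) : a * 1 = a := by
  ext n v e β
  induction n generalizing a with
  | succ n ih =>
    simp only [apply_succ, ins_mul, add_apply, ins_one, weilMul_zero, zero_apply, add_zero, ih]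
  | zero =>
    induction v generalizing a with
    | succ v ih =>
      simp only [apply_succ', der_mul, add_apply, ih, der_one, weilMul_zero, zero_apply, add_zero]
    | zero => simp only [mul_apply_zero, one_apply]; simp

instance : Ring (WeilRing R L G) where
  left_distrib := weilMul_add
  right_distrib := add_weilMul
  zero_mul := zero_weilMul
  mul_zero := weilMul_zero
  mul_assoc := weilMul_assoc
  one_mul := one_weilMul
  mul_one := weilMul_one
  neg_add_cancel := neg_add_cancel
  zsmul := fun n x => n • x
  zsmul_zero' := SubNegMonoid.zsmul_zero'
  zsmul_succ' := SubNegMonoid.zsmul_succ'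
  zsmul_neg' := SubNegMonoid.zsmul_neg'
  sub_eq_add_neg := sub_eq_add_neg

instance {S : Type*} [CommSemiring S] [Algebra S R] : Algebra S (WeilRing R L G) :=
  Algebra.ofModule
    (fun r a b => by
      ext n v e β
      simp only [mul_apply, smul_apply, Finset.smul_sum, smul_mul_assoc, smul_comm r])
    (fun r a b => by
      ext n v e β
      simp only [mul_apply, smul_apply, Finset.smul_sum, mul_smul_comm, smul_comm r])

instance {S : Type*} [CommSemiring S] [Algebra S R] : IsScalarTower S R (WeilRing R L G) :=
  inferInstanceAs (IsScalarTower S R (WeilCochain R L G))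

end WeilRing
end Ring
end WeilBRST

namespace WeilBRST
namespace WeilRing

section AltSym

variable (R L G : Type*) [CommRing R] [AddCommGroup L] [Module R L]
  [AddCommGroup G] [Module R G]

/-- The cochains that are multilinear, alternating in the `eᵢ` and symmetric in the `βⱼ`. -/
def altSym : Submodule R (WeilRing R L G) where
  carrier := {c |
    (∀ n v β, ∃ F : (L × G) [⋀^Fin n]→ₗ[R] R, ∀ e, F e = c.comp n v e β) ∧
    (∀ n v e, ∃ F : MultilinearMap R (fun _ : Fin v => G) R, ∀ β, F β = c.comp n v e β) ∧
    (∀ n v e β (σ : Equiv.Perm (Fin v)), c.comp n v e (β ∘ σ) = c.comp n v e β)}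
  add_mem' := by
    rintro c c' ⟨h1, h2, h3⟩ ⟨h1', h2', h3'⟩
    refine ⟨fun n v β => ?_, fun n v e => ?_, fun n v e β σ => ?_⟩
    · obtain ⟨F, hF⟩ := h1 n v β
      obtain ⟨F', hF'⟩ := h1' n v β
      exact ⟨F + F', fun e => congrArg₂ (· + ·) (hF e) (hF' e)⟩
    · obtain ⟨F, hF⟩ := h2 n v e
      obtain ⟨F', hF'⟩ := h2' n v e
      exact ⟨F + F', fun β => congrArg₂ (· + ·) (hF β) (hF' β)⟩
    · exact congrArg₂ (· + ·) (h3 n v e β σ) (h3' n v e β σ)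
  zero_mem' := ⟨fun _ _ _ => ⟨0, fun _ => rfl⟩, fun _ _ _ => ⟨0, fun _ => rfl⟩,
    fun _ _ _ _ _ => rfl⟩
  smul_mem' := by
    rintro r c ⟨h1, h2, h3⟩
    refine ⟨fun n v β => ?_, fun n v e => ?_, fun n v e β σ => ?_⟩
    · obtain ⟨F, hF⟩ := h1 n v β
      exact ⟨r • F, fun e => congrArg (r • ·) (hF e)⟩
    · obtain ⟨F, hF⟩ := h2 n v e
      exact ⟨r • F, fun β => congrArg (r • ·) (hF β)⟩
    · exact congrArg (r • ·) (h3 n v e β σ)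

variable {R L G}
variable {c : WeilRing R L G}

theorem ins_mem_altSym (hc : c ∈ altSym R L G) (e : L × G) : ins e c ∈ altSym R L G := by
  obtain ⟨h1, h2, h3⟩ := hc
  refine ⟨fun n v β => ?_, fun n v es => ?_, fun n v es β σ => h3 _ _ _ _ _⟩
  · obtain ⟨F, hF⟩ := h1 (n + 1) v β
    exact ⟨F.curryLeft e, fun es => hF _⟩
  · exact h2 (n + 1) v (Matrix.vecCons e es)

theorem der_mem_altSym (hc : c ∈ altSym R L G) (β : G) : der β c ∈ altSym R L G := by
  obtain ⟨h1, h2, h3⟩ := hc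
  refine ⟨fun n v βs => h1 _ _ _, fun n v es => ?_, fun n v es βs σ => ?_⟩
  · obtain ⟨F, hF⟩ := h2 n (v + 1) es
    exact ⟨F.curryLeft β, fun es => hF _⟩
  · rw [der_apply, der_apply, ← h3 n (v + 1) es (Matrix.vecCons β βs)
      (Equiv.Perm.decomposeFin.symm (0, σ))]
    congr 1
    funext i
    refine Fin.cases ?_ (fun i => ?_) i <;> simp

theorem ins_smul_add (hc : c ∈ altSym R L G) (r : R) (e f : L × G) :
    ins (r • e + f) c = r • ins e c + ins f c := by
  ext n v es βs
  obtain ⟨F, hF⟩ := hc.1 (n + 1) v βs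
  simp only [add_apply, smul_apply, ins_apply, ← hF]
  rw [F.map_vecCons_add, F.map_vecCons_smul]

theorem ins_add (hc : c ∈ altSym R L G) (e f : L × G) :
    ins (e + f) c = ins e c + ins f c := by
  simpa using ins_smul_add hc 1 e f

theorem ins_zero (hc : c ∈ altSym R L G) : ins (0 : L × G) c = 0 := by
  have := ins_add hc 0 0
  simpa using this

theorem ins_smul (hc : c ∈ altSym R L G) (r : R) (e : L × G) :
    ins (r • e) c = r • ins e c := by
  simpa [ins_zero hc] using ins_smul_add hc r e 0

theorem ins_ins_self (hc : c ∈ altSym R L G) (e : L × G) : ins e (ins e c) = 0 := by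
  ext n v es βs
  obtain ⟨F, hF⟩ := hc.1 (n + 2) v βs
  rw [ins_apply, ins_apply, ← hF]
  exact F.map_eq_zero_of_eq _ (i := 0) (j := 1) rfl (by simp)

theorem ins_ins_comm (hc : c ∈ altSym R L G) (e f : L × G) :
    ins e (ins f c) = - ins f (ins e c) := by
  have h := ins_ins_self hc (e + f)
  simp only [ins_add hc, map_add, ins_add (ins_mem_altSym hc _), ins_ins_self hc, zero_add,
    add_zero] at h
  exact eq_neg_of_add_eq_zero_right h

theorem der_smul_add (hc : c ∈ altSym R L G) (r : R) (β γ : G) :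
    der (r • β + γ) c = r • der β c + der γ c := by
  ext n v es βs
  obtain ⟨F, hF⟩ := hc.2.1 n (v + 1) es
  simp only [add_apply, smul_apply, der_apply, ← hF]
  exact (F.cons_add βs (r • β) γ).trans (congrArg (· + _) (F.cons_smul βs r β))

theorem der_add (hc : c ∈ altSym R L G) (e f : G) :
    der (e + f) c = der e c + der f c := by
  simpa using der_smul_add hc 1 e f

theorem der_zero (hc : c ∈ altSym R L G) : der (0 : G) c = 0 := by
  have := der_add hc 0 0
  simpa using this

theorem der_smul (hc : c ∈ altSym R L G) (r : R) (e : G) :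
    der (r • e) c = r • der e c := by
  simpa [der_zero hc] using der_smul_add hc r e 0

theorem der_der_comm (hc : c ∈ altSym R L G) (β γ : G) : der β (der γ c) = der γ (der β c) := by
  ext n v es βs
  simp only [der_apply]
  rw [← hc.2.2 n (v + 2) es _ (Equiv.swap 0 1)]
  congr 1
  funext i
  refine Fin.cases ?_ (fun i => Fin.cases ?_ (fun i => ?_) i) i
  · simp
  · simp
  · have h : Equiv.swap (0 : Fin (v + 2)) 1 i.succ.succ = i.succ.succ :=
      Equiv.swap_apply_of_ne_of_ne (Fin.succ_ne_zero _) (by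
        rw [← Fin.succ_zero_eq_one]
        exact fun h => Fin.succ_ne_zero i (Fin.succ_injective _ h))
    simp [h]

section Criterion

variable {S : Submodule R (WeilRing R L G)}
  (h1 : ∀ c ∈ S, ∀ e, ins e c ∈ S) (h2 : ∀ c ∈ S, ∀ β, der β c ∈ S)
  (h3 : ∀ c ∈ S, ∀ (r : R) (e f : L × G), ins (r • e + f) c = r • ins e c + ins f c)
  (h4 : ∀ c ∈ S, ∀ e, ins e (ins e c) = 0)
  (h5 : ∀ c ∈ S, ∀ (r : R) (e f : G), der (r • e + f) c = r • der e c + der f c)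
  (h6 : ∀ c ∈ S, ∀ β γ, der β (der γ c) = der γ (der β c))

include h1 h3 in
theorem comp_update_smul_add {c : WeilRing R L G} (hc : c ∈ S) (n v : ℕ)
    (β : Fin v → G) (r : R) (x y : L × G) (e : Fin n → L × G) (i : Fin n) :
    c.comp n v (Function.update e i (r • x + y)) β =
      r * c.comp n v (Function.update e i x) β + c.comp n v (Function.update e i y) β := by
  induction n generalizing c with
  | zero => exact i.elim0
  | succ n ih =>
    refine Fin.cases ?_ (fun i => ?_) i
    · simp only [apply_succ, Function.update_self, Fin.tail_update_zero, h3 c hc]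
      rfl
    · simp only [apply_succ, Fin.tail_update_succ,
        Function.update_of_ne (Fin.succ_ne_zero i).symm, ih (h1 c hc _)]

include h2 h5 in
theorem comp_update_smul_add' {c : WeilRing R L G} (hc : c ∈ S) (n v : ℕ)
    (e : Fin n → L × G) (r : R) (x y : G) (β : Fin v → G) (i : Fin v) :
    c.comp n v e (Function.update β i (r • x + y)) =
      r * c.comp n v e (Function.update β i x) + c.comp n v e (Function.update β i y) := by
  induction v generalizing c with
  | zero => exact i.elim0
  | succ n ih =>
    refine Fin.cases ?_ (fun i => ?_) i
    · simp only [apply_succ', Function.update_self, Fin.tail_update_zero, h5 c hc]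
      rfl
    · simp only [apply_succ', Fin.tail_update_succ,
        Function.update_of_ne (Fin.succ_ne_zero i).symm, ih (h2 c hc _)]

include h1 h3 h4 in
theorem comp_eq_zero_of_eq {c : WeilRing R L G} (hc : c ∈ S) (n v : ℕ)
    (β : Fin v → G) (e : Fin n → L × G) (i j : Fin n) (hij : i < j) (he : e i = e j) :
    c.comp n v e β = 0 := by
  have h30 : ∀ c ∈ S, ∀ e f : L × G, ins (e + f) c = ins e c + ins f c := fun c hc e f => by
    simpa using h3 c hc 1 e f
  have hcomm : ∀ c ∈ S, ∀ e f : L × G, ins e (ins f c) = - ins f (ins e c) := by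
    intro c hc e f
    have h := h4 c hc (e + f)
    simp only [h30 c hc, map_add, h30 _ (h1 c hc _), h4 c hc, zero_add, add_zero] at h
    exact eq_neg_of_add_eq_zero_right h
  induction n generalizing c with
  | zero => exact i.elim0
  | succ n ih =>
    refine Fin.cases (fun hij he => ?_) (fun i hij he => ?_) i hij he
    · obtain ⟨j, rfl⟩ := Fin.exists_succ_eq.2 hij.ne'
      obtain _ | n := n
      · exact j.elim0
      refine Fin.cases (fun hij he => ?_) (fun j hij he => ?_) j hij he
      · rw [apply_succ, apply_succ, he]
        change (ins (e 1) (ins (e 1) c)).comp _ _ _ _ = 0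
        rw [h4 c hc]
        rfl
      · rw [apply_succ, apply_succ, hcomm c hc, neg_apply, neg_eq_zero]
        have := ih (h1 c hc (Fin.tail e 0)) (Matrix.vecCons (e 0) (Fin.tail (Fin.tail e)))
          0 j.succ (Fin.succ_pos _) he
        rwa [apply_succ] at this
    · obtain ⟨j, rfl⟩ := Fin.exists_succ_eq.2 (Fin.pos_of_ne_zero (by
        rintro rfl; simp at hij) : 0 < j).ne'
      rw [apply_succ]
      exact ih (h1 c hc _) (Fin.tail e) i j (Fin.succ_lt_succ_iff.1 hij) he

include h2 h6 in
theorem comp_comp_perm {c : WeilRing R L G} (hc : c ∈ S) (n v : ℕ)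
    (e : Fin n → L × G) (β : Fin v → G) (σ : Equiv.Perm (Fin v)) :
    c.comp n v e (β ∘ σ) = c.comp n v e β := by
  have hswap : ∀ (v : ℕ) (c : WeilRing R L G), c ∈ S → ∀ (β : Fin (v + 1) → G) (i : Fin v),
      c.comp n (v + 1) e (β ∘ Equiv.swap i.castSucc i.succ) = c.comp n (v + 1) e β := by
    intro v
    induction v with
    | zero => intro c _ β i; exact i.elim0
    | succ v ih =>
      intro c hc β i
      refine Fin.cases ?_ (fun i => ?_) i
      · simp only [apply_succ']
        have h0 : (β ∘ Equiv.swap (Fin.castSucc 0) (Fin.succ (0 : Fin (v + 1)))) 0 = β 1 := by simp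
        have h1 : Fin.tail (β ∘ Equiv.swap (Fin.castSucc 0) (Fin.succ (0 : Fin (v + 1)))) 0 =
          β 0 := by simp [Fin.tail]
        have h2 : Fin.tail (Fin.tail (β ∘ Equiv.swap (Fin.castSucc 0) (Fin.succ (0 : Fin (v + 1)))))
            = Fin.tail (Fin.tail β) := by
          funext j
          have h : Equiv.swap (0 : Fin (v + 2)) 1 j.succ.succ = j.succ.succ :=
            Equiv.swap_apply_of_ne_of_ne (Fin.succ_ne_zero _) (by
              rw [← Fin.succ_zero_eq_one]
              exact fun h => Fin.succ_ne_zero j (Fin.succ_injective _ h))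
          simp [Fin.tail, h]
        rw [h0, h1, h2, h6 c hc]
        rfl
      · have h0 : (β ∘ Equiv.swap i.succ.castSucc i.succ.succ) 0 = β 0 := by
          have h : Equiv.swap i.succ.castSucc i.succ.succ (0 : Fin (v + 2)) = 0 :=
            Equiv.swap_apply_of_ne_of_ne (by
              rw [Fin.castSucc_succ]; exact (Fin.succ_ne_zero _).symm) (Fin.succ_ne_zero _).symm
          rw [Function.comp_apply, h]
        have h1 : Fin.tail (β ∘ Equiv.swap i.succ.castSucc i.succ.succ) =
            Fin.tail β ∘ Equiv.swap i.castSucc i.succ := by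
          funext j
          simp only [Fin.tail, Function.comp_apply, Fin.castSucc_succ]
          rw [(Fin.succ_injective _).swap_apply]
        rw [apply_succ', h0, h1, ih _ (h2 c hc _), apply_succ' c]
  obtain _ | v := v
  · rw [Subsingleton.elim (β ∘ σ) β]
  have : σ ∈ Submonoid.closure (Set.range fun i : Fin v => Equiv.swap i.castSucc i.succ) := by
    rw [Equiv.Perm.mclosure_swap_castSucc_succ]
    trivial
  induction this using Submonoid.closure_induction generalizing β with
  | mem σ h => obtain ⟨i, rfl⟩ := h; exact hswap v c hc β i
  | one => rfl
  | mul σ τ _ _ hσ hτ =>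
    rw [Equiv.Perm.coe_mul, ← Function.comp_assoc, hτ, hσ]

include h1 h2 h3 h4 h5 h6 in
theorem le_altSym : S ≤ altSym R L G := by
  intro c hc
  refine ⟨fun n v β => ⟨⟨⟨fun e => c.comp n v e β, ?_, ?_⟩, ?_⟩, fun _ => rfl⟩,
    fun n v e => ⟨⟨fun β => c.comp n v e β, ?_, ?_⟩, fun _ => rfl⟩,
    fun n v e β σ => comp_comp_perm h2 h6 hc n v e β σ⟩
  · intro hd e i x y
    obtain rfl : hd = instDecidableEqFin n := Subsingleton.elim _ _
    simpa using comp_update_smul_add h1 h3 hc n v β 1 x y e i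
  · intro hd e i r x
    obtain rfl : hd = instDecidableEqFin n := Subsingleton.elim _ _
    have h0 := comp_update_smul_add h1 h3 hc n v β 1 0 0 e i
    have h := comp_update_smul_add h1 h3 hc n v β r x 0 e i
    simp only [smul_zero, add_zero, one_mul, left_eq_add] at h0
    rwa [add_zero, h0, add_zero] at h
  · intro e i j he hij
    rcases hij.lt_or_gt with hij | hij
    · exact comp_eq_zero_of_eq h1 h3 h4 hc n v β e i j hij he
    · exact comp_eq_zero_of_eq h1 h3 h4 hc n v β e j i hij he.symm
  · intro hd β i x y
    obtain rfl : hd = instDecidableEqFin v := Subsingleton.elim _ _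
    simpa using comp_update_smul_add' h2 h5 hc n v e 1 x y β i
  · intro hd β i r x
    obtain rfl : hd = instDecidableEqFin v := Subsingleton.elim _ _
    have h0 := comp_update_smul_add' h2 h5 hc n v e 1 0 0 β i
    have h := comp_update_smul_add' h2 h5 hc n v e r x 0 β i
    simp only [smul_zero, add_zero, one_mul, left_eq_add] at h0
    rwa [add_zero, h0, add_zero] at h

end Criterion

theorem mem_altSym_of_ins_der {c : WeilRing R L G} (h1 : ∀ e, ins e c ∈ altSym R L G)
    (h2 : ∀ β, der β c ∈ altSym R L G)
    (h3 : ∀ (r : R) (e f : L × G), ins (r • e + f) c = r • ins e c + ins f c)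
    (h4 : ∀ e, ins e (ins e c) = 0)
    (h5 : ∀ (r : R) (e f : G), der (r • e + f) c = r • der e c + der f c)
    (h6 : ∀ β γ, der β (der γ c) = der γ (der β c)) : c ∈ altSym R L G := by
  have hle : altSym R L G ≤ altSym R L G ⊔ Submodule.span R {c} := le_sup_left
  have key : ∀ {P : WeilRing R L G → Prop}, (∀ x ∈ altSym R L G, P x) → P c →
      (∀ x y, P x → P y → P (x + y)) → (∀ (r : R) x, P x → P (r • x)) →
      ∀ x ∈ altSym R L G ⊔ Submodule.span R {c}, P x := by
    intro P hP hc hadd hsmul x hx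
    obtain ⟨y, hy, z, hz, rfl⟩ := Submodule.mem_sup.1 hx
    obtain ⟨r, rfl⟩ := Submodule.mem_span_singleton.1 hz
    exact hadd _ _ (hP y hy) (hsmul _ _ hc)
  refine le_altSym (S := altSym R L G ⊔ Submodule.span R {c})
    (key (fun x hx e => hle (ins_mem_altSym hx e)) (fun e => hle (h1 e)) ?_ ?_)
    (key (fun x hx e => hle (der_mem_altSym hx e)) (fun e => hle (h2 e)) ?_ ?_)
    (key (fun x hx => ins_smul_add hx) h3 ?_ ?_)
    (key (fun x hx => ins_ins_self hx) h4 ?_ ?_)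
    (key (fun x hx => der_smul_add hx) h5 ?_ ?_)
    (key (fun x hx => der_der_comm hx) h6 ?_ ?_)
    (Submodule.mem_sup_right (Submodule.mem_span_singleton_self c))
  · intro x y hx hy e
    rw [map_add]
    exact add_mem (hx e) (hy e)
  · intro r x hx e
    rw [map_smul]
    exact Submodule.smul_mem _ _ (hx e)
  · intro x y hx hy e
    rw [map_add]
    exact add_mem (hx e) (hy e)
  · intro r x hx e
    rw [map_smul]
    exact Submodule.smul_mem _ _ (hx e)
  · intro x y hx hy r e f
    simp only [map_add, hx, hy]
    module
  · intro r x hx s e f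
    simp only [map_smul, hx]
    module
  · intro x y hx hy e
    simp only [map_add, hx, hy, add_zero]
  · intro r x hx e
    simp only [map_smul, hx, smul_zero]
  · intro x y hx hy r e f
    simp only [map_add, hx, hy]
    module
  · intro r x hx s e f
    simp only [map_smul, hx]
    module
  · intro x y hx hy e f
    simp only [map_add, hx e f, hy e f]
  · intro r x hx e f
    simp only [map_smul, hx e f]

theorem par_mem_altSym (hc : c ∈ altSym R L G) : par c ∈ altSym R L G := by
  obtain ⟨h1, h2, h3⟩ := hc
  refine ⟨fun n v β => ?_, fun n v es => ?_, fun n v es β σ => ?_⟩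
  · obtain ⟨F, hF⟩ := h1 n v β
    refine ⟨(-1 : R) ^ n • F, fun es => ?_⟩
    rw [AlternatingMap.smul_apply, hF, par_apply, smul_eq_mul]
  · obtain ⟨F, hF⟩ := h2 n v es
    refine ⟨(-1 : R) ^ n • F, fun es => ?_⟩
    rw [MultilinearMap.smul_apply, hF, par_apply, smul_eq_mul]
  · rw [par_apply, par_apply, h3]

theorem mul_mem_altSym {a b : WeilRing R L G} (ha : a ∈ altSym R L G) (hb : b ∈ altSym R L G) :
    a * b ∈ altSym R L G := by
  have key : ∀ {P : WeilRing R L G → Prop},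
      (∀ a ∈ altSym R L G, ∀ b ∈ altSym R L G, P (a * b)) →
      (∀ x y, P x → P y → P (x + y)) →
      ∀ x ∈ altSym R L G * altSym R L G, P x := by
    intro P hP hadd x hx
    exact Submodule.mul_induction_on hx hP hadd
  refine le_altSym (S := altSym R L G * altSym R L G)
    (key (fun a ha b hb e => ?_) ?_) (key (fun a ha b hb e => ?_) ?_)
    (key (fun a ha b hb r e f => ?_) ?_) (key (fun a ha b hb e => ?_) ?_)
    (key (fun a ha b hb r e f => ?_) ?_) (key (fun a ha b hb e f => ?_) ?_)
    (Submodule.mul_mem_mul ha hb)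
  · rw [ins_mul]
    exact add_mem (Submodule.mul_mem_mul (ins_mem_altSym ha e) hb)
      (Submodule.mul_mem_mul (par_mem_altSym ha) (ins_mem_altSym hb e))
  · intro x y hx hy e
    rw [map_add]
    exact add_mem (hx e) (hy e)
  · rw [der_mul]
    exact add_mem (Submodule.mul_mem_mul (der_mem_altSym ha e) hb)
      (Submodule.mul_mem_mul ha (der_mem_altSym hb e))
  · intro x y hx hy e
    rw [map_add]
    exact add_mem (hx e) (hy e)
  · simp only [ins_mul, ins_smul_add ha, ins_smul_add hb, add_mul, mul_add, smul_mul_assoc,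
      mul_smul_comm]
    module
  · intro x y hx hy r e f
    simp only [map_add, hx, hy]
    module
  · simp only [ins_mul, map_add, ins_ins_self ha, ins_ins_self hb, ins_par, zero_mul, mul_zero,
      neg_mul]
    abel
  · intro x y hx hy e
    simp only [map_add, hx, hy, add_zero]
  · simp only [der_mul, der_smul_add ha, der_smul_add hb, add_mul, mul_add, smul_mul_assoc,
      mul_smul_comm]
    module
  · intro x y hx hy r e f
    simp only [map_add, hx, hy]
    module
  · simp only [der_mul, map_add, der_der_comm ha e f, der_der_comm hb e f]
    abel
  · intro x y hx hy e f
    simp only [map_add, hx e f, hy e f]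

theorem one_mem_altSym : (1 : WeilRing R L G) ∈ altSym R L G := by
  refine mem_altSym_of_ins_der ?_ ?_ ?_ ?_ ?_ ?_ <;> intros <;> simp [ins_one, der_one]

end AltSym

end WeilRing
end WeilBRST

namespace WeilBRST
section ShufflePerm

variable {k l : ℕ}

/-- The permutation that lists the elements of `S` and then those of its complement. -/
def shufflePerm (S : Finset (Fin (k + l))) (hS : S.card = k) (hS' : Sᶜ.card = l) :
    Equiv.Perm (Fin (k + l)) :=
  finSumFinEquiv.symm.trans (finSumEquivOfFinset hS hS')

theorem shufflePerm_castAdd (S : Finset (Fin (k + l))) (hS : S.card = k) (hS' : Sᶜ.card = l)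
    (i : Fin k) : shufflePerm S hS hS' (Fin.castAdd l i) = S.orderEmbOfFin hS i := by
  simp [shufflePerm]

theorem shufflePerm_natAdd (S : Finset (Fin (k + l))) (hS : S.card = k) (hS' : Sᶜ.card = l)
    (i : Fin l) : shufflePerm S hS hS' (Fin.natAdd k i) = Sᶜ.orderEmbOfFin hS' i := by
  simp [shufflePerm]

theorem shufflePerm_inversion (S : Finset (Fin (k + l))) (hS : S.card = k) (hS' : Sᶜ.card = l)
    (i j : Fin (k + l)) :
    (i < j ∧ ¬ shufflePerm S hS hS' i < shufflePerm S hS hS' j) ↔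
      (shufflePerm S hS hS' i ∈ S ∧ shufflePerm S hS hS' j ∈ Sᶜ) ∧
        shufflePerm S hS hS' j < shufflePerm S hS hS' i := by
  have hm : ∀ i, S.orderEmbOfFin hS i ∈ S := fun i => Finset.orderEmbOfFin_mem _ _ _
  have hm' : ∀ i, Sᶜ.orderEmbOfFin hS' i ∈ Sᶜ := fun i => Finset.orderEmbOfFin_mem _ _ _
  have hn : ∀ i, Sᶜ.orderEmbOfFin hS' i ∉ S := fun i => Finset.mem_compl.1 (hm' i)
  have hn' : ∀ i, S.orderEmbOfFin hS i ∉ Sᶜ := fun i h => Finset.mem_compl.1 h (hm i)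
  induction i using Fin.addCases with
  | left i =>
    induction j using Fin.addCases with
    | left j =>
      simp only [shufflePerm_castAdd, hm, hn', and_false, false_and, iff_false, not_and, not_not]
      intro h
      exact (S.orderEmbOfFin hS).strictMono h
    | right j =>
      have h : Fin.castAdd l i < Fin.natAdd k j := by
        rw [Fin.lt_def]; simp; omega
      have hne : S.orderEmbOfFin hS i ≠ Sᶜ.orderEmbOfFin hS' j := fun h => hn j (h ▸ hm i)
      simp only [shufflePerm_castAdd, shufflePerm_natAdd, hm, hm', h, true_and, not_lt]
      exact ⟨fun h => h.lt_of_ne hne.symm, fun h => h.le⟩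
  | right i =>
    induction j using Fin.addCases with
    | left j =>
      have h : ¬ Fin.natAdd k i < Fin.castAdd l j := by
        rw [Fin.lt_def]; simp; omega
      simp [shufflePerm_castAdd, shufflePerm_natAdd, h, hn]
    | right j =>
      simp only [shufflePerm_natAdd, hn, false_and, iff_false, not_and, not_not]
      intro h
      simpa using h

theorem sign_shufflePerm (S : Finset (Fin (k + l))) (hS : S.card = k) (hS' : Sᶜ.card = l) :
    (Equiv.Perm.sign (shufflePerm S hS hS') : ℤ) = shuffleSign S := by
  rw [Equiv.Perm.sign_eq_prod_prod_Ioi, Finset.prod_sigma']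
  rw [Finset.prod_ite]
  push_cast
  simp only [Finset.prod_const_one, one_mul, Units.val_one, Units.val_neg, Finset.prod_const]
  rw [shuffleSign]
  congr 1
  refine Finset.card_bij (fun p _ => (shufflePerm S hS hS' p.1, shufflePerm S hS hS' p.2)) ?_ ?_ ?_
  · rintro ⟨i, j⟩ h
    simp only [Finset.mem_filter, Finset.mem_sigma, Finset.mem_univ, Finset.mem_Ioi,
      true_and] at h
    simpa only [Finset.mem_filter, Finset.mem_product] using
      (shufflePerm_inversion S hS hS' i j).1 h
  · rintro ⟨i, j⟩ _ ⟨i', j'⟩ _ h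
    simpa using h
  · rintro ⟨a, b⟩ h
    obtain ⟨i, rfl⟩ := (shufflePerm S hS hS').surjective a
    obtain ⟨j, rfl⟩ := (shufflePerm S hS hS').surjective b
    refine ⟨⟨i, j⟩, ?_, rfl⟩
    simp only [Finset.mem_filter, Finset.mem_product] at h
    simpa only [Finset.mem_filter, Finset.mem_sigma, Finset.mem_univ, Finset.mem_Ioi,
      true_and] using (shufflePerm_inversion S hS hS' i j).2 h

end ShufflePerm

namespace WeilRing

section Generators

variable {R L G : Type*} [CommRing R] [AddCommGroup L] [Module R L]
  [AddCommGroup G] [Module R G]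

variable (L) in
/-- `weilTheta`, as an element of the ring of cochains. -/
def theta (l : G →ₗ[R] R) : WeilRing R L G := weilTheta l

variable (L) in
/-- `weilMu`, as an element of the ring of cochains. -/
def mu (l : G →ₗ[R] R) : WeilRing R L G := weilMu l

variable (G) in
/-- `weilForm`, as an element of the ring of cochains. -/
def form {k : ℕ} (φ : L [⋀^Fin k]→ₗ[R] R) : WeilRing R L G := weilForm φ

theorem theta_comp (l : G →ₗ[R] R) (n v : ℕ) (e : Fin n → L × G) (β : Fin v → G) :
    (theta L l).comp n v e β = if h : n = 1 ∧ v = 0 then l (e (Fin.cast h.1.symm 0)).2 else 0 :=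
  rfl

theorem mu_comp (l : G →ₗ[R] R) (n v : ℕ) (e : Fin n → L × G) (β : Fin v → G) :
    (mu L l).comp n v e β = if h : n = 0 ∧ v = 1 then l (β (Fin.cast h.2.symm 0)) else 0 :=
  rfl

theorem form_comp {k : ℕ} (φ : L [⋀^Fin k]→ₗ[R] R) (n v : ℕ) (e : Fin n → L × G)
    (β : Fin v → G) : (form G φ).comp n v e β =
      if h : n = k ∧ v = 0 then φ fun i => (e (Fin.cast h.1.symm i)).1 else 0 :=
  rfl

theorem ins_theta (e : L × G) (l : G →ₗ[R] R) : ins e (theta L l) = l e.2 • 1 := by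
  ext n v es βs
  rw [ins_apply, theta_comp, smul_apply, one_apply]
  by_cases h : n = 0 ∧ v = 0
  · obtain ⟨rfl, rfl⟩ := h
    simp
  · simp [h]

theorem der_theta (β : G) (l : G →ₗ[R] R) : der β (theta L l) = 0 := by
  ext n v es βs
  simp [der_apply, theta_comp, zero_apply]

theorem ins_mu (e : L × G) (l : G →ₗ[R] R) : ins e (mu L l) = 0 := by
  ext n v es βs
  simp [ins_apply, mu_comp, zero_apply]

theorem der_mu (β : G) (l : G →ₗ[R] R) : der β (mu L l) = l β • 1 := by
  ext n v es βs
  rw [der_apply, mu_comp, smul_apply, one_apply]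
  by_cases h : n = 0 ∧ v = 0
  · obtain ⟨rfl, rfl⟩ := h
    simp
  · simp [h]

theorem ins_form {k : ℕ} (e : L × G) (φ : L [⋀^Fin (k + 1)]→ₗ[R] R) :
    ins e (form G φ) = form G (φ.curryLeft e.1) := by
  ext n v es βs
  rw [ins_apply, form_comp, form_comp]
  by_cases h : n = k ∧ v = 0
  · obtain ⟨rfl, rfl⟩ := h
    simp only [and_self, dite_true]
    rw [AlternatingMap.curryLeft_apply_apply]
    congr 1
    funext i
    refine Fin.cases ?_ (fun i => ?_) i <;> rfl
  · simp [h]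

theorem ins_form_zero (e : L × G) (φ : L [⋀^Fin 0]→ₗ[R] R) :
    ins e (form G φ) = 0 := by
  ext n v es βs
  simp [ins_apply, form_comp, zero_apply]

theorem der_form {k : ℕ} (β : G) (φ : L [⋀^Fin k]→ₗ[R] R) :
    der β (form G φ) = 0 := by
  ext n v es βs
  simp [der_apply, form_comp, zero_apply]

theorem form_comp_self {k : ℕ} (φ : L [⋀^Fin k]→ₗ[R] R) (e : Fin k → L × G)
    (β : Fin 0 → G) : (form G φ).comp k 0 e β = φ fun i => (e i).1 := by
  rw [form_comp, dif_pos ⟨rfl, rfl⟩]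
  rfl

theorem form_comp_of_ne {k : ℕ} (φ : L [⋀^Fin k]→ₗ[R] R) {n v : ℕ} (h : ¬ (n = k ∧ v = 0))
    (e : Fin n → L × G) (β : Fin v → G) : (form G φ).comp n v e β = 0 :=
  dif_neg h

theorem theta_mem_altSym (l : G →ₗ[R] R) : theta L l ∈ altSym R L G := by
  refine mem_altSym_of_ins_der ?_ ?_ ?_ ?_ ?_ ?_ <;> intros <;>
    simp only [ins_theta, der_theta, map_zero, map_smul, ins_one, smul_zero, zero_mem, add_zero]
  · exact Submodule.smul_mem _ _ one_mem_altSym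
  · simp only [Prod.snd_add, Prod.smul_snd, map_add, map_smul, add_smul, smul_assoc]

theorem mu_mem_altSym (l : G →ₗ[R] R) : mu L l ∈ altSym R L G := by
  refine mem_altSym_of_ins_der ?_ ?_ ?_ ?_ ?_ ?_ <;> intros <;>
    simp only [ins_mu, der_mu, map_zero, map_smul, der_one, smul_zero, zero_mem, add_zero]
  · exact Submodule.smul_mem _ _ one_mem_altSym
  · simp only [map_add, map_smul, add_smul, smul_assoc]

theorem form_add {k : ℕ} (φ η : L [⋀^Fin k]→ₗ[R] R) : form G (φ + η) = form G φ + form G η := by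
  ext n v e β
  simp only [add_apply, form_comp]
  split_ifs <;> simp

theorem form_smul {S : Type*} [CommSemiring S] [Algebra S R] {k : ℕ} (r : S)
    (φ : L [⋀^Fin k]→ₗ[R] R) : form G (r • φ) = r • form G φ := by
  ext n v e β
  simp only [smul_apply, form_comp]
  split_ifs <;> simp

theorem form_mem_altSym {k : ℕ} (φ : L [⋀^Fin k]→ₗ[R] R) : form G φ ∈ altSym R L G := by
  induction k with
  | zero =>
    refine mem_altSym_of_ins_der ?_ ?_ ?_ ?_ ?_ ?_ <;> intros <;>
    simp only [ins_form_zero, der_form, map_zero, smul_zero, zero_mem, add_zero]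
  | succ k ih =>
    refine mem_altSym_of_ins_der ?_ ?_ ?_ ?_ ?_ ?_ <;> intros <;>
    simp only [ins_form, der_form, map_zero, smul_zero, zero_mem, add_zero, ih]
    · rw [← form_smul, ← form_add]
      simp
    · obtain _ | k := k
      · rw [ins_form_zero]
      · rw [ins_form]
        ext n v es βs
        rw [form_comp]
        simp [zero_apply]

theorem mu_mul_comm (l : G →ₗ[R] R) (c : WeilRing R L G) : mu L l * c = c * mu L l := by
  ext n v e β
  have hp : par (mu L l) = mu L l := by
    ext n v e β
    rw [par_apply, mu_comp]
    split_ifs with h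
    · simp [h.1]
    · simp
  induction n generalizing c with
  | succ n ih =>
    simp only [apply_succ, ins_mul, add_apply, ins_mu, zero_mul, mul_zero, zero_apply, hp, ih,
      zero_add, add_zero]
  | zero =>
    induction v generalizing c with
    | succ v ih =>
      simp only [apply_succ', der_mul, add_apply, der_mu, ih, smul_mul_assoc, mul_smul_comm,
        one_mul, mul_one, smul_apply]
      ring
    | zero => simp only [mul_apply_zero]; ring

theorem par_theta (l : G →ₗ[R] R) : par (theta L l) = - theta L l := by
  ext n v e β
  rw [neg_apply, par_apply, theta_comp]
  split_ifs with h
  · simp [h.1]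
  · simp

theorem theta_mul_comm (l : G →ₗ[R] R) (c : WeilRing R L G) :
    theta L l * c = par c * theta L l := by
  ext n v e β
  induction n generalizing c with
  | succ n ih =>
    simp only [apply_succ, ins_mul, add_apply, ins_theta, par_theta, ins_par, par_par, neg_mul,
      neg_apply, ih, smul_mul_assoc, mul_smul_comm, one_mul, mul_one, smul_apply]
    ring
  | zero =>
    induction v generalizing c with
    | succ v ih =>
      simp only [apply_succ', der_mul, add_apply, der_theta, ih, zero_mul, mul_zero, zero_apply,
        der_par, zero_add, add_zero]
    | zero => 
      simp only [mul_apply_zero, theta_comp]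
      simp

theorem theta_mul_self (l : G →ₗ[R] R) : theta L l * theta L l = 0 := by
  ext n v e β
  obtain _ | n := n
  · obtain _ | v := v
    · simp [mul_apply_zero, theta_comp, zero_apply]
    · simp [apply_succ', der_mul, der_theta, zero_apply]
  · rw [apply_succ, ins_mul, ins_theta, par_theta, mul_smul_comm]
    simp [zero_apply]

theorem par_form {k : ℕ} (φ : L [⋀^Fin k]→ₗ[R] R) :
    par (form G φ) = (-1 : R) ^ k • form G φ := by
  ext n v e β
  rw [smul_apply, par_apply, form_comp]
  split_ifs with h
  · simp [h.1]
  · simp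

theorem theta_add (l l' : G →ₗ[R] R) : theta L (l + l') = theta L l + theta L l' := by
  ext n v e β
  simp only [add_apply, theta_comp]
  split_ifs <;> simp

theorem theta_smul {S : Type*} [CommSemiring S] [Algebra S R] (r : S) (l : G →ₗ[R] R) :
    theta L (r • l) = r • theta L l := by
  ext n v e β
  simp only [smul_apply, theta_comp]
  split_ifs <;> simp

theorem mu_add (l l' : G →ₗ[R] R) : mu L (l + l') = mu L l + mu L l' := by
  ext n v e β
  simp only [add_apply, mu_comp]
  split_ifs <;> simp

theorem mu_smul {S : Type*} [CommSemiring S] [Algebra S R] (r : S) (l : G →ₗ[R] R) :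
    mu L (r • l) = r • mu L l := by
  ext n v e β
  simp only [smul_apply, mu_comp]
  split_ifs <;> simp

end Generators

section Wedge

variable {R L G : Type*} [CommRing R] [Algebra ℝ R] [LieRing L] [Module R L] [LieAlgebra ℝ L]
  [LieRingModule L R] [LieRinehartRing R L] [LieRinehartAlgebra ℝ R L]
  [AddCommGroup G] [Module R G] {k l : ℕ}

theorem form_mul_form_comp_of_ne (φ : Form R L k) (η : Form R L l) {n v : ℕ}
    (h : ¬ (n = k + l ∧ v = 0)) (e : Fin n → L × G) (β : Fin v → G) :
    (form G φ * form G η).comp n v e β = 0 := by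
  rw [mul_apply]
  refine Finset.sum_eq_zero fun S _ => Finset.sum_eq_zero fun T _ => ?_
  by_cases h1 : S.card = k ∧ T.card = 0
  · by_cases h2 : Sᶜ.card = l ∧ Tᶜ.card = 0
    · refine absurd ⟨?_, ?_⟩ h
      · rw [← h1.1, ← h2.1, Finset.card_add_card_compl, Fintype.card_fin]
      · rw [← Fintype.card_fin v, ← Finset.card_add_card_compl T, h1.2, h2.2]
    · rw [form_comp_of_ne η h2, mul_zero, smul_zero]
  · rw [form_comp_of_ne φ h1, zero_mul, smul_zero]

theorem form_mul_form_comp (φ : Form R L k) (η : Form R L l) (e : Fin (k + l) → L × G)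
    (β : Fin 0 → G) :
    (form G φ * form G η).comp (k + l) 0 e β =
      ∑ S : {S : Finset (Fin (k + l)) // S.card = k ∧ Sᶜ.card = l},
        (Equiv.Perm.sign (shufflePerm S.1 S.2.1 S.2.2) : ℤ) •
          (φ (fun i => (e (shufflePerm S.1 S.2.1 S.2.2 (Fin.castAdd l i))).1) *
            η fun i => (e (shufflePerm S.1 S.2.1 S.2.2 (Fin.natAdd k i))).1) := by
  classical
  rw [mul_apply, ← Finset.sum_filter_of_ne
    (p := fun S : Finset (Fin (k + l)) => S.card = k ∧ Sᶜ.card = l),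
    Finset.sum_subtype (p := fun S : Finset (Fin (k + l)) => S.card = k ∧ Sᶜ.card = l) _
      (by simp)]
  · refine Finset.sum_congr rfl fun S _ => ?_
    obtain ⟨S, hS, hS'⟩ := S
    rw [Fintype.sum_unique, sign_shufflePerm, apply_congr (form G φ) e β rfl rfl hS rfl,
      apply_congr (form G η) e β rfl rfl hS' rfl]
    simp only [shufflePerm_castAdd, shufflePerm_natAdd]
    rw [form_comp, dif_pos ⟨rfl, rfl⟩, form_comp, dif_pos ⟨rfl, rfl⟩]
    rfl
  · intro S _ h
    by_contra hS
    refine h (Finset.sum_eq_zero fun T _ => ?_)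
    by_cases h1 : S.card = k
    · rw [form_comp_of_ne η (fun h => hS ⟨h1, h.1⟩), mul_zero, smul_zero]
    · rw [form_comp_of_ne φ (fun h => h1 h.1), zero_mul, smul_zero]

/-- The sum over all permutations whose value is `k! l!` times the wedge product. -/
def permSum (φ : Form R L k) (η : Form R L l) (X : Fin (k + l) → L) : R :=
  ∑ σ : Equiv.Perm (Fin (k + l)), (Equiv.Perm.sign σ : ℤ) •
    (φ (fun i => X (σ (Fin.castAdd l i))) * η fun i => X (σ (Fin.natAdd k i)))

theorem permSum_comp_perm (φ : Form R L k) (η : Form R L l) (X : Fin (k + l) → L)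
    (τ : Equiv.Perm (Fin (k + l))) :
    ∑ σ : Equiv.Perm (Fin (k + l)), (Equiv.Perm.sign σ : ℤ) • (Equiv.Perm.sign τ : ℤ) •
      (φ (fun i => X (σ (τ (Fin.castAdd l i)))) * η fun i => X (σ (τ (Fin.natAdd k i)))) =
    permSum φ η X := by
  refine Fintype.sum_equiv (Equiv.mulRight τ) _ _ fun σ => ?_
  simp only [Equiv.coe_mulRight, Equiv.Perm.sign_mul, Equiv.Perm.mul_apply, smul_smul]
  push_cast
  rfl

theorem factorial_smul_wedgeForm (φ : Form R L k) (η : Form R L l) (X : Fin (k + l) → L) :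
    (k.factorial * l.factorial) • wedgeForm k l φ η X = permSum φ η X := by
  have h := congrArg (fun F => LinearMap.mul' R R (F (X ∘ finSumFinEquiv)))
    (MultilinearMap.domCoprod_alternization_eq φ η)
  simp only [AlternatingMap.smul_apply, map_nsmul, Fintype.card_fin] at h
  refine h.symm.trans ?_
  rw [MultilinearMap.alternatization_apply, map_sum, permSum]
  refine Fintype.sum_equiv (Equiv.permCongr finSumFinEquiv) _ _ fun σ => ?_
  rw [Equiv.Perm.sign_permCongr, Units.smul_def, map_zsmul]
  congr 1
  simp only [MultilinearMap.domDomCongr_apply, MultilinearMap.domCoprod_apply,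
    LinearMap.mul'_apply]
  simp [Equiv.permCongr_apply]

theorem factorial_smul_form_mul_form (φ : Form R L k) (η : Form R L l) (e : Fin (k + l) → L × G)
    (β : Fin 0 → G) :
    (k + l).factorial • (form G φ * form G η).comp (k + l) 0 e β =
      (k + l).choose k • permSum φ η fun i => (e i).1 := by
  obtain ⟨F, hF⟩ := (mul_mem_altSym (form_mem_altSym φ) (form_mem_altSym η)).1 (k + l) 0 β
  have h : (k + l).factorial • F e =
      ∑ σ : Equiv.Perm (Fin (k + l)), (Equiv.Perm.sign σ : ℤ) • F (e ∘ σ) := by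
    have : ∀ σ : Equiv.Perm (Fin (k + l)), (Equiv.Perm.sign σ : ℤ) • F (e ∘ σ) = F e := by
      intro σ
      rw [F.map_perm, Units.smul_def, smul_smul, ← Units.val_mul, Int.units_mul_self,
        Units.val_one, one_smul]
    simp only [this, Finset.sum_const, Finset.card_univ, Fintype.card_perm, Fintype.card_fin]
  rw [← hF, h]
  simp only [hF, form_mul_form_comp, Finset.smul_sum]
  rw [Finset.sum_comm]
  have hc : Fintype.card {S : Finset (Fin (k + l)) // S.card = k ∧ Sᶜ.card = l} =
      (k + l).choose k := by
    have h : (Finset.univ.filter fun S : Finset (Fin (k + l)) => S.card = k ∧ Sᶜ.card = l) =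
        Finset.powersetCard k Finset.univ := by
      ext S
      have := Finset.card_add_card_compl S
      simp only [Fintype.card_fin] at this
      simp only [Finset.mem_filter, Finset.mem_univ, true_and, Finset.mem_powersetCard,
        Finset.subset_univ]
      omega
    rw [Fintype.card_subtype, h, Finset.card_powersetCard, Finset.card_univ, Fintype.card_fin]
  rw [← hc, ← Finset.card_univ, ← Finset.sum_const]
  exact Finset.sum_congr rfl fun S _ => permSum_comp_perm φ η (fun i => (e i).1) _

theorem form_mul_form (φ : Form R L k) (η : Form R L l) :
    form G φ * form G η = form G (wedgeForm k l φ η) := by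
  ext n v e β
  by_cases h : n = k + l ∧ v = 0
  · obtain ⟨rfl, rfl⟩ := h
    have h1 := factorial_smul_form_mul_form φ η e β
    rw [← factorial_smul_wedgeForm, smul_smul, ← mul_assoc,
      show (k + l).choose k * k.factorial * l.factorial = (k + l).factorial by
        rw [← Nat.choose_mul_factorial_mul_factorial (Nat.le_add_right k l),
          Nat.add_sub_cancel_left]] at h1
    rw [form_comp_self]
    rw [← Nat.cast_smul_eq_nsmul ℝ, ← Nat.cast_smul_eq_nsmul ℝ] at h1
    exact smul_right_injective R (Nat.cast_ne_zero.2 (Nat.factorial_ne_zero _)) h1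
  · rw [form_mul_form_comp_of_ne φ η h, form_comp_of_ne _ h]

end Wedge
end WeilRing
end WeilBRST

namespace WeilBRST

section Instances

variable {𝔤 : Type*} [LieRing 𝔤] [LieAlgebra ℝ 𝔤]

scoped instance : AddCommMonoid (Module.Dual ℝ 𝔤) := inferInstance
scoped instance : Module ℝ (Module.Dual ℝ 𝔤) := inferInstance
scoped instance : Semiring (ExteriorAlgebra ℝ (Module.Dual ℝ 𝔤)) := inferInstance
scoped instance : AddCommMonoid (ExteriorAlgebra ℝ (Module.Dual ℝ 𝔤)) := inferInstance
scoped instance : Algebra ℝ (ExteriorAlgebra ℝ (Module.Dual ℝ 𝔤)) := inferInstance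
scoped instance : Module ℝ (ExteriorAlgebra ℝ (Module.Dual ℝ 𝔤)) := inferInstance
scoped instance : Semiring (SymmetricAlgebra ℝ (Module.Dual ℝ 𝔤)) := inferInstance
scoped instance : AddCommMonoid (SymmetricAlgebra ℝ (Module.Dual ℝ 𝔤)) := inferInstance
scoped instance : Algebra ℝ (SymmetricAlgebra ℝ (Module.Dual ℝ 𝔤)) := inferInstance
scoped instance : Module ℝ (SymmetricAlgebra ℝ (Module.Dual ℝ 𝔤)) := inferInstance
scoped instance : Semiring (LieWeil 𝔤) := inferInstance
scoped instance : AddCommMonoid (LieWeil 𝔤) := inferInstance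
scoped instance : Algebra ℝ (LieWeil 𝔤) := inferInstance
scoped instance : Module ℝ (LieWeil 𝔤) := inferInstance

end Instances

namespace WeilRing

section Bounded

variable {R L G : Type*} [CommRing R] [Algebra ℝ R] [AddCommGroup L] [Module R L]
  [AddCommGroup G] [Module R G]

variable (R L G) in
/-- `WeilAlgebra`, as a subspace of the ring of cochains. -/
def weilSubmodule : Submodule ℝ (WeilRing R L G) := WeilAlgebra R L G

theorem mem_weilSubmodule {c : WeilRing R L G} : c ∈ weilSubmodule R L G ↔
    c ∈ altSym R L G ∧ ∃ N, ∀ n v, N ≤ n + v → ∀ e β, c.comp n v e β = 0 := by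
  constructor
  · rintro ⟨h1, h2, h3, N, hN⟩
    exact ⟨⟨h1, h2, h3⟩, N, fun n v h e β => congrFun (congrFun (hN n v h) e) β⟩
  · rintro ⟨⟨h1, h2, h3⟩, N, hN⟩
    exact ⟨h1, h2, h3, N, fun n v h => funext fun e => funext fun β => hN n v h e β⟩

theorem mul_mem_weilSubmodule {a b : WeilRing R L G} (ha : a ∈ weilSubmodule R L G)
    (hb : b ∈ weilSubmodule R L G) : a * b ∈ weilSubmodule R L G := by
  rw [mem_weilSubmodule] at *
  obtain ⟨ha, N, hN⟩ := ha
  obtain ⟨hb, N', hN'⟩ := hb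
  refine ⟨mul_mem_altSym ha hb, N + N', fun n v h e β => ?_⟩
  rw [mul_apply]
  refine Finset.sum_eq_zero fun S _ => Finset.sum_eq_zero fun T _ => ?_
  have h1 := Finset.card_add_card_compl S
  have h2 := Finset.card_add_card_compl T
  rw [Fintype.card_fin] at h1 h2
  by_cases h3 : N ≤ S.card + T.card
  · rw [hN _ _ h3, zero_mul, smul_zero]
  · rw [hN' _ _ (by omega), mul_zero, smul_zero]

theorem theta_mem_weilSubmodule (l : G →ₗ[R] R) : theta L l ∈ weilSubmodule R L G :=
  mem_weilSubmodule.2 ⟨theta_mem_altSym l, 2, fun n v h e β => by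
    rw [theta_comp, dif_neg (by omega)]⟩

theorem mu_mem_weilSubmodule (l : G →ₗ[R] R) : mu L l ∈ weilSubmodule R L G :=
  mem_weilSubmodule.2 ⟨mu_mem_altSym l, 2, fun n v h e β => by
    rw [mu_comp, dif_neg (by omega)]⟩

theorem form_mem_weilSubmodule {k : ℕ} (φ : L [⋀^Fin k]→ₗ[R] R) :
    form G φ ∈ weilSubmodule R L G :=
  mem_weilSubmodule.2 ⟨form_mem_altSym φ, k + 1, fun n v h e β => by
    rw [form_comp, dif_neg (by omega)]⟩

theorem ins_mem_weilSubmodule {c : WeilRing R L G} (hc : c ∈ weilSubmodule R L G) (e : L × G) :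
    ins e c ∈ weilSubmodule R L G := by
  rw [mem_weilSubmodule] at *
  obtain ⟨hc, N, hN⟩ := hc
  exact ⟨ins_mem_altSym hc e, N, fun n v h e β => hN _ _ (by omega) _ _⟩

theorem der_mem_weilSubmodule {c : WeilRing R L G} (hc : c ∈ weilSubmodule R L G) (β : G) :
    der β c ∈ weilSubmodule R L G := by
  rw [mem_weilSubmodule] at *
  obtain ⟨hc, N, hN⟩ := hc
  exact ⟨der_mem_altSym hc β, N, fun n v h e β => hN _ _ (by omega) _ _⟩

end Bounded

end WeilRing

section Induction

variable {𝔤 : Type*} [LieRing 𝔤] [LieAlgebra ℝ 𝔤]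
  {R L : Type*} [CommRing R] [Algebra ℝ R] [LieRing L] [Module R L] [LieAlgebra ℝ L]
  [LieRingModule L R] [LieRinehartRing R L] [LieRinehartAlgebra ℝ R L]

/-- Left multiplication with an element of `W(𝔤)`. -/
def leftMul (a : LieWeil 𝔤) : BRST 𝔤 R L →ₗ[ℝ] BRST 𝔤 R L :=
  TensorProduct.map (LinearMap.mulLeft ℝ a) LinearMap.id

theorem leftMul_tmul (a b : LieWeil 𝔤) (w : Forms R L) :
    leftMul a (b ⊗ₜ[ℝ] w : BRST 𝔤 R L) = (a * b) ⊗ₜ w := rfl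

theorem leftMul_add (a b : LieWeil 𝔤) (x : BRST 𝔤 R L) :
    leftMul (a + b) x = leftMul a x + leftMul b x := by
  induction x using TensorProduct.induction_on with
  | zero => simp
  | add x y hx hy => simp only [map_add, hx, hy]; abel
  | tmul c w => simp only [leftMul_tmul, add_mul, TensorProduct.add_tmul]

theorem leftMul_mul (a b : LieWeil 𝔤) (x : BRST 𝔤 R L) :
    leftMul (a * b) x = leftMul a (leftMul b x) := by
  induction x using TensorProduct.induction_on with
  | zero => simp
  | add x y hx hy => simp only [map_add, hx, hy]
  | tmul c w => simp only [leftMul_tmul, mul_assoc]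

theorem leftMul_algebraMap (r : ℝ) (x : BRST 𝔤 R L) :
    leftMul (algebraMap ℝ _ r) x = r • x := by
  induction x using TensorProduct.induction_on with
  | zero => simp
  | add x y hx hy => simp only [map_add, hx, hy, smul_add]
  | tmul c w => rw [leftMul_tmul, ← Algebra.smul_def, TensorProduct.smul_tmul']

theorem lieWeil_induction {P : LieWeil 𝔤 → Prop} (hr : ∀ r : ℝ, P (algebraMap ℝ _ r))
    (hadd : ∀ a b, P a → P b → P (a + b)) (hmul : ∀ a b, P a → P b → P (a * b))
    (hθ : ∀ ξ, P (theta ξ)) (hμ : ∀ ξ, P (mu ξ)) (a : LieWeil 𝔤) : P a := by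
  induction a using TensorProduct.induction_on with
  | zero => simpa using hr 0
  | add x y hx hy => exact hadd _ _ hx hy
  | tmul x y =>
    have h : x ⊗ₜ[ℝ] y = (x ⊗ₜ 1 : LieWeil 𝔤) * 1 ⊗ₜ y := by
      rw [Algebra.TensorProduct.tmul_mul_tmul, mul_one, one_mul]
    rw [h]
    clear h
    refine hmul _ _ ?_ ?_
    · induction x using ExteriorAlgebra.induction with
      | algebraMap r => exact hr r
      | ι ξ => exact hθ ξ
      | mul x y hx hy =>
        have := hmul _ _ (hx) (hy)
        rwa [Algebra.TensorProduct.tmul_mul_tmul, mul_one] at this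
      | add x y hx hy => rw [TensorProduct.add_tmul]; exact hadd _ _ hx hy
    · induction y using SymmetricAlgebra.induction with
      | algebraMap r =>
        have := hr r
        rwa [Algebra.TensorProduct.algebraMap_apply'] at this
      | ι ξ => exact hμ ξ
      | mul x y hx hy =>
        have := hmul _ _ (hx) (hy)
        rwa [Algebra.TensorProduct.tmul_mul_tmul, mul_one] at this
      | add x y hx hy => rw [TensorProduct.tmul_add]; exact hadd _ _ hx hy

theorem forms_induction {P : Forms R L → Prop} (hadd : ∀ w η, P w → P η → P (w + η))
    (hlof : ∀ k φ, P (DirectSum.lof ℝ ℕ (Form R L) k φ)) (w : Forms R L) : P w := by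
  induction w using DirectSum.induction_on with
  | zero => simpa using hlof 0 0
  | of k φ => exact hlof k φ
  | add x y hx hy => exact hadd _ _ hx hy

theorem brst_eq_top {Q : Submodule ℝ (BRST 𝔤 R L)}
    (hform : ∀ k (φ : Form R L k), 1 ⊗ₜ DirectSum.lof ℝ ℕ (Form R L) k φ ∈ Q)
    (hθ : ∀ ξ, ∀ x ∈ Q, leftMul (theta ξ) x ∈ Q)
    (hμ : ∀ ξ, ∀ x ∈ Q, leftMul (mu ξ) x ∈ Q) : Q = ⊤ := by
  rw [eq_top_iff]
  rintro x -
  have hsmul : ∀ a : LieWeil 𝔤, ∀ x ∈ Q, leftMul a x ∈ Q := by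
    intro a
    induction a using lieWeil_induction with
    | hr r => intro x hx; rw [leftMul_algebraMap]; exact Q.smul_mem r hx
    | hadd a b ha hb => intro x hx; rw [leftMul_add]; exact add_mem (ha x hx) (hb x hx)
    | hmul a b ha hb => intro x hx; rw [leftMul_mul]; exact ha _ (hb x hx)
    | hθ ξ => exact hθ ξ
    | hμ ξ => exact hμ ξ
  induction x using TensorProduct.induction_on with
  | zero => exact zero_mem _
  | add x y hx hy => exact add_mem hx hy
  | tmul a w =>
    have h : a ⊗ₜ[ℝ] w = leftMul a (1 ⊗ₜ[ℝ] w : BRST 𝔤 R L) := by rw [leftMul_tmul, mul_one]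
    rw [h]
    clear h
    refine hsmul _ _ ?_
    induction w using forms_induction with
    | hlof k φ => exact hform k φ
    | hadd x y hx hy => rw [TensorProduct.tmul_add]; exact add_mem hx hy

end Induction

section BrstMap

variable {𝔤 : Type*} [LieRing 𝔤] [LieAlgebra ℝ 𝔤]
  {R L G : Type*} [CommRing R] [Algebra ℝ R] [LieRing L] [Module R L] [LieAlgebra ℝ L]
  [LieRingModule L R] [LieRinehartRing R L] [LieRinehartAlgebra ℝ R L]
  [AddCommGroup G] [Module R G]
  (p : Module.Dual ℝ 𝔤 →ₗ[ℝ] G →ₗ[R] R)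

open WeilRing

variable (L) in
/-- The homomorphism from `Λ𝔤*` to the cochains. -/
def extMap : ExteriorAlgebra ℝ (Module.Dual ℝ 𝔤) →ₐ[ℝ] WeilRing R L G :=
  ExteriorAlgebra.lift ℝ ⟨{ toFun := fun ξ => WeilRing.theta L (p ξ)
                            map_add' := fun ξ η => by rw [map_add, theta_add]
                            map_smul' := fun r ξ => by rw [map_smul, theta_smul]; rfl },
    fun _ => theta_mul_self _⟩

variable (L) in
/-- The homomorphism from `S𝔤*` to the centre of the ring of cochains. -/
def symMapCenter : SymmetricAlgebra ℝ (Module.Dual ℝ 𝔤) →ₐ[ℝ]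
    Subalgebra.center ℝ (WeilRing R L G) :=
  SymmetricAlgebra.lift
    { toFun := fun ξ => ⟨WeilRing.mu L (p ξ), Subalgebra.mem_center_iff.2 fun c =>
        (mu_mul_comm (p ξ) c).symm⟩
      map_add' := fun ξ η => Subtype.ext ((congrArg _ (map_add p ξ η)).trans (mu_add _ _))
      map_smul' := fun r ξ => Subtype.ext ((congrArg _ (map_smul p r ξ)).trans (mu_smul _ _)) }

variable (L) in
/-- The homomorphism from `S𝔤*` to the cochains. -/
def symMap : SymmetricAlgebra ℝ (Module.Dual ℝ 𝔤) →ₐ[ℝ] WeilRing R L G :=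
  (Subalgebra.val _).comp (symMapCenter L p)

theorem symMap_comm (y : SymmetricAlgebra ℝ (Module.Dual ℝ 𝔤)) (c : WeilRing R L G) :
    c * symMap L p y = symMap L p y * c :=
  Subalgebra.mem_center_iff.1 (symMapCenter L p y).2 c

variable (L) in
/-- The homomorphism from `W(𝔤)` to the cochains. -/
def lieWeilMap : LieWeil 𝔤 →ₐ[ℝ] WeilRing R L G :=
  Algebra.TensorProduct.lift (extMap L p) (symMap L p) fun x y => symMap_comm p y (extMap L p x)

theorem lieWeilMap_tmul (x : ExteriorAlgebra ℝ (Module.Dual ℝ 𝔤))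
    (y : SymmetricAlgebra ℝ (Module.Dual ℝ 𝔤)) :
    lieWeilMap L p (x ⊗ₜ y) = extMap L p x * symMap L p y :=
  Algebra.TensorProduct.lift_tmul _ _ _ _ _

theorem extMap_ι (ξ : Module.Dual ℝ 𝔤) :
    extMap L p (ExteriorAlgebra.ι ℝ ξ) = WeilRing.theta L (p ξ) :=
  ExteriorAlgebra.lift_ι_apply _ _ _ _

theorem symMap_ι (ξ : Module.Dual ℝ 𝔤) :
    symMap L p (SymmetricAlgebra.ι ℝ _ ξ) = WeilRing.mu L (p ξ) := by
  simp [symMap, symMapCenter]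

theorem lieWeilMap_theta (ξ : Module.Dual ℝ 𝔤) :
    lieWeilMap L p (theta ξ) = WeilRing.theta L (p ξ) := by
  rw [theta, lieWeilMap_tmul, extMap_ι, map_one, mul_one]

theorem lieWeilMap_mu (ξ : Module.Dual ℝ 𝔤) :
    lieWeilMap L p (mu ξ) = WeilRing.mu L (p ξ) := by
  rw [mu, lieWeilMap_tmul, symMap_ι, map_one, one_mul]

variable (R L G) in
/-- The inclusion of the forms into the cochains. -/
def formMap : Forms R L →ₗ[ℝ] WeilRing R L G :=
  DirectSum.toModule ℝ ℕ _ fun _ =>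
    { toFun := form G
      map_add' := form_add
      map_smul' := form_smul }

theorem formMap_lof (k : ℕ) (φ : Form R L k) :
    formMap R L G (DirectSum.lof ℝ ℕ (Form R L) k φ) = form G φ :=
  DirectSum.toModule_lof _ _ _

variable (L) in
/-- The identification of the BRST algebra with the Weil algebra. -/
def brstMap : BRST 𝔤 R L →ₗ[ℝ] WeilRing R L G :=
  TensorProduct.lift ((LinearMap.mul ℝ (WeilRing R L G)).compl₁₂
    (lieWeilMap L p).toLinearMap (formMap R L G))

theorem brstMap_tmul (a : LieWeil 𝔤) (w : Forms R L) :
    brstMap L p (a ⊗ₜ w) = lieWeilMap L p a * formMap R L G w := rfl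

theorem brstMap_leftMul (a : LieWeil 𝔤) (x : BRST 𝔤 R L) :
    brstMap L p (leftMul a x) = lieWeilMap L p a * brstMap L p x := by
  induction x using TensorProduct.induction_on with
  | zero => simp
  | add x y hx hy => rw [map_add, map_add, map_add, hx, hy, mul_add]
  | tmul b w => rw [leftMul_tmul, brstMap_tmul, brstMap_tmul, map_mul, mul_assoc]

theorem brstMap_leftMul_theta (ξ : Module.Dual ℝ 𝔤) (x : BRST 𝔤 R L) :
    brstMap L p (leftMul (theta ξ) x) = WeilRing.theta L (p ξ) * brstMap L p x := by
  rw [brstMap_leftMul, lieWeilMap_theta]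

theorem brstMap_leftMul_mu (ξ : Module.Dual ℝ 𝔤) (x : BRST 𝔤 R L) :
    brstMap L p (leftMul (mu ξ) x) = WeilRing.mu L (p ξ) * brstMap L p x := by
  rw [brstMap_leftMul, lieWeilMap_mu]

theorem brstMap_one_tmul_lof (k : ℕ) (φ : Form R L k) :
    brstMap L p (1 ⊗ₜ DirectSum.lof ℝ ℕ (Form R L) k φ) = form G φ := by
  rw [brstMap_tmul, map_one, one_mul, formMap_lof]

theorem form_one : form G (AlternatingMap.constOfIsEmpty R L (Fin 0) (1 : R)) =
    (1 : WeilRing R L G) := by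
  ext n v e β
  rw [form_comp, one_apply]
  rfl

theorem formMap_oneForm : formMap R L G oneForm = 1 := by
  rw [oneForm, formMap_lof, form_one]

theorem brstMap_mem (x : BRST 𝔤 R L) : brstMap L p x ∈ weilSubmodule R L G := by
  have : (weilSubmodule R L G).comap (brstMap L p) = ⊤ := by
    refine brst_eq_top (fun k φ => ?_) (fun ξ x hx => ?_) (fun ξ x hx => ?_)
    · rw [Submodule.mem_comap, brstMap_one_tmul_lof]
      exact form_mem_weilSubmodule φ
    · rw [Submodule.mem_comap, brstMap_leftMul_theta]
      exact mul_mem_weilSubmodule (theta_mem_weilSubmodule _) hx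
    · rw [Submodule.mem_comap, brstMap_leftMul_mu]
      exact mul_mem_weilSubmodule (mu_mem_weilSubmodule _) hx
  exact (this ▸ Submodule.mem_top : x ∈ (weilSubmodule R L G).comap (brstMap L p))

theorem formMap_wedge (w η : Forms R L) :
    formMap R L G (wedge w η) = formMap R L G w * formMap R L G η := by
  induction w using forms_induction with
  | hadd x y hx hy => rw [map_add, LinearMap.add_apply, map_add, map_add, hx, hy, add_mul]
  | hlof k φ =>
    induction η using forms_induction with
    | hadd x y hx hy => rw [map_add, map_add, map_add, hx, hy, mul_add]
    | hlof l η =>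
      rw [formMap_lof, formMap_lof, form_mul_form, ← formMap_lof]
      congr 1
      simp [wedge]

theorem mul_extMap {c : WeilRing R L G} {k : ℕ} (hc : par c = (-1 : R) ^ k • c)
    (x : ExteriorAlgebra ℝ (Module.Dual ℝ 𝔤)) :
    c * extMap L p x = extMap L p ((CliffordAlgebra.involute
      (Q := (0 : QuadraticForm ℝ (Module.Dual ℝ 𝔤))))^[k] x) * c := by
  induction x using ExteriorAlgebra.induction with
  | algebraMap r =>
    have h : (CliffordAlgebra.involute (Q := (0 : QuadraticForm ℝ (Module.Dual ℝ 𝔤))))^[k]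
        (algebraMap ℝ _ r) = algebraMap ℝ _ r := Function.iterate_fixed (AlgHom.commutes _ r) k
    erw [h]
    rw [AlgHom.commutes, Algebra.commutes]
  | ι ξ =>
    have h : (CliffordAlgebra.involute (Q := (0 : QuadraticForm ℝ (Module.Dual ℝ 𝔤))))^[k]
        (ExteriorAlgebra.ι ℝ ξ) = (-1 : ℝ) ^ k • ExteriorAlgebra.ι ℝ ξ := by
      clear hc
      induction k with
      | zero => simp
      | succ k ih =>
        rw [Function.iterate_succ_apply', ih, map_smul, pow_succ, mul_smul, neg_smul, one_smul]
        exact congrArg _ (CliffordAlgebra.involute_ι ξ)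
    erw [h]
    rw [map_smul, extMap_ι, smul_mul_assoc, theta_mul_comm, hc]
    rcases Nat.even_or_odd k with h | h <;> simp [h.neg_one_pow]
  | mul x y hx hy =>
    rw [map_mul, ← mul_assoc, hx, mul_assoc, hy, ← mul_assoc, ← map_mul]
    congr 2
    exact (iterate_map_mul _ _ _ _).symm
  | add x y hx hy =>
    rw [map_add, mul_add, hx, hy, ← add_mul, ← map_add]
    congr 2
    exact (iterate_map_add _ _ _ _).symm

theorem mul_lieWeilMap {c : WeilRing R L G} {k : ℕ} (hc : par c = (-1 : R) ^ k • c)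
    (b : LieWeil 𝔤) : c * lieWeilMap L p b = lieWeilMap L p ((weilParity ^ k) b) * c := by
  induction b using TensorProduct.induction_on with
  | zero => simp
  | add x y hx hy => rw [map_add, map_add, map_add, mul_add, add_mul, hx, hy]
  | tmul x y =>
    have h : (weilParity ^ k) (x ⊗ₜ[ℝ] y) = ((CliffordAlgebra.involute
      (Q := (0 : QuadraticForm ℝ (Module.Dual ℝ 𝔤))))^[k] x) ⊗ₜ[ℝ] y := by
      rw [Module.End.pow_apply]
      clear hc
      induction k with
      | zero => rfl
      | succ k ih => 
        rw [Function.iterate_succ_apply', Function.iterate_succ_apply', ih]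
        rfl
    rw [h, lieWeilMap_tmul, lieWeilMap_tmul, ← mul_assoc, mul_extMap p hc, mul_assoc, mul_assoc,
      symMap_comm]

theorem brstMap_brstMul (x y : BRST 𝔤 R L) :
    brstMap L p (brstMul x y) = brstMap L p x * brstMap L p y := by
  induction x using TensorProduct.induction_on with
  | zero => simp
  | add x x' hx hx' => rw [map_add, LinearMap.add_apply, map_add, map_add, hx, hx', add_mul]
  | tmul a w =>
    induction w using forms_induction with
    | hadd x x' hx hx' =>
      rw [TensorProduct.tmul_add, map_add, LinearMap.add_apply, map_add, map_add, hx, hx', add_mul]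
    | hlof k φ =>
      induction y using TensorProduct.induction_on with
      | zero => simp
      | add y y' hy hy' => rw [map_add, map_add, map_add, hy, hy', mul_add]
      | tmul b η =>
        rw [brstMul_apply, brstMap_tmul, brstMap_tmul, brstMap_tmul, map_mul, formMap_wedge,
          mul_assoc, mul_assoc, formMap_lof, ← mul_assoc (lieWeilMap L p ((weilParity ^ k) b)),
          ← mul_lieWeilMap p (par_form φ), mul_assoc]

end BrstMap
end WeilBRST

namespace WeilBRST

section Generation

variable {V ι : Type*} [AddCommGroup V] [Module ℝ V] [Fintype ι] [DecidableEq ι]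
  {T I M D : ι → V →ₗ[ℝ] V} {K Q : Submodule ℝ V}

theorem le_of_clifford (hKT : ∀ a, ∀ x ∈ K, T a x ∈ K) (hKI : ∀ a, ∀ x ∈ K, I a x ∈ K)
    (hIT : ∀ a b, ∀ x ∈ K, I a (T b x) = (if a = b then x else 0) - T b (I a x))
    (hII : ∀ a b, ∀ x ∈ K, I a (I b x) = - I b (I a x))
    (hQT : ∀ a, ∀ x ∈ Q, T a x ∈ Q) (h0 : ∀ x ∈ K, (∀ a, I a x = 0) → x ∈ Q) : K ≤ Q := by
  have h : ∀ s : Finset ι, ∀ x ∈ K, (∀ a ∉ s, I a x = 0) → x ∈ Q := by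
    intro s
    induction s using Finset.induction_on with
    | empty => intro x hx h; exact h0 x hx fun a => h a (Finset.notMem_empty a)
    | insert a s _ ih =>
      intro x hx h
      have hself : ∀ x ∈ K, I a (I a x) = 0 := fun x hx => by
        have h2 : (2 : ℝ) • I a (I a x) = 0 := by
          rw [two_smul]
          exact add_eq_zero_iff_eq_neg.2 (hII a a x hx)
        exact (smul_eq_zero.1 h2).resolve_left two_ne_zero
      have h1 : I a x ∈ Q := by
        refine ih _ (hKI a x hx) fun b hb => ?_
        by_cases hba : b = a
        · rw [hba, hself x hx]
        · rw [hII b a x hx, h b (by simp [hba, hb]), map_zero, neg_zero]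
      have h2 : I a (T a x) ∈ Q := by
        refine ih _ (hKI a _ (hKT a x hx)) fun b hb => ?_
        by_cases hba : b = a
        · rw [hba, hself _ (hKT a x hx)]
        · rw [hII b a _ (hKT a x hx), hIT b a x hx, if_neg hba, h b (by simp [hba, hb])]
          simp
      have h3 := hIT a a x hx
      rw [if_pos rfl, eq_sub_iff_add_eq] at h3
      rw [← h3]
      exact add_mem h2 (hQT a _ h1)
  exact fun x hx => h Finset.univ x hx fun a ha => absurd (Finset.mem_univ a) ha

/-- The elements that are killed by all the products of `N` of the operators `D a`. -/
def nilOrder (D : ι → V →ₗ[ℝ] V) : ℕ → Submodule ℝ V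
  | 0 => ⊥
  | N + 1 => ⨅ a, (nilOrder D N).comap (D a)

theorem mem_nilOrder_succ {N : ℕ} {x : V} :
    x ∈ nilOrder D (N + 1) ↔ ∀ a, D a x ∈ nilOrder D N := by
  simp [nilOrder]

theorem nilOrder_le_succ (N : ℕ) : nilOrder D N ≤ nilOrder D (N + 1) := by
  induction N with
  | zero => exact bot_le
  | succ N ih => exact fun x hx => mem_nilOrder_succ.2 fun a => ih (mem_nilOrder_succ.1 hx a)

theorem nilOrder_mono : Monotone (nilOrder D) := monotone_nat_of_le_succ nilOrder_le_succ

theorem le_of_weyl (hKM : ∀ a, ∀ x ∈ K, M a x ∈ K) (hKD : ∀ a, ∀ x ∈ K, D a x ∈ K)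
    (hDM : ∀ a b, ∀ x ∈ K, D a (M b x) = (if a = b then x else 0) + M b (D a x))
    (hDD : ∀ a b, ∀ x ∈ K, D a (D b x) = D b (D a x)) (hnil : ∀ x ∈ K, ∃ N, x ∈ nilOrder D N)
    (hQM : ∀ a, ∀ x ∈ Q, M a x ∈ Q) (h0 : ∀ x ∈ K, (∀ a, D a x = 0) → x ∈ Q) : K ≤ Q := by
  have hE : ∀ N, ∀ x ∈ K, x ∈ nilOrder D (N + 1) →
      (N : ℝ) • x - ∑ a, M a (D a x) ∈ nilOrder D N := by
    intro N
    induction N with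
    | zero =>
      intro x _ h
      have : ∀ a, D a x = 0 := fun a => mem_nilOrder_succ.1 h a
      simp [this]
    | succ N ih =>
      intro x hx h
      rw [mem_nilOrder_succ] at h ⊢
      intro b
      convert ih (D b x) (hKD b x hx) (h b) using 1
      have h1 : ∀ a, D b (M a (D a x)) = (if b = a then D a x else 0) + M a (D a (D b x)) :=
        fun a => by rw [hDM b a _ (hKD a x hx), hDD b a x hx]
      simp only [map_sub, map_smul, map_sum, h1, Finset.sum_add_distrib, Finset.sum_ite_eq,
        Finset.mem_univ, if_true]
      push_cast
      module
  have hN : ∀ N, ∀ x ∈ K, x ∈ nilOrder D N → x ∈ Q := by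
    intro N
    induction N with
    | zero =>
      intro x hx h
      rw [(Submodule.mem_bot ℝ).1 h]
      exact zero_mem _
    | succ N ih =>
      intro x hx h
      have h1 : ∀ a, D a x ∈ Q := fun a => ih _ (hKD a x hx) (mem_nilOrder_succ.1 h a)
      have h2 : ∑ a, M a (D a x) ∈ Q := sum_mem fun a _ => hQM a _ (h1 a)
      have h3 : ∑ a, M a (D a x) ∈ K := sum_mem fun a _ => hKM a _ (hKD a x hx)
      obtain _ | N := N
      · exact h0 x hx fun a => mem_nilOrder_succ.1 h a
      · have h4 := ih _ (sub_mem (K.smul_mem ((N + 1 : ℕ) : ℝ) hx) h3) (hE _ x hx h)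
        have h5 := add_mem h4 h2
        rw [sub_add_cancel] at h5
        exact (Q.smul_mem_iff (Nat.cast_ne_zero.2 (Nat.succ_ne_zero N))).1 h5
  intro x hx
  obtain ⟨N, h⟩ := hnil x hx
  exact hN N x hx h

theorem le_of_clifford_weyl (hKT : ∀ a, ∀ x ∈ K, T a x ∈ K) (hKI : ∀ a, ∀ x ∈ K, I a x ∈ K)
    (hKM : ∀ a, ∀ x ∈ K, M a x ∈ K) (hKD : ∀ a, ∀ x ∈ K, D a x ∈ K)
    (hIT : ∀ a b, ∀ x ∈ K, I a (T b x) = (if a = b then x else 0) - T b (I a x))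
    (hII : ∀ a b, ∀ x ∈ K, I a (I b x) = - I b (I a x))
    (hDM : ∀ a b, ∀ x ∈ K, D a (M b x) = (if a = b then x else 0) + M b (D a x))
    (hDD : ∀ a b, ∀ x ∈ K, D a (D b x) = D b (D a x))
    (hDT : ∀ a b, ∀ x ∈ K, D a (T b x) = T b (D a x))
    (hDI : ∀ a b, ∀ x ∈ K, D a (I b x) = I b (D a x))
    (hnil : ∀ x ∈ K, ∃ N, x ∈ nilOrder D N)
    (hQT : ∀ a, ∀ x ∈ Q, T a x ∈ Q) (hQM : ∀ a, ∀ x ∈ Q, M a x ∈ Q)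
    (h0 : ∀ x ∈ K, (∀ a, I a x = 0) → (∀ a, D a x = 0) → x ∈ Q) : K ≤ Q := by
  refine le_of_weyl hKM hKD hDM hDD hnil hQM fun x hx hDx => ?_
  have hmem : ∀ x, x ∈ K ⊓ (⨅ a, LinearMap.ker (D a)) ↔ x ∈ K ∧ ∀ a, D a x = 0 := by
    intro x
    simp [Submodule.mem_inf, Submodule.mem_iInf]
  refine le_of_clifford (K := K ⊓ (⨅ a, LinearMap.ker (D a))) (T := T) (I := I)
    (fun a x hx => ?_) (fun a x hx => ?_) (fun a b x hx => hIT a b x ((hmem x).1 hx).1)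
    (fun a b x hx => hII a b x ((hmem x).1 hx).1) hQT (fun x hx h => ?_) ((hmem x).2 ⟨hx, hDx⟩)
  · obtain ⟨h1, h2⟩ := (hmem x).1 hx
    exact (hmem _).2 ⟨hKT a x h1, fun b => by rw [hDT b a x h1, h2, map_zero]⟩
  · obtain ⟨h1, h2⟩ := (hmem x).1 hx
    exact (hmem _).2 ⟨hKI a x h1, fun b => by rw [hDI b a x h1, h2, map_zero]⟩
  · exact h0 x ((hmem x).1 hx).1 h ((hmem x).1 hx).2

/-- The product of the operators `E - n`, for `1 ≤ n ≤ N`. -/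
def descProd (E : V →ₗ[ℝ] V) : ℕ → V →ₗ[ℝ] V
  | 0 => LinearMap.id
  | N + 1 => (E - ((N + 1 : ℕ) : ℝ) • LinearMap.id) ∘ₗ descProd E N

theorem descProd_succ (E : V →ₗ[ℝ] V) (N : ℕ) (x : V) :
    descProd E (N + 1) x = E (descProd E N x) - ((N + 1 : ℕ) : ℝ) • descProd E N x := rfl

theorem descProd_shift {E S : V →ₗ[ℝ] V} (h : ∀ x, E (S x) = S (E x) + S x) (N : ℕ) (x : V) :
    descProd E (N + 1) (S x) = S (E (descProd E N x)) := by
  induction N with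
  | zero =>
    rw [descProd_succ]
    change E (S x) - ((0 + 1 : ℕ) : ℝ) • S x = S (E x)
    rw [h]
    push_cast
    module
  | succ N ih =>
    rw [descProd_succ, ih, h, descProd_succ]
    simp only [map_sub, map_smul]
    push_cast
    module

theorem mem_of_euler {E : V →ₗ[ℝ] V} {S : Set (V →ₗ[ℝ] V)}
    (hS : ∀ s ∈ S, ∀ x, E (s x) = s (E x) + s x) (hQ : ∀ x ∈ Q, E x = 0)
    (hgen : ∀ P : Submodule ℝ V, Q ≤ P → (∀ s ∈ S, ∀ x ∈ P, s x ∈ P) → P = ⊤) {x : V}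
    (hx : E x = 0) : x ∈ Q := by
  have hmono : ∀ {N N' : ℕ} {x : V}, N ≤ N' → descProd E N x ∈ Q → descProd E N' x ∈ Q := by
    intro N N' x hN h
    induction N', hN using Nat.le_induction with
    | base => exact h
    | succ N' _ ih =>
      rw [descProd_succ, hQ _ ih, zero_sub]
      exact neg_mem (Q.smul_mem _ ih)
  let P : Submodule ℝ V :=
    { carrier := {x | ∃ N, descProd E N x ∈ Q}
      add_mem' := by
        rintro x y ⟨N, hN⟩ ⟨N', hN'⟩
        refine ⟨max N N', ?_⟩
        rw [map_add]
        exact add_mem (hmono (le_max_left _ _) hN) (hmono (le_max_right _ _) hN')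
      zero_mem' := ⟨0, by rw [map_zero]; exact zero_mem _⟩
      smul_mem' := by
        rintro r x ⟨N, hN⟩
        refine ⟨N, ?_⟩
        rw [map_smul]
        exact Q.smul_mem _ hN }
  have hP : P = ⊤ := by
    refine hgen P (fun x hx => ⟨0, hx⟩) ?_
    rintro s hs x ⟨N, hN⟩
    refine ⟨N + 1, ?_⟩
    rw [descProd_shift (hS s hs), hQ _ hN, map_zero]
    exact zero_mem _
  obtain ⟨N, hN⟩ : x ∈ P := hP ▸ Submodule.mem_top
  have hc : ∀ N, ∃ r : ℝ, r ≠ 0 ∧ descProd E N x = r • x := by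
    intro N
    induction N with
    | zero => exact ⟨1, one_ne_zero, (one_smul _ _).symm⟩
    | succ N ih =>
      obtain ⟨r, hr, h⟩ := ih
      refine ⟨-((N + 1 : ℕ) : ℝ) * r, mul_ne_zero (neg_ne_zero.2 (Nat.cast_ne_zero.2
        (Nat.succ_ne_zero N))) hr, ?_⟩
      rw [descProd_succ, h, map_smul, hx]
      module
  obtain ⟨r, hr, h⟩ := hc N
  rw [h] at hN
  exact (Q.smul_mem_iff hr).1 hN

end Generation

section LieWeilOps

variable {𝔤 : Type*} [LieRing 𝔤] [LieAlgebra ℝ 𝔤]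
  {ι : Type*} [Fintype ι] [DecidableEq ι] (b : Module.Basis ι ℝ 𝔤)

theorem theta_mul_tmul (ξ : Module.Dual ℝ 𝔤) (x : ExteriorAlgebra ℝ (Module.Dual ℝ 𝔤))
    (y : SymmetricAlgebra ℝ (Module.Dual ℝ 𝔤)) :
    theta ξ * (x ⊗ₜ[ℝ] y) = (ExteriorAlgebra.ι ℝ ξ * x) ⊗ₜ y := by
  rw [theta, Algebra.TensorProduct.tmul_mul_tmul, one_mul]

theorem mu_mul_tmul (ξ : Module.Dual ℝ 𝔤) (x : ExteriorAlgebra ℝ (Module.Dual ℝ 𝔤))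
    (y : SymmetricAlgebra ℝ (Module.Dual ℝ 𝔤)) :
    mu ξ * (x ⊗ₜ[ℝ] y) = x ⊗ₜ (SymmetricAlgebra.ι ℝ _ ξ * y) := by
  rw [mu, Algebra.TensorProduct.tmul_mul_tmul, one_mul]

theorem theta_mul_theta (ξ η : Module.Dual ℝ 𝔤) :
    theta ξ * theta η = - (theta η * theta ξ) := by
  have h : (ExteriorAlgebra.ι ℝ ξ * ExteriorAlgebra.ι ℝ η : ExteriorAlgebra ℝ (Module.Dual ℝ 𝔤)) =
      - (ExteriorAlgebra.ι ℝ η * ExteriorAlgebra.ι ℝ ξ) :=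
    eq_neg_of_add_eq_zero_left (ExteriorAlgebra.ι_add_mul_swap ξ η)
  rw [theta, theta, Algebra.TensorProduct.tmul_mul_tmul, Algebra.TensorProduct.tmul_mul_tmul, h,
    TensorProduct.neg_tmul]

theorem mu_mul_comm (ξ : Module.Dual ℝ 𝔤) (z : LieWeil 𝔤) : mu ξ * z = z * mu ξ := by
  induction z using TensorProduct.induction_on with
  | zero => simp
  | add x y hx hy => rw [mul_add, add_mul, hx, hy]
  | tmul x y =>
    rw [mu, Algebra.TensorProduct.tmul_mul_tmul, Algebra.TensorProduct.tmul_mul_tmul, one_mul,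
      mul_one, mul_comm]

theorem derivTheta_tmul (u : 𝔤) (x : ExteriorAlgebra ℝ (Module.Dual ℝ 𝔤))
    (y : SymmetricAlgebra ℝ (Module.Dual ℝ 𝔤)) : derivTheta u (x ⊗ₜ y) =
      CliffordAlgebra.contractLeft (Q := (0 : QuadraticForm ℝ (Module.Dual ℝ 𝔤)))
        (Module.Dual.eval ℝ 𝔤 u) x ⊗ₜ y := rfl

theorem derivTheta_theta_mul (u : 𝔤) (ξ : Module.Dual ℝ 𝔤) (z : LieWeil 𝔤) :
    derivTheta u (theta ξ * z) = ξ u • z - theta ξ * derivTheta u z := by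
  induction z using TensorProduct.induction_on with
  | zero => simp
  | add x y hx hy => simp only [mul_add, map_add, hx, hy, smul_add]; abel
  | tmul x y =>
    rw [theta_mul_tmul, derivTheta_tmul, derivTheta_tmul, theta_mul_tmul]
    erw [CliffordAlgebra.contractLeft_ι_mul]
    rw [TensorProduct.sub_tmul, ← TensorProduct.smul_tmul']
    rfl

theorem derivTheta_mu_mul (u : 𝔤) (ξ : Module.Dual ℝ 𝔤) (z : LieWeil 𝔤) :
    derivTheta u (mu ξ * z) = mu ξ * derivTheta u z := by
  induction z using TensorProduct.induction_on with
  | zero => simp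
  | add x y hx hy => simp only [mul_add, map_add, hx, hy]
  | tmul x y => rw [mu_mul_tmul, derivTheta_tmul, derivTheta_tmul, mu_mul_tmul]

theorem derivTheta_one (u : 𝔤) : derivTheta u 1 = 0 := by
  rw [Algebra.TensorProduct.one_def, derivTheta_tmul]
  erw [CliffordAlgebra.contractLeft_one]
  rw [TensorProduct.zero_tmul]

theorem derivTheta_derivTheta (u v : 𝔤) (z : LieWeil 𝔤) :
    derivTheta u (derivTheta v z) = - derivTheta v (derivTheta u z) := by
  induction z using TensorProduct.induction_on with
  | zero => simp
  | add x y hx hy => simp only [map_add, hx, hy]; abel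
  | tmul x y =>
    simp only [derivTheta_tmul]
    rw [CliffordAlgebra.contractLeft_comm, TensorProduct.neg_tmul]

theorem derivSym_ι_mul (i : ι) (ξ : Module.Dual ℝ 𝔤)
    (y : SymmetricAlgebra ℝ (Module.Dual ℝ 𝔤)) :
    derivSym b i (SymmetricAlgebra.ι ℝ _ ξ * y) =
      ξ (b i) • y + SymmetricAlgebra.ι ℝ _ ξ * derivSym b i y := by
  have h : MvPolynomial.pderiv i (SymmetricAlgebra.equivMvPolynomial b.dualBasis
      (SymmetricAlgebra.ι ℝ _ ξ)) = MvPolynomial.C (ξ (b i)) := by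
    have h1 : ∀ j, SymmetricAlgebra.equivMvPolynomial b.dualBasis
        (SymmetricAlgebra.ι ℝ _ (b.dualBasis j)) = MvPolynomial.X j := fun j =>
      SymmetricAlgebra.equivMvPolynomial_ι_apply _ _
    conv_lhs => rw [← b.dualBasis.sum_repr ξ]
    simp only [map_sum, map_smul, h1, Derivation.map_smul, MvPolynomial.pderiv_X, Pi.single_apply,
      smul_ite, smul_zero, Finset.sum_ite_eq, Finset.sum_ite_eq', Finset.mem_univ, if_true,
      Module.Basis.dualBasis_repr, MvPolynomial.smul_eq_C_mul, mul_one, MvPolynomial.pderiv_C_mul,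
      Finset.sum_ite_eq, mul_ite, mul_zero]
  apply (SymmetricAlgebra.equivMvPolynomial b.dualBasis).injective
  simp only [derivSym, LinearMap.comp_apply, AlgEquiv.toLinearMap_apply, map_mul, map_add,
    map_smul, AlgEquiv.apply_symm_apply]
  change MvPolynomial.pderiv i (_ * _) = _
  rw [Derivation.leibniz, h]
  simp only [smul_eq_mul]
  rw [MvPolynomial.smul_eq_C_mul]
  change _ = _ + _ * MvPolynomial.pderiv i _
  ring

theorem derivSym_one (i : ι) : derivSym b i 1 = 0 := by
  simp [derivSym]

theorem derivSym_comm (i j : ι) (y : SymmetricAlgebra ℝ (Module.Dual ℝ 𝔤)) :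
    derivSym b i (derivSym b j y) = derivSym b j (derivSym b i y) := by
  have h : ∀ f : MvPolynomial ι ℝ, MvPolynomial.pderiv i (MvPolynomial.pderiv j f) =
      MvPolynomial.pderiv j (MvPolynomial.pderiv i f) := by
    intro f
    induction f using MvPolynomial.induction_on with
    | C r => simp
    | add f g hf hg => simp only [map_add, hf, hg]
    | mul_X f k hf =>
      simp only [Derivation.leibniz, map_add, smul_eq_mul, hf, MvPolynomial.pderiv_X,
        Pi.single_apply, apply_ite (MvPolynomial.pderiv (R := ℝ) (σ := ι) _), map_zero,
        Derivation.map_one_eq_zero, ite_self, mul_zero, zero_add]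
      ring
  simp only [derivSym, LinearMap.comp_apply, AlgEquiv.toLinearMap_apply,
    AlgEquiv.apply_symm_apply]
  exact congrArg _ (h _)

theorem derivMu_tmul (i : ι) (x : ExteriorAlgebra ℝ (Module.Dual ℝ 𝔤))
    (y : SymmetricAlgebra ℝ (Module.Dual ℝ 𝔤)) :
    derivMu b i (x ⊗ₜ y) = x ⊗ₜ derivSym b i y := rfl

theorem derivMu_mu_mul (i : ι) (ξ : Module.Dual ℝ 𝔤) (z : LieWeil 𝔤) :
    derivMu b i (mu ξ * z) = ξ (b i) • z + mu ξ * derivMu b i z := by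
  induction z using TensorProduct.induction_on with
  | zero => simp
  | add x y hx hy => simp only [mul_add, map_add, hx, hy, smul_add]; abel
  | tmul x y =>
    rw [mu_mul_tmul, derivMu_tmul, derivMu_tmul, mu_mul_tmul, derivSym_ι_mul,
      TensorProduct.tmul_add, TensorProduct.tmul_smul]

theorem derivMu_theta_mul (i : ι) (ξ : Module.Dual ℝ 𝔤) (z : LieWeil 𝔤) :
    derivMu b i (theta ξ * z) = theta ξ * derivMu b i z := by
  induction z using TensorProduct.induction_on with
  | zero => simp
  | add x y hx hy => simp only [mul_add, map_add, hx, hy]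
  | tmul x y => rw [theta_mul_tmul, derivMu_tmul, derivMu_tmul, theta_mul_tmul]

theorem derivMu_one (i : ι) : derivMu b i 1 = 0 := by
  rw [Algebra.TensorProduct.one_def, derivMu_tmul, derivSym_one, TensorProduct.tmul_zero]

theorem derivMu_comm (i j : ι) (z : LieWeil 𝔤) :
    derivMu b i (derivMu b j z) = derivMu b j (derivMu b i z) := by
  induction z using TensorProduct.induction_on with
  | zero => simp
  | add x y hx hy => simp only [map_add, hx, hy]
  | tmul x y => simp only [derivMu_tmul, derivSym_comm b i j]

theorem derivMu_derivTheta (i : ι) (u : 𝔤) (z : LieWeil 𝔤) :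
    derivMu b i (derivTheta u z) = derivTheta u (derivMu b i z) := by
  induction z using TensorProduct.induction_on with
  | zero => simp
  | add x y hx hy => simp only [map_add, hx, hy]
  | tmul x y => simp only [derivMu_tmul, derivTheta_tmul]

end LieWeilOps
end WeilBRST

namespace WeilBRST

section BrstOps

variable {𝔤 : Type*} [LieRing 𝔤] [LieAlgebra ℝ 𝔤]
  {R L : Type*} [CommRing R] [Algebra ℝ R] [LieRing L] [Module R L] [LieAlgebra ℝ L]
  [LieRingModule L R] [LieRinehartRing R L] [LieRinehartAlgebra ℝ R L]
  {ι : Type*} [Fintype ι] [DecidableEq ι] (b : Module.Basis ι ℝ 𝔤)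

/-- An operator on `W(𝔤)`, acting on the first factor of the BRST algebra. -/
def onFst (D : LieWeil 𝔤 →ₗ[ℝ] LieWeil 𝔤) : BRST 𝔤 R L →ₗ[ℝ] BRST 𝔤 R L :=
  TensorProduct.map D LinearMap.id

theorem onFst_tmul (D : LieWeil 𝔤 →ₗ[ℝ] LieWeil 𝔤) (a : LieWeil 𝔤) (w : Forms R L) :
    onFst D (a ⊗ₜ[ℝ] w : BRST 𝔤 R L) = D a ⊗ₜ w := rfl

theorem derivTheta_leftMul_theta (u : 𝔤) (ξ : Module.Dual ℝ 𝔤) (x : BRST 𝔤 R L) :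
    onFst (derivTheta u) (leftMul (theta ξ) x) =
      ξ u • x - leftMul (theta ξ) (onFst (derivTheta u) x) := by
  induction x using TensorProduct.induction_on with
  | zero => simp
  | add x y hx hy => simp only [map_add, hx, hy, smul_add]; abel
  | tmul a w =>
    rw [leftMul_tmul, onFst_tmul, onFst_tmul, leftMul_tmul, derivTheta_theta_mul,
      TensorProduct.sub_tmul, TensorProduct.smul_tmul']

theorem derivTheta_leftMul_mu (u : 𝔤) (ξ : Module.Dual ℝ 𝔤) (x : BRST 𝔤 R L) :
    onFst (derivTheta u) (leftMul (mu ξ) x) = leftMul (mu ξ) (onFst (derivTheta u) x) := by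
  induction x using TensorProduct.induction_on with
  | zero => simp
  | add x y hx hy => simp only [map_add, hx, hy]
  | tmul a w =>
    rw [leftMul_tmul, onFst_tmul, onFst_tmul, leftMul_tmul, derivTheta_mu_mul]

theorem derivMu_leftMul_mu (i : ι) (ξ : Module.Dual ℝ 𝔤) (x : BRST 𝔤 R L) :
    onFst (derivMu b i) (leftMul (mu ξ) x) =
      ξ (b i) • x + leftMul (mu ξ) (onFst (derivMu b i) x) := by
  induction x using TensorProduct.induction_on with
  | zero => simp
  | add x y hx hy => simp only [map_add, hx, hy, smul_add]; abel
  | tmul a w =>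
    rw [leftMul_tmul, onFst_tmul, onFst_tmul, leftMul_tmul, derivMu_mu_mul,
      TensorProduct.add_tmul, TensorProduct.smul_tmul']

theorem derivMu_leftMul_theta (i : ι) (ξ : Module.Dual ℝ 𝔤) (x : BRST 𝔤 R L) :
    onFst (derivMu b i) (leftMul (theta ξ) x) =
      leftMul (theta ξ) (onFst (derivMu b i) x) := by
  induction x using TensorProduct.induction_on with
  | zero => simp
  | add x y hx hy => simp only [map_add, hx, hy]
  | tmul a w =>
    rw [leftMul_tmul, onFst_tmul, onFst_tmul, leftMul_tmul, derivMu_theta_mul]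

theorem onFst_derivTheta_comm (u v : 𝔤) (x : BRST 𝔤 R L) :
    onFst (derivTheta u) (onFst (derivTheta v) x) =
      - onFst (derivTheta v) (onFst (derivTheta u) x) := by
  induction x using TensorProduct.induction_on with
  | zero => simp only [map_zero]; exact (neg_zero (G := BRST 𝔤 R L)).symm
  | add x y hx hy => simp only [map_add, hx, hy]; abel
  | tmul a w => simp only [onFst_tmul]; rw [derivTheta_derivTheta, TensorProduct.neg_tmul]

theorem onFst_derivMu_comm (i j : ι) (x : BRST 𝔤 R L) :
    onFst (derivMu b i) (onFst (derivMu b j) x) = onFst (derivMu b j) (onFst (derivMu b i) x) := by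
  induction x using TensorProduct.induction_on with
  | zero => simp
  | add x y hx hy => simp only [map_add, hx, hy]
  | tmul a w => simp only [onFst_tmul]; rw [derivMu_comm]

theorem onFst_derivMu_derivTheta (i : ι) (u : 𝔤) (x : BRST 𝔤 R L) :
    onFst (derivMu b i) (onFst (derivTheta u) x) =
      onFst (derivTheta u) (onFst (derivMu b i) x) := by
  induction x using TensorProduct.induction_on with
  | zero => simp
  | add x y hx hy => simp only [map_add, hx, hy]
  | tmul a w => simp only [onFst_tmul]; rw [derivMu_derivTheta]

theorem leftMul_smul (r : ℝ) (a : LieWeil 𝔤) (x : BRST 𝔤 R L) :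
    leftMul (r • a) x = r • leftMul a x := by
  induction x using TensorProduct.induction_on with
  | zero => simp
  | add x y hx hy => simp only [map_add, hx, hy, smul_add]
  | tmul c w => rw [leftMul_tmul, leftMul_tmul, smul_mul_assoc, TensorProduct.smul_tmul']

theorem leftMul_neg (a : LieWeil 𝔤) (x : BRST 𝔤 R L) : leftMul (-a) x = - leftMul a x := by
  have h := leftMul_algebraMap (𝔤 := 𝔤) (0 : ℝ) x
  rw [map_zero, zero_smul, ← neg_add_cancel a, leftMul_add] at h
  exact eq_neg_of_add_eq_zero_left (G := BRST 𝔤 R L) h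

theorem leftMul_sum {s : Finset ι} (a : ι → LieWeil 𝔤) (x : BRST 𝔤 R L) :
    leftMul (∑ i ∈ s, a i) x = ∑ i ∈ s, leftMul (a i) x := by
  induction s using Finset.cons_induction with
  | empty => simpa using leftMul_algebraMap (0 : ℝ) x
  | cons i s hi ih => rw [Finset.sum_cons, Finset.sum_cons, leftMul_add, ih]

theorem theta_eq_sum (ξ : Module.Dual ℝ 𝔤) : theta ξ = ∑ a, ξ (b a) • theta (b.coord a) := by
  conv_lhs => rw [← b.sum_dual_apply_smul_coord ξ]
  simp only [theta, map_sum, map_smul, TensorProduct.sum_tmul, TensorProduct.smul_tmul']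

theorem mu_eq_sum (ξ : Module.Dual ℝ 𝔤) : mu ξ = ∑ a, ξ (b a) • mu (b.coord a) := by
  conv_lhs => rw [← b.sum_dual_apply_smul_coord ξ]
  simp only [mu, map_sum, map_smul, TensorProduct.tmul_sum, TensorProduct.tmul_smul]

/-- The Euler operator of the generators of `W(𝔤)`. -/
def brstEuler : BRST 𝔤 R L →ₗ[ℝ] BRST 𝔤 R L :=
  ∑ a, leftMul (theta (b.coord a)) ∘ₗ onFst (derivTheta (b a)) +
    ∑ a, leftMul (mu (b.coord a)) ∘ₗ onFst (derivMu b a)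

theorem brstEuler_apply (x : BRST 𝔤 R L) : brstEuler b x =
    ∑ a, leftMul (theta (b.coord a)) (onFst (derivTheta (b a)) x) +
      ∑ a, leftMul (mu (b.coord a)) (onFst (derivMu b a) x) := by
  simp [brstEuler]

theorem leftMul_theta_theta (ξ η : Module.Dual ℝ 𝔤) (x : BRST 𝔤 R L) :
    leftMul (theta ξ) (leftMul (theta η) x) = - leftMul (theta η) (leftMul (theta ξ) x) := by
  rw [← leftMul_mul, theta_mul_theta, ← leftMul_mul, leftMul_neg]

theorem leftMul_mu_comm (ξ : Module.Dual ℝ 𝔤) (a : LieWeil 𝔤) (x : BRST 𝔤 R L) :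
    leftMul (mu ξ) (leftMul a x) = leftMul a (leftMul (mu ξ) x) := by
  rw [← leftMul_mul, mu_mul_comm, ← leftMul_mul]

theorem brstEuler_theta (ξ : Module.Dual ℝ 𝔤) (x : BRST 𝔤 R L) :
    brstEuler b (leftMul (theta ξ) x) = leftMul (theta ξ) (brstEuler b x) +
      leftMul (theta ξ) x := by
  simp only [brstEuler_apply, derivTheta_leftMul_theta, derivMu_leftMul_theta, map_sub, map_add,
    map_sum, map_smul, Finset.sum_sub_distrib, leftMul_mu_comm]
  conv_rhs => rw [theta_eq_sum b ξ, leftMul_sum (ι := ι) _ x, ← theta_eq_sum b ξ]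
  have h : ∑ a, leftMul (theta (b.coord a)) (leftMul (theta ξ) (onFst (derivTheta (b a)) x)) +
      ∑ a, leftMul (theta ξ) (leftMul (theta (b.coord a)) (onFst (derivTheta (b a)) x)) = 0 := by
    rw [← Finset.sum_add_distrib]
    refine Finset.sum_eq_zero fun a _ => ?_
    rw [leftMul_theta_theta]
    exact neg_add_cancel (G := BRST 𝔤 R L) _
  simp only [leftMul_smul]
  rw [eq_neg_of_add_eq_zero_left (G := BRST 𝔤 R L) h]
  abel

theorem brstEuler_mu (ξ : Module.Dual ℝ 𝔤) (x : BRST 𝔤 R L) :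
    brstEuler b (leftMul (mu ξ) x) = leftMul (mu ξ) (brstEuler b x) + leftMul (mu ξ) x := by
  simp only [brstEuler_apply, derivTheta_leftMul_mu, derivMu_leftMul_mu, map_add,
    map_sum, map_smul, Finset.sum_add_distrib, leftMul_mu_comm ξ]
  conv_rhs => rw [mu_eq_sum b ξ, leftMul_sum (ι := ι) _ x, ← mu_eq_sum b ξ]
  simp only [leftMul_smul]
  abel

theorem eq_one_tmul_of_derivs {x : BRST 𝔤 R L}
    (hI : ∀ a, onFst (derivTheta (b a)) x = 0) (hD : ∀ a, onFst (derivMu b a) x = 0) :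
    ∃ w, x = 1 ⊗ₜ w := by
  have hx : brstEuler b x = 0 := by simp [brstEuler_apply, hI, hD]
  have h := mem_of_euler (V := BRST 𝔤 R L) (E := brstEuler b)
    (Q := LinearMap.range (TensorProduct.mk ℝ (LieWeil 𝔤) (Forms R L) 1))
    (S := Set.range (fun ξ => leftMul (theta ξ)) ∪ Set.range (fun ξ => leftMul (mu ξ))) ?_ ?_ ?_ hx
  · obtain ⟨w, hw⟩ := h
    exact ⟨w, hw.symm⟩
  · rintro s (⟨ξ, rfl⟩ | ⟨ξ, rfl⟩) x
    · exact brstEuler_theta b ξ x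
    · exact brstEuler_mu b ξ x
  · rintro _ ⟨w, rfl⟩
    rw [TensorProduct.mk_apply, brstEuler_apply]
    simp only [onFst_tmul, derivTheta_one, derivMu_one, TensorProduct.zero_tmul, map_zero,
      Finset.sum_const_zero, add_zero]
  · intro P hP hS
    exact brst_eq_top (fun k φ => hP ⟨_, rfl⟩)
      (fun ξ x hx => hS _ (Or.inl ⟨ξ, rfl⟩) x hx) (fun ξ x hx => hS _ (Or.inr ⟨ξ, rfl⟩) x hx)

theorem exists_mem_nilOrder (x : BRST 𝔤 R L) :
    ∃ N, x ∈ nilOrder (V := BRST 𝔤 R L) (fun a => onFst (derivMu b a) : ι → BRST 𝔤 R L →ₗ[ℝ] BRST 𝔤 R L) N := by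
  let D : ι → BRST 𝔤 R L →ₗ[ℝ] BRST 𝔤 R L := fun a => onFst (derivMu b a)
  have hT : ∀ ξ N, ∀ x ∈ nilOrder (V := BRST 𝔤 R L) D N, leftMul (theta ξ) x ∈ nilOrder (V := BRST 𝔤 R L) D N := by
    intro ξ N
    induction N with
    | zero =>
      intro x hx
      rw [(Submodule.mem_bot ℝ).1 hx, map_zero]
      exact zero_mem _
    | succ N ih =>
      intro x hx
      refine mem_nilOrder_succ.2 fun a => ?_
      rw [show D a (leftMul (theta ξ) x) = leftMul (theta ξ) (D a x) from
        derivMu_leftMul_theta b a ξ x]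
      exact ih _ (mem_nilOrder_succ.1 hx a)
  have hM : ∀ ξ N, ∀ x ∈ nilOrder (V := BRST 𝔤 R L) D N, leftMul (mu ξ) x ∈ nilOrder (V := BRST 𝔤 R L) D (N + 1) := by
    intro ξ N
    induction N with
    | zero =>
      intro x hx
      rw [(Submodule.mem_bot ℝ).1 hx, map_zero]
      exact zero_mem _
    | succ N ih =>
      intro x hx
      refine mem_nilOrder_succ.2 fun a => ?_
      rw [show D a (leftMul (mu ξ) x) = ξ (b a) • x + leftMul (mu ξ) (D a x) from
        derivMu_leftMul_mu b a ξ x]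
      exact add_mem (Submodule.smul_mem _ _ hx) (ih _ (mem_nilOrder_succ.1 hx a))
  have h : (⨆ N, nilOrder (V := BRST 𝔤 R L) D N) = ⊤ := by
    have hmem := fun x => Submodule.mem_iSup_of_directed (x := x) (nilOrder (V := BRST 𝔤 R L) D)
      nilOrder_mono.directed_le
    refine brst_eq_top (fun k φ => (hmem _).2 ⟨1, mem_nilOrder_succ.2 fun a => ?_⟩)
      (fun ξ x hx => ?_) (fun ξ x hx => ?_)
    · change onFst (derivMu b a) (1 ⊗ₜ _) ∈ _
      rw [onFst_tmul, derivMu_one, TensorProduct.zero_tmul]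
      exact zero_mem _
    · obtain ⟨N, hN⟩ := (hmem x).1 hx
      exact (hmem _).2 ⟨N, hT ξ N x hN⟩
    · obtain ⟨N, hN⟩ := (hmem x).1 hx
      exact (hmem _).2 ⟨N + 1, hM ξ N x hN⟩
  exact (Submodule.mem_iSup_of_directed (nilOrder (V := BRST 𝔤 R L) D) nilOrder_mono.directed_le).1
    (h ▸ Submodule.mem_top : x ∈ ⨆ N, nilOrder (V := BRST 𝔤 R L) D N)

end BrstOps
end WeilBRST

namespace WeilBRST

namespace WeilRing

section Basic

variable {R L G : Type*} [CommRing R] [AddCommGroup L] [Module R L]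
  [AddCommGroup G] [Module R G]

theorem sum_apply {ι : Type*} (s : Finset ι) (f : ι → WeilRing R L G) (n v : ℕ)
    (e : Fin n → L × G) (β : Fin v → G) :
    (∑ i ∈ s, f i).comp n v e β = ∑ i ∈ s, (f i).comp n v e β :=
  map_sum (AddMonoidHom.mk' (fun c : WeilRing R L G => c.comp n v e β) fun _ _ => rfl) f s

variable {c : WeilRing R L G} {ι : Type*} {u : ι → G}

theorem ins_eq_zero_of_span (hc : c ∈ altSym R L G) (hu : Submodule.span R (Set.range u) = ⊤)
    (h : ∀ i, ins (0, u i) c = 0) (γ : G) : ins (0, γ) c = 0 := by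
  have hγ : γ ∈ Submodule.span R (Set.range u) := hu ▸ Submodule.mem_top
  induction hγ using Submodule.span_induction with
  | mem x hx => obtain ⟨i, rfl⟩ := hx; exact h i
  | zero => exact ins_zero hc
  | add x y _ _ hx hy =>
    rw [show ((0 : L), x + y) = (0, x) + (0, y) by simp, ins_add hc, hx, hy, add_zero]
  | smul r x _ hx => rw [show ((0 : L), r • x) = r • (0, x) by simp, ins_smul hc, hx, smul_zero]

theorem der_eq_zero_of_span (hc : c ∈ altSym R L G) (hu : Submodule.span R (Set.range u) = ⊤)
    (h : ∀ i, der (u i) c = 0) (γ : G) : der γ c = 0 := by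
  have hγ : γ ∈ Submodule.span R (Set.range u) := hu ▸ Submodule.mem_top
  induction hγ using Submodule.span_induction with
  | mem x hx => obtain ⟨i, rfl⟩ := hx; exact h i
  | zero => exact der_zero hc
  | add x y _ _ hx hy => rw [der_add hc, hx, hy, add_zero]
  | smul r x _ hx => rw [der_smul hc, hx, smul_zero]

theorem comp_eq_comp_fst (hc : c ∈ altSym R L G) (h : ∀ γ, ins (0, γ) c = 0) (n v : ℕ)
    (e : Fin n → L × G) (β : Fin v → G) :
    c.comp n v e β = c.comp n v (fun i => ((e i).1, 0)) β := by
  induction n generalizing c with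
  | zero => exact congrArg (fun e => c.comp 0 v e β) (Subsingleton.elim _ _)
  | succ n ih =>
    rw [apply_succ, apply_succ c]
    have h1 : ins (e 0) c = ins ((e 0).1, 0) c := by
      conv_lhs => rw [show e 0 = ((e 0).1, 0) + (0, (e 0).2) by simp]
      rw [ins_add hc, h, add_zero]
    rw [h1]
    exact ih (ins_mem_altSym hc ((e 0).1, 0))
      (fun γ => by rw [ins_ins_comm hc, h, map_zero, neg_zero]) (Fin.tail e)

theorem eq_sum_form [Algebra ℝ R] (hc : c ∈ weilSubmodule R L G) (hI : ∀ γ, ins (0, γ) c = 0)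
    (hD : ∀ γ, der γ c = 0) :
    ∃ (N : ℕ) (φ : ∀ n, L [⋀^Fin n]→ₗ[R] R), c = ∑ n ∈ Finset.range N, form G (φ n) := by
  obtain ⟨hc, N, hN⟩ := mem_weilSubmodule.1 hc
  choose F hF using hc.1
  refine ⟨N, fun n => (F n 0 Fin.elim0).compLinearMap (LinearMap.inl R L G), ?_⟩
  ext n v e β
  rw [sum_apply]
  obtain _ | v := v
  · rw [comp_eq_comp_fst hc hI, Subsingleton.elim β Fin.elim0, ← hF]
    have h : ∀ m, m ≠ n → (form G ((F m 0 Fin.elim0).compLinearMap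
        (LinearMap.inl R L G))).comp n 0 e Fin.elim0 = 0 := fun m hm =>
      form_comp_of_ne _ (fun h => hm h.1.symm) _ _
    by_cases hn : n < N
    · rw [Finset.sum_eq_single n (fun m _ hm => h m hm)
        (fun h => absurd (Finset.mem_range.2 hn) h), form_comp_self]
      rfl
    · rw [Finset.sum_eq_zero fun m hm => h m fun hmn => hn (hmn ▸ Finset.mem_range.1 hm), hF,
        hN _ _ (by omega)]
  · rw [apply_succ', hD, zero_apply]
    refine (Finset.sum_eq_zero fun m _ => form_comp_of_ne _ (fun h => ?_) _ _).symm
    exact Nat.succ_ne_zero _ h.2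

end Basic

end WeilRing

section Bijective

open WeilRing

variable {𝔤 : Type*} [LieRing 𝔤] [LieAlgebra ℝ 𝔤]
  {R L G : Type*} [CommRing R] [Algebra ℝ R] [LieRing L] [Module R L] [LieAlgebra ℝ L]
  [LieRingModule L R] [LieRinehartRing R L] [LieRinehartAlgebra ℝ R L]
  [AddCommGroup G] [Module R G]
  {p : Module.Dual ℝ 𝔤 →ₗ[ℝ] G →ₗ[R] R} {κ : 𝔤 → G}
  (hκ : ∀ ξ u, p ξ (κ u) = algebraMap ℝ R (ξ u))
  {ι : Type*} [Fintype ι] [DecidableEq ι] (b : Module.Basis ι ℝ 𝔤)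

include hκ

theorem ins_theta_mul (u : 𝔤) (ξ : Module.Dual ℝ 𝔤) (c : WeilRing R L G) :
    ins (0, κ u) (WeilRing.theta L (p ξ) * c) =
      ξ u • c - WeilRing.theta L (p ξ) * ins (0, κ u) c := by
  rw [ins_mul, ins_theta, hκ, par_theta, neg_mul, ← sub_eq_add_neg, algebraMap_smul,
    smul_mul_assoc, one_mul]

theorem der_mu_mul (u : 𝔤) (ξ : Module.Dual ℝ 𝔤) (c : WeilRing R L G) :
    der (κ u) (WeilRing.mu L (p ξ) * c) = ξ u • c + WeilRing.mu L (p ξ) * der (κ u) c := by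
  rw [der_mul, der_mu, hκ, algebraMap_smul, smul_mul_assoc, one_mul]

omit hκ in
theorem ins_mu_mul (e : L × G) (l : G →ₗ[R] R) (c : WeilRing R L G) :
    ins e (WeilRing.mu L l * c) = WeilRing.mu L l * ins e c := by
  have h : par (WeilRing.mu L l) = WeilRing.mu L l := by
    ext n v e β
    rw [par_apply, mu_comp]
    split_ifs with h
    · obtain ⟨rfl, rfl⟩ := h
      rw [pow_zero, one_mul]
    · rw [mul_zero]
  rw [ins_mul, ins_mu, zero_mul, zero_add, h]

omit hκ in
theorem der_theta_mul (β : G) (l : G →ₗ[R] R) (c : WeilRing R L G) :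
    der β (WeilRing.theta L l * c) = WeilRing.theta L l * der β c := by
  rw [der_mul, der_theta, zero_mul, zero_add]

omit hκ in
theorem ins_zero_form {k : ℕ} (γ : G) (φ : L [⋀^Fin k]→ₗ[R] R) :
    ins ((0 : L), γ) (form G φ) = 0 := by
  obtain _ | k := k
  · exact ins_form_zero _ _
  · rw [ins_form, map_zero, ← zero_smul R (0 : L [⋀^Fin k]→ₗ[R] R), form_smul, zero_smul]

omit hκ in
theorem brst_hom_ext {V : Type*} [AddCommGroup V] [Module ℝ V] {f g : BRST 𝔤 R L →ₗ[ℝ] V}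
    (hform : ∀ k (φ : Form R L k), f (1 ⊗ₜ DirectSum.lof ℝ ℕ (Form R L) k φ) =
      g (1 ⊗ₜ DirectSum.lof ℝ ℕ (Form R L) k φ))
    (hθ : ∀ ξ x, f x = g x → f (leftMul (theta ξ) x) = g (leftMul (theta ξ) x))
    (hμ : ∀ ξ x, f x = g x → f (leftMul (mu ξ) x) = g (leftMul (mu ξ) x)) : f = g := by
  have h : LinearMap.eqLocus f g = ⊤ := brst_eq_top hform hθ hμ
  exact LinearMap.ext fun x => (h ▸ Submodule.mem_top : x ∈ LinearMap.eqLocus f g)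

theorem brstMap_derivTheta (u : 𝔤) (x : BRST 𝔤 R L) :
    brstMap L p (onFst (derivTheta u) x) = ins (0, κ u) (brstMap L p x) := by
  let f := brstMap L p ∘ₗ onFst (derivTheta u)
  let g := (ins ((0 : L), κ u)).restrictScalars ℝ ∘ₗ brstMap L p
  refine congrArg (fun h => h x) (brst_hom_ext (f := f) (g := g) (fun k φ => ?_) (fun ξ x hx => ?_) (fun ξ x hx => ?_))
  · change brstMap L p (onFst (derivTheta u) (1 ⊗ₜ DirectSum.lof ℝ ℕ (Form R L) k φ)) =
      ins (0, κ u) (brstMap L p (1 ⊗ₜ DirectSum.lof ℝ ℕ (Form R L) k φ))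
    rw [onFst_tmul, derivTheta_one, TensorProduct.zero_tmul, map_zero, brstMap_one_tmul_lof,
        ins_zero_form]
  · change brstMap L p (onFst _ _) = ins _ (brstMap L p _)
    rw [derivTheta_leftMul_theta, map_sub, map_smul, brstMap_leftMul_theta,
        brstMap_leftMul_theta, ins_theta_mul hκ]
    exact congrArg (fun y => _ - _ * y) hx
  · change brstMap L p (onFst _ _) = ins _ (brstMap L p _)
    rw [derivTheta_leftMul_mu, brstMap_leftMul_mu, brstMap_leftMul_mu, ins_mu_mul]
    exact congrArg (fun y => _ * y) hx

theorem brstMap_derivMu (i : ι) (x : BRST 𝔤 R L) :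
    brstMap L p (onFst (derivMu b i) x) = der (κ (b i)) (brstMap L p x) := by
  let f := brstMap L p ∘ₗ onFst (derivMu b i)
  let g := (der (L := L) (κ (b i))).restrictScalars ℝ ∘ₗ brstMap L p
  refine congrArg (fun h => h x) (brst_hom_ext (f := f) (g := g) (fun k φ => ?_) (fun ξ x hx => ?_) (fun ξ x hx => ?_))
  · change brstMap L p (onFst (derivMu b i) (1 ⊗ₜ DirectSum.lof ℝ ℕ (Form R L) k φ)) =
      der (κ (b i)) (brstMap L p (1 ⊗ₜ DirectSum.lof ℝ ℕ (Form R L) k φ))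
    rw [onFst_tmul, derivMu_one, TensorProduct.zero_tmul, map_zero, brstMap_one_tmul_lof,
        der_form]
  · change brstMap L p (onFst _ _) = der _ (brstMap L p _)
    rw [derivMu_leftMul_theta, brstMap_leftMul_theta, brstMap_leftMul_theta, der_theta_mul]
    exact congrArg (fun y => _ * y) hx
  · change brstMap L p (onFst _ _) = der _ (brstMap L p _)
    rw [derivMu_leftMul_mu, map_add, map_smul, brstMap_leftMul_mu, brstMap_leftMul_mu,
        der_mu_mul hκ]
    exact congrArg (fun y => _ + _ * y) hx

omit hκ in
theorem formMap_comp (w : Forms R L) (k : ℕ) (v : Fin k → L) :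
    (formMap R L G w).comp k 0 (fun i => (v i, 0)) Fin.elim0 = w k v := by
  induction w using forms_induction with
  | hadd w η hw hη =>
    rw [map_add, WeilRing.add_apply, hw, hη]
    rfl
  | hlof n φ =>
    rw [formMap_lof]
    by_cases h : n = k
    · subst h
      rw [form_comp_self, DirectSum.lof_apply]
    · rw [form_comp_of_ne _ (fun h' => h h'.1.symm), DirectSum.lof_eq_of,
        DirectSum.of_eq_of_ne _ _ _ (Ne.symm h)]
      rfl

omit hκ in
theorem formMap_injective {w : Forms R L} (h : formMap R L G w = 0) : w = 0 := by
  refine DFinsupp.ext fun k => AlternatingMap.ext fun v => ?_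
  rw [← formMap_comp (G := G), h]
  rfl

theorem brstMap_injective (b : Module.Basis ι ℝ 𝔤) : Function.Injective (brstMap L p) := by
  suffices h : LinearMap.ker (brstMap L p) ≤ ⊥ by
    intro x y hxy
    have h1 : x - y ∈ LinearMap.ker (brstMap L p) := by
      rw [LinearMap.mem_ker, map_sub, hxy, sub_self]
    exact sub_eq_zero.1 (h h1)
  refine le_of_clifford_weyl (V := BRST 𝔤 R L) (ι := ι) (T := fun a => leftMul (theta (b.coord a)))
    (I := fun a => onFst (derivTheta (b a))) (M := fun a => leftMul (mu (b.coord a)))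
    (D := fun a => onFst (derivMu b a)) ?_ ?_ ?_ ?_ ?_ ?_ ?_ ?_ ?_ ?_ ?_ ?_ ?_ ?_
  · intro a x hx
    rw [LinearMap.mem_ker] at hx ⊢
    rw [brstMap_leftMul_theta, hx, mul_zero]
  · intro a x hx
    rw [LinearMap.mem_ker] at hx ⊢
    rw [brstMap_derivTheta hκ, hx, map_zero]
  · intro a x hx
    rw [LinearMap.mem_ker] at hx ⊢
    rw [brstMap_leftMul_mu, hx, mul_zero]
  · intro a x hx
    rw [LinearMap.mem_ker] at hx ⊢
    rw [brstMap_derivMu hκ, hx, map_zero]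
  · intro a c x _
    rw [derivTheta_leftMul_theta, Module.Basis.coord_apply, Module.Basis.repr_self,
      Finsupp.single_apply, ite_smul, one_smul, zero_smul]
  · exact fun a c x _ => onFst_derivTheta_comm _ _ _
  · intro a c x _
    rw [derivMu_leftMul_mu, Module.Basis.coord_apply, Module.Basis.repr_self,
      Finsupp.single_apply, ite_smul, one_smul, zero_smul]
  · exact fun a c x _ => onFst_derivMu_comm _ _ _ _
  · exact fun a c x _ => derivMu_leftMul_theta _ _ _ _
  · exact fun a c x _ => onFst_derivMu_derivTheta _ _ _ _
  · exact fun x _ => exists_mem_nilOrder b x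
  · intro a x hx
    rw [(Submodule.mem_bot ℝ).1 hx, map_zero]
    exact zero_mem _
  · intro a x hx
    rw [(Submodule.mem_bot ℝ).1 hx, map_zero]
    exact zero_mem _
  · intro x hx hI hD
    obtain ⟨w, rfl⟩ := eq_one_tmul_of_derivs b hI hD
    rw [LinearMap.mem_ker, brstMap_tmul, map_one, one_mul] at hx
    rw [formMap_injective hx, TensorProduct.tmul_zero]
    exact zero_mem _

theorem weilSubmodule_le_range (b : Module.Basis ι ℝ 𝔤)
    (hspan : Submodule.span R (Set.range fun i => κ (b i)) = ⊤) :
    weilSubmodule R L G ≤ LinearMap.range (brstMap L p) := by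
  have hI : ∀ a (c : WeilRing R L G), (ins ((0 : L), κ (b a))).restrictScalars ℝ c =
    ins (0, κ (b a)) c := fun _ _ => rfl
  have hD : ∀ a (c : WeilRing R L G), (der (L := L) (κ (b a))).restrictScalars ℝ c =
    der (κ (b a)) c := fun _ _ => rfl
  refine le_of_clifford_weyl
    (T := fun a => LinearMap.mulLeft ℝ (WeilRing.theta L (p (b.coord a))))
    (I := fun a => (ins ((0 : L), κ (b a))).restrictScalars ℝ)
    (M := fun a => LinearMap.mulLeft ℝ (WeilRing.mu L (p (b.coord a))))
    (D := fun a => (der (κ (b a))).restrictScalars ℝ) ?_ ?_ ?_ ?_ ?_ ?_ ?_ ?_ ?_ ?_ ?_ ?_ ?_ ?_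
  · exact fun a x hx => mul_mem_weilSubmodule (theta_mem_weilSubmodule _) hx
  · exact fun a x hx => ins_mem_weilSubmodule hx _
  · exact fun a x hx => mul_mem_weilSubmodule (mu_mem_weilSubmodule _) hx
  · exact fun a x hx => der_mem_weilSubmodule hx _
  · intro a c x _
    simp only [hI, LinearMap.mulLeft_apply]
    rw [ins_theta_mul hκ, Module.Basis.coord_apply, Module.Basis.repr_self,
      Finsupp.single_apply, ite_smul, one_smul, zero_smul]
  · exact fun a c x hx => ins_ins_comm (mem_weilSubmodule.1 hx).1 _ _
  · intro a c x _
    simp only [hD, LinearMap.mulLeft_apply]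
    rw [der_mu_mul hκ, Module.Basis.coord_apply, Module.Basis.repr_self,
      Finsupp.single_apply, ite_smul, one_smul, zero_smul]
  · exact fun a c x hx => der_der_comm (mem_weilSubmodule.1 hx).1 _ _
  · exact fun a c x _ => der_theta_mul _ _ _
  · exact fun a c x _ => (ins_der _ _ _).symm
  · intro x hx
    obtain ⟨-, N, hN⟩ := mem_weilSubmodule.1 hx
    have key : ∀ N (c : WeilRing R L G), (∀ n v, N ≤ n + v → ∀ e β, c.comp n v e β = 0) →
        c ∈ nilOrder (fun a => (der (L := L) (κ (b a))).restrictScalars ℝ) N := by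
      intro N
      induction N with
      | zero =>
        intro c hc
        refine (Submodule.mem_bot ℝ).2 ?_
        ext n v e β
        exact hc n v (Nat.zero_le _) e β
      | succ N ih =>
        exact fun c hc => mem_nilOrder_succ.2 fun a => ih _ fun n v h e β =>
          hc _ _ (by omega) _ _
    exact ⟨N, key N x hN⟩
  · rintro a _ ⟨y, rfl⟩
    exact ⟨_, brstMap_leftMul_theta p _ y⟩
  · rintro a _ ⟨y, rfl⟩
    exact ⟨_, brstMap_leftMul_mu p _ y⟩
  · intro c hc hIc hDc
    have hc' := (mem_weilSubmodule.1 hc).1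
    obtain ⟨N, φ, h⟩ := eq_sum_form hc (ins_eq_zero_of_span hc' hspan hIc)
      (der_eq_zero_of_span hc' hspan hDc)
    refine ⟨1 ⊗ₜ ∑ n ∈ Finset.range N, DirectSum.lof ℝ ℕ (Form R L) n (φ n), ?_⟩
    rw [h, brstMap_tmul, map_one, one_mul, map_sum]
    exact Finset.sum_congr rfl fun n _ => formMap_lof n (φ n)

end Bijective

end WeilBRST

namespace WeilBRST

namespace WeilRing

section Tridegree

variable {R L G : Type*} [CommRing R] [Algebra ℝ R] [AddCommGroup L] [Module R L]
  [AddCommGroup G] [Module R G]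

/-- The pairs `(Xᵢ, αᵢ)`, rescaled to `(s Xᵢ, t αᵢ)`. -/
def rescale (s t : R) {n : ℕ} (e : Fin n → L × G) : Fin n → L × G :=
  fun i => (s • (e i).1, t • (e i).2)

variable (R L G) in
/-- The cochains with values in `Λᵘ L* ⊗ Sᵛ G* ⊗ Λʷ G*`. -/
def tridegree (u v w : ℕ) : Submodule ℝ (WeilRing R L G) where
  carrier := {c | ∀ n m (e : Fin n → L × G) (β : Fin m → G),
    (∀ s t : R, c.comp n m (rescale s t e) β = s ^ u * t ^ w * c.comp n m e β) ∧
      (¬ (n = u + w ∧ m = v) → c.comp n m e β = 0)}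
  add_mem' := fun ha hb n m e β => by
    refine ⟨fun s t => ?_, fun h => ?_⟩
    · rw [WeilRing.add_apply, (ha n m e β).1, (hb n m e β).1, WeilRing.add_apply, mul_add]
    · rw [WeilRing.add_apply, (ha n m e β).2 h, (hb n m e β).2 h, add_zero]
  zero_mem' := fun n m e β => ⟨fun s t => (mul_zero _).symm, fun _ => rfl⟩
  smul_mem' := fun r c hc n m e β => by
    refine ⟨fun s t => ?_, fun h => ?_⟩
    · rw [WeilRing.smul_apply, (hc n m e β).1, WeilRing.smul_apply, mul_smul_comm]
    · rw [WeilRing.smul_apply, (hc n m e β).2 h, smul_zero]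

theorem mul_mem_tridegree {u v w u' v' w' : ℕ} {a b : WeilRing R L G}
    (ha : a ∈ tridegree R L G u v w) (hb : b ∈ tridegree R L G u' v' w') :
    a * b ∈ tridegree R L G (u + u') (v + v') (w + w') := by
  refine fun n m e β => ⟨fun s t => ?_, fun h => ?_⟩
  · rw [mul_apply, mul_apply, Finset.mul_sum]
    refine Finset.sum_congr rfl fun S _ => ?_
    rw [Finset.mul_sum]
    refine Finset.sum_congr rfl fun T _ => ?_
    rw [mul_smul_comm]
    have h1 := (ha S.card T.card (e ∘ S.orderEmbOfFin rfl) (β ∘ T.orderEmbOfFin rfl)).1 s t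
    have h2 := (hb Sᶜ.card Tᶜ.card (e ∘ Sᶜ.orderEmbOfFin rfl) (β ∘ Tᶜ.orderEmbOfFin rfl)).1 s t
    refine congrArg _ ((congrArg₂ (· * ·) h1 h2).trans ?_)
    ring
  · rw [mul_apply]
    refine Finset.sum_eq_zero fun S _ => Finset.sum_eq_zero fun T _ => ?_
    have h1 := Finset.card_add_card_compl S
    have h2 := Finset.card_add_card_compl T
    rw [Fintype.card_fin] at h1 h2
    by_cases h3 : S.card = u + w ∧ T.card = v
    · rw [(hb _ _ _ _).2 (by omega), mul_zero, smul_zero]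
    · rw [(ha _ _ _ _).2 h3, zero_mul, smul_zero]

theorem one_mem_tridegree : (1 : WeilRing R L G) ∈ tridegree R L G 0 0 0 := by
  refine fun n m e β => ⟨fun s t => ?_, fun h => ?_⟩
  · rw [one_apply, one_apply, pow_zero, pow_zero, one_mul, one_mul]
  · rw [one_apply, if_neg h]

theorem theta_mem_tridegree (l : G →ₗ[R] R) : theta L l ∈ tridegree R L G 0 0 1 := by
  refine fun n m e β => ⟨fun s t => ?_, fun h => ?_⟩
  · rw [theta_comp, theta_comp]
    split_ifs with h
    · simp only [rescale, map_smul, smul_eq_mul, pow_zero, one_mul, pow_one]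
    · rw [mul_zero]
  · rw [theta_comp, dif_neg h]

theorem mu_mem_tridegree (l : G →ₗ[R] R) : mu L l ∈ tridegree R L G 0 1 0 := by
  refine fun n m e β => ⟨fun s t => ?_, fun h => ?_⟩
  · rw [mu_comp, mu_comp, pow_zero, pow_zero, one_mul, one_mul]
  · rw [mu_comp, dif_neg h]

theorem form_mem_tridegree {k : ℕ} (φ : L [⋀^Fin k]→ₗ[R] R) :
    form G φ ∈ tridegree R L G k 0 0 := by
  refine fun n m e β => ⟨fun s t => ?_, fun h => ?_⟩
  · rw [form_comp, form_comp]
    split_ifs with h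
    · have h1 := φ.map_smul_univ (fun _ => s) fun i => (e (Fin.cast h.1.symm i)).1
      simp only [Finset.prod_const, Finset.card_univ, Fintype.card_fin, smul_eq_mul] at h1
      rw [pow_zero, mul_one]
      exact h1
    · rw [mul_zero]
  · rw [form_comp, dif_neg (by rwa [add_zero] at h)]

variable (R L G) in
/-- The cochains of bidegree `(p, q)`. -/
def bidegree (p q : ℕ) : Submodule ℝ (WeilRing R L G) where
  carrier := {c | HasWeilBidegree p q c}
  add_mem' := fun {a b} ha hb n v => by
    refine ⟨fun h s t e β => ?_, fun h => ?_⟩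
    · refine (congrArg₂ (· + ·) ((ha n v).1 h s t e β) ((hb n v).1 h s t e β)).trans ?_
      exact (mul_add _ _ _).symm
    · change a n v + b n v = 0
      rw [(ha n v).2 h, (hb n v).2 h, add_zero]
  zero_mem' := fun n v => ⟨fun _ _ _ _ _ => (mul_zero _).symm, fun _ => rfl⟩
  smul_mem' := fun r c hc n v => by
    refine ⟨fun h s t e β => ?_, fun h => ?_⟩
    · refine (congrArg (r • ·) ((hc n v).1 h s t e β)).trans ?_
      exact (mul_smul_comm _ _ _).symm
    · change r • c n v = 0
      rw [(hc n v).2 h, smul_zero]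

theorem tridegree_le_bidegree (u v w : ℕ) :
    tridegree R L G u v w ≤ bidegree R L G (v + w) (u + v) := by
  refine fun c hc n m => ⟨fun h s t e β => ?_, fun h => ?_⟩
  · by_cases hm : n = u + w ∧ m = v
    · refine ((hc n m e β).1 s t).trans ?_
      obtain ⟨rfl, rfl⟩ := hm
      rw [Nat.add_sub_cancel, Nat.add_sub_cancel_left]
      rfl
    · refine ((hc n m _ β).2 hm).trans ?_
      rw [show c n m e β = 0 from (hc n m e β).2 hm, mul_zero]
  · refine funext fun e => funext fun β => (hc n m e β).2 fun h' => h ?_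
    omega

/-- The operator that multiplies the cochains of bidegree `(p, q)` with `2 ^ q * 3 ^ p`. -/
def bigrading : Module.End ℝ (WeilRing R L G) where
  toFun c := fun n v e β => (6 : R) ^ v * c.comp n v (rescale (2 : R) (3 : R) e) β
  map_add' a b := by
    funext n v e β
    exact mul_add _ _ _
  map_smul' r c := by
    funext n v e β
    exact mul_smul_comm _ _ _

theorem bidegree_le_eigenspace (p q : ℕ) :
    bidegree R L G p q ≤ Module.End.eigenspace bigrading ((2 : ℝ) ^ q * 3 ^ p) := by
  refine fun c hc => Module.End.mem_eigenspace_iff.2 ?_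
  ext n v e β
  rw [smul_apply]
  change (6 : R) ^ v * c.comp n v (rescale (2 : R) (3 : R) e) β = _
  by_cases h : v ≤ p ∧ v ≤ q ∧ n + 2 * v = p + q
  · rw [show c.comp n v (rescale (2 : R) (3 : R) e) β = _ from (hc n v).1 h 2 3 e β, Algebra.smul_def]
    obtain ⟨p, rfl⟩ := Nat.exists_eq_add_of_le h.1
    obtain ⟨q, rfl⟩ := Nat.exists_eq_add_of_le h.2.1
    simp only [Nat.add_sub_cancel_left, map_mul, map_pow, map_ofNat, pow_add]
    rw [show (6 : R) = 2 * 3 by norm_num, mul_pow]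
    change _ = _ * c n v e β
    ring
  · have h0 : ∀ e β, c.comp n v e β = 0 := fun e β => congrFun (congrFun ((hc n v).2 h) e) β
    rw [h0, h0, mul_zero, smul_zero]

end Tridegree

theorem two_pow_mul_three_pow_injective :
    Function.Injective fun i : ℕ × ℕ => (2 : ℝ) ^ i.2 * 3 ^ i.1 := by
  rintro ⟨p, q⟩ ⟨p', q'⟩ h
  have h1 : 2 ^ q * 3 ^ p = 2 ^ q' * 3 ^ p' := by
    simp only at h
    exact_mod_cast h
  have h2 : ∀ p q l : ℕ, (2 ^ q * 3 ^ p).factorization l =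
      q * Nat.factorization 2 l + p * Nat.factorization 3 l := by
    intro p q l
    rw [Nat.factorization_mul (by positivity) (by positivity), Nat.factorization_pow,
      Nat.factorization_pow]
    rfl
  have h3 := h2 p q 2
  have h4 := h2 p q 3
  rw [h1, h2] at h3 h4
  simp [Nat.prime_two.factorization, Nat.prime_three.factorization] at h3 h4
  rw [h3, h4]

end WeilRing

section BrstBidegree

open WeilRing

variable {𝔤 : Type*} [LieRing 𝔤] [LieAlgebra ℝ 𝔤]
  {R L G : Type*} [CommRing R] [Algebra ℝ R] [LieRing L] [Module R L] [LieAlgebra ℝ L]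
  [LieRingModule L R] [LieRinehartRing R L] [LieRinehartAlgebra ℝ R L]
  [AddCommGroup G] [Module R G]

theorem extMap_mem_tridegree (p : Module.Dual ℝ 𝔤 →ₗ[ℝ] G →ₗ[R] R) {w : ℕ}
    {x : ExteriorAlgebra ℝ (Module.Dual ℝ 𝔤)}
    (hx : x ∈ LinearMap.range (ExteriorAlgebra.ι ℝ (M := Module.Dual ℝ 𝔤)) ^ w) :
    extMap L p x ∈ tridegree R L G 0 0 w := by
  induction w generalizing x with
  | zero =>
    rw [pow_zero] at hx
    obtain ⟨r, rfl⟩ := Submodule.mem_one.1 hx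
    rw [AlgHom.commutes, Algebra.algebraMap_eq_smul_one]
    exact Submodule.smul_mem _ _ one_mem_tridegree
  | succ w ih =>
    rw [pow_succ] at hx
    induction hx using Submodule.mul_induction_on' with
    | mem_mul_mem y hy z hz =>
      obtain ⟨ξ, rfl⟩ := hz
      rw [map_mul, extMap_ι]
      exact mul_mem_tridegree (ih hy) (theta_mem_tridegree _)
    | add y _ z _ hy hz => rw [map_add]; exact add_mem hy hz

theorem symMap_mem_tridegree (p : Module.Dual ℝ 𝔤 →ₗ[ℝ] G →ₗ[R] R) {v : ℕ}
    {x : SymmetricAlgebra ℝ (Module.Dual ℝ 𝔤)}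
    (hx : x ∈ LinearMap.range (SymmetricAlgebra.ι ℝ (Module.Dual ℝ 𝔤)) ^ v) :
    symMap L p x ∈ tridegree R L G 0 v 0 := by
  induction v generalizing x with
  | zero =>
    rw [pow_zero] at hx
    obtain ⟨r, rfl⟩ := Submodule.mem_one.1 hx
    rw [AlgHom.commutes, Algebra.algebraMap_eq_smul_one]
    exact Submodule.smul_mem _ _ one_mem_tridegree
  | succ w ih =>
    rw [pow_succ] at hx
    induction hx using Submodule.mul_induction_on' with
    | mem_mul_mem y hy z hz =>
      obtain ⟨ξ, rfl⟩ := hz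
      rw [map_mul, symMap_ι]
      exact mul_mem_tridegree (ih hy) (mu_mem_tridegree _)
    | add y _ z _ hy hz => rw [map_add]; exact add_mem hy hz

theorem brstMap_mem_bidegree (P : Module.Dual ℝ 𝔤 →ₗ[ℝ] G →ₗ[R] R) {p q : ℕ} {x : BRST 𝔤 R L}
    (hx : x ∈ brstBidegree p q) : brstMap L P x ∈ bidegree R L G p q := by
  have h : brstBidegree p q ≤ (bidegree R L G p q).comap (brstMap L P) := by
    refine Submodule.span_le.2 ?_
    rintro _ ⟨u, v, w, rfl, rfl, x, hx, y, hy, φ, rfl⟩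
    refine tridegree_le_bidegree u v w ?_
    rw [brstMap_tmul, lieWeilMap_tmul, formMap_lof]
    have := mul_mem_tridegree (mul_mem_tridegree (extMap_mem_tridegree (L := L) P hx)
      (symMap_mem_tridegree P hy)) (form_mem_tridegree φ)
    simpa only [zero_add, add_zero] using this
  exact h hx

theorem iSup_brstBidegree :
    (⨆ i : ℕ × ℕ, brstBidegree (𝔤 := 𝔤) (R := R) (L := L) i.1 i.2) = ⊤ := by
  have hle : ∀ p q, brstBidegree (𝔤 := 𝔤) (R := R) (L := L) p q ≤
      ⨆ i : ℕ × ℕ, brstBidegree i.1 i.2 := fun p q =>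
    le_iSup (fun i : ℕ × ℕ => brstBidegree (𝔤 := 𝔤) (R := R) (L := L) i.1 i.2) (p, q)
  refine brst_eq_top (fun k φ => ?_) (fun ξ => ?_) (fun ξ => ?_)
  · exact hle 0 k (Submodule.subset_span ⟨k, 0, 0, rfl, rfl, 1, Submodule.one_le.1 le_rfl, 1,
      Submodule.one_le.1 le_rfl, φ, rfl⟩)
  · change (⨆ i : ℕ × ℕ, brstBidegree i.1 i.2) ≤
      (⨆ i : ℕ × ℕ, brstBidegree i.1 i.2).comap (leftMul (theta ξ))
    refine iSup_le fun i => Submodule.span_le.2 ?_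
    rintro _ ⟨u, v, w, _, _, x, hx, y, hy, φ, rfl⟩
    refine hle (v + (w + 1)) (u + v) (Submodule.subset_span ⟨u, v, w + 1, rfl, rfl,
      ExteriorAlgebra.ι ℝ ξ * x, ?_, y, hy, φ, ?_⟩)
    · rw [pow_succ']
      exact Submodule.mul_mem_mul ⟨ξ, rfl⟩ hx
    · rw [leftMul_tmul, theta_mul_tmul]
  · change (⨆ i : ℕ × ℕ, brstBidegree i.1 i.2) ≤
      (⨆ i : ℕ × ℕ, brstBidegree i.1 i.2).comap (leftMul (mu ξ))
    refine iSup_le fun i => Submodule.span_le.2 ?_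
    rintro _ ⟨u, v, w, _, _, x, hx, y, hy, φ, rfl⟩
    refine hle ((v + 1) + w) (u + (v + 1)) (Submodule.subset_span ⟨u, v + 1, w, rfl, rfl,
      x, hx, SymmetricAlgebra.ι ℝ _ ξ * y, ?_, φ, ?_⟩)
    · rw [pow_succ']
      exact Submodule.mul_mem_mul ⟨ξ, rfl⟩ hy
    · rw [leftMul_tmul, mu_mul_tmul]

theorem mem_brstBidegree_iff {P : Module.Dual ℝ 𝔤 →ₗ[ℝ] G →ₗ[R] R}
    (hP : Function.Injective (brstMap L P)) {p q : ℕ} {x : BRST 𝔤 R L} :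
    x ∈ brstBidegree p q ↔ brstMap L P x ∈ bidegree R L G p q := by
  refine ⟨brstMap_mem_bidegree P, fun hx => ?_⟩
  have hle : ∀ i : ℕ × ℕ, (brstBidegree i.1 i.2).map (brstMap L P) ≤
      Module.End.eigenspace bigrading ((2 : ℝ) ^ i.2 * 3 ^ i.1) := by
    rintro i _ ⟨y, hy, rfl⟩
    exact bidegree_le_eigenspace _ _ (brstMap_mem_bidegree P hy)
  have hind := ((Module.End.eigenspaces_iSupIndep (bigrading (R := R) (L := L) (G := G))).comp
    two_pow_mul_three_pow_injective) (p, q)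
  have htop : x ∈ ⨆ i : ℕ × ℕ, brstBidegree (𝔤 := 𝔤) (R := R) (L := L) i.1 i.2 :=
    iSup_brstBidegree (𝔤 := 𝔤) (R := R) (L := L) ▸ Submodule.mem_top
  rw [iSup_split_single _ (p, q)] at htop
  obtain ⟨y, hy, z, hz, rfl⟩ := Submodule.mem_sup.1 htop
  have hz' : brstMap L P z ∈ ⨆ i : ℕ × ℕ, ⨆ _ : i ≠ (p, q),
      Module.End.eigenspace bigrading ((2 : ℝ) ^ i.2 * 3 ^ i.1) := by
    have h := Submodule.mem_map_of_mem (f := brstMap L P) hz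
    simp only [Submodule.map_iSup] at h
    exact iSup₂_mono (fun i _ => hle i) h
  have hy' := brstMap_mem_bidegree P hy
  have hz2 : brstMap L P z ∈ bidegree R L G p q := by
    have h := sub_mem hx hy'
    rwa [map_add, add_sub_cancel_left] at h
  have h0 := Submodule.disjoint_def.1 hind _ (bidegree_le_eigenspace p q hz2) hz'
  rw [hP (h0.trans (map_zero _).symm), add_zero]
  exact hy

end BrstBidegree

end WeilBRST

namespace WeilBRST

theorem removeNth_succ_vecCons {X : Type*} {n : ℕ} (x : X) (e : Fin (n + 1) → X)
    (i : Fin (n + 1)) :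
    (i.succ : Fin (n + 2)).removeNth (Matrix.vecCons x e) = Matrix.vecCons x (i.removeNth e) := by
  funext j
  refine Fin.cases ?_ (fun j => ?_) j <;> simp [Fin.removeNth]

theorem removeNth_zero_vecCons {X : Type*} {n : ℕ} (x : X) (e : Fin n → X) :
    (0 : Fin (n + 1)).removeNth (Matrix.vecCons x e) = e := by
  funext j
  simp [Fin.removeNth]

theorem update_succ_vecCons {X : Type*} {n : ℕ} (x y : X) (e : Fin n → X) (i : Fin n) :
    Function.update (Matrix.vecCons x e) i.succ y = Matrix.vecCons x (Function.update e i y) :=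
  (Fin.cons_update (α := fun _ => X) x e i y).symm

theorem update_zero_vecCons {X : Type*} {n : ℕ} (x y : X) (e : Fin n → X) :
    Function.update (Matrix.vecCons x e) 0 y = Matrix.vecCons y e :=
  Fin.update_cons_zero (α := fun _ => X) x e y

namespace WeilRing

variable {R L G : Type*} [CommRing R] [Algebra ℝ R] [AddCommGroup L] [Module R L]
  [AddCommGroup G] [Module R G]

section Insert

variable (j : G → L × G)

/-- `insertTerm`, as an operator on the ring of cochains. -/
def insTerm : WeilRing R L G →ₗ[ℝ] WeilRing R L G where
  toFun := insertTerm j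
  map_add' a b := by
    funext n v e β
    obtain _ | v := v
    · exact (add_zero (0 : R)).symm
    · exact Finset.sum_add_distrib
  map_smul' r a := by
    funext n v e β
    obtain _ | v := v
    · exact (smul_zero r).symm
    · exact (Finset.smul_sum (r := r) (f := fun k => a (n + 1) v (Matrix.vecCons (j (β k)) e)
        (k.removeNth β)) (s := Finset.univ)).symm

variable {j}

theorem insTerm_zero (c : WeilRing R L G) (n : ℕ) (e : Fin n → L × G) (β : Fin 0 → G) :
    (insTerm j c).comp n 0 e β = 0 := rfl

theorem insTerm_succ (c : WeilRing R L G) (n v : ℕ) (e : Fin n → L × G) (β : Fin (v + 1) → G) :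
    (insTerm j c).comp n (v + 1) e β =
      ∑ k, (ins (j (β k)) c).comp n v e (k.removeNth β) := rfl

theorem der_insTerm (c : WeilRing R L G) (β : G) :
    der β (insTerm j c) = ins (j β) c + insTerm j (der β c) := by
  ext n v e βs
  rw [der_apply, insTerm_succ, Fin.sum_univ_succ, WeilRing.add_apply, removeNth_zero_vecCons]
  congr 1
  obtain _ | v := v
  · simp [insTerm_zero]
  · rw [insTerm_succ]
    refine Finset.sum_congr rfl fun k _ => ?_
    rw [removeNth_succ_vecCons]
    rfl

theorem ins_insTerm {c : WeilRing R L G} (hc : c ∈ altSym R L G) (e : L × G) :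
    ins e (insTerm j c) = - insTerm j (ins e c) := by
  ext n v es βs
  rw [ins_apply, WeilRing.neg_apply]
  obtain _ | v := v
  · rw [insTerm_zero, insTerm_zero, neg_zero]
  · rw [insTerm_succ, insTerm_succ, ← Finset.sum_neg_distrib]
    refine Finset.sum_congr rfl fun k _ => ?_
    rw [← ins_apply, ins_ins_comm hc, WeilRing.neg_apply]

theorem par_insTerm (c : WeilRing R L G) : par (insTerm j c) = - insTerm j (par c) := by
  ext n v es βs
  rw [par_apply, WeilRing.neg_apply]
  obtain _ | v := v
  · rw [insTerm_zero, insTerm_zero, neg_zero, mul_zero]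
  · rw [insTerm_succ, insTerm_succ, Finset.mul_sum, ← Finset.sum_neg_distrib]
    refine Finset.sum_congr rfl fun k _ => ?_
    rw [ins_par, WeilRing.neg_apply, par_apply, neg_neg]

theorem insTerm_mul {a b : WeilRing R L G} (ha : a ∈ altSym R L G) (hb : b ∈ altSym R L G) :
    insTerm j (a * b) = insTerm j a * b + par a * insTerm j b := by
  let Δ : WeilRing R L G → WeilRing R L G → WeilRing R L G := fun a b =>
    insTerm j (a * b) - (insTerm j a * b + par a * insTerm j b)
  let S : AddSubgroup (WeilRing R L G) :=
    AddSubgroup.closure {c | ∃ a ∈ altSym R L G, ∃ b ∈ altSym R L G, c = Δ a b}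
  have hΔ : ∀ a ∈ altSym R L G, ∀ b ∈ altSym R L G, Δ a b ∈ S := fun a ha b hb =>
    AddSubgroup.subset_closure ⟨a, ha, b, hb, rfl⟩
  refine sub_eq_zero.1 (ext_zero (S := S) ?_ ?_ ?_ (hΔ a ha b hb))
  · intro c hc e β
    induction hc using AddSubgroup.closure_induction with
    | zero => rfl
    | add x y _ _ hx hy => rw [WeilRing.add_apply, hx, hy, add_zero]
    | neg x _ hx => rw [WeilRing.neg_apply, hx, neg_zero]
    | mem x hx =>
      obtain ⟨a, ha, b, hb, rfl⟩ := hx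
      rw [WeilRing.sub_apply, WeilRing.add_apply, mul_apply_zero, mul_apply_zero, insTerm_zero,
        insTerm_zero, insTerm_zero, zero_mul, mul_zero, add_zero, sub_zero]
  · intro c hc e
    induction hc using AddSubgroup.closure_induction with
    | zero => rw [map_zero]; exact zero_mem _
    | add x y _ _ hx hy => rw [map_add]; exact add_mem hx hy
    | neg x _ hx => rw [map_neg]; exact neg_mem hx
    | mem x hx =>
      obtain ⟨a, ha, b, hb, rfl⟩ := hx
      have h : ins e (Δ a b) = - Δ (ins e a) b - Δ (par a) (ins e b) := by
        simp only [Δ, map_sub, map_add, ins_mul, ins_insTerm (mul_mem_altSym ha hb),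
          ins_insTerm ha, ins_insTerm hb, ins_par, par_insTerm, par_par]
        noncomm_ring
      rw [h]
      exact sub_mem (neg_mem (hΔ _ (ins_mem_altSym ha e) _ hb))
        (hΔ _ (par_mem_altSym ha) _ (ins_mem_altSym hb e))
  · intro c hc β
    induction hc using AddSubgroup.closure_induction with
    | zero => rw [map_zero]; exact zero_mem _
    | add x y _ _ hx hy => rw [map_add]; exact add_mem hx hy
    | neg x _ hx => rw [map_neg]; exact neg_mem hx
    | mem x hx =>
      obtain ⟨a, ha, b, hb, rfl⟩ := hx
      have h : der β (Δ a b) = Δ (der β a) b + Δ a (der β b) := by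
        simp only [Δ, map_sub, map_add, ins_mul, der_mul, der_insTerm, der_par]
        noncomm_ring
      rw [h]
      exact add_mem (hΔ _ (der_mem_altSym ha β) _ hb) (hΔ _ ha _ (der_mem_altSym hb β))

end Insert

section Koszul

variable (act : L × G → Derivation ℝ R R) (cov : L × G → G → G) (br : L × G → L × G → L × G)

/-- `koszulTerm`, as an operator on the ring of cochains. -/
def kos : WeilRing R L G →ₗ[ℝ] WeilRing R L G where
  toFun := koszulTerm (fun e f => act e f) cov br
  map_add' a b := by
    funext n v e β
    obtain _ | n := n
    · exact (add_zero (0 : R)).symm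
    · change koszulTerm _ _ _ (a + b) (n + 1) v e β = koszulTerm _ _ _ a (n + 1) v e β +
        koszulTerm _ _ _ b (n + 1) v e β
      have h : ∀ n v e β, (a + b) n v e β = a n v e β + b n v e β := fun _ _ _ _ => rfl
      simp only [koszulTerm, h, map_add, Finset.sum_add_distrib, mul_add, mul_sub,
        Finset.sum_sub_distrib]
      ring
  map_smul' r a := by
    funext n v e β
    obtain _ | n := n
    · exact (smul_zero r).symm
    · change koszulTerm _ _ _ (r • a) (n + 1) v e β = r • koszulTerm _ _ _ a (n + 1) v e β
      have h : ∀ n v e β, (r • a) n v e β = r • a n v e β := fun _ _ _ _ => rfl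
      simp only [koszulTerm, h, Derivation.map_smul, smul_add, smul_sub, Finset.smul_sum, Finset.mul_sum,
        mul_smul_comm, mul_sub]

/-- The Lie derivative that belongs to the operator `kos`. -/
def lieOp (e : L × G) : WeilRing R L G →ₗ[ℝ] WeilRing R L G where
  toFun c := fun n v es β => act e (c.comp n v es β) -
    ∑ k, c.comp n v es (Function.update β k (cov e (β k))) -
      ∑ k, c.comp n v (Function.update es k (br e (es k))) β
  map_add' a b := by
    funext n v es β
    change _ = (act e (a.comp n v es β) - _ - _) + (act e (b.comp n v es β) - _ - _)
    simp only [WeilRing.add_apply, map_add, Finset.sum_add_distrib]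
    ring
  map_smul' r a := by
    funext n v es β
    change _ = r • (act e (a.comp n v es β) - _ - _)
    simp only [WeilRing.smul_apply, Derivation.map_smul, smul_sub, Finset.smul_sum]

variable {act cov br}

theorem lieOp_apply (e : L × G) (c : WeilRing R L G) (n v : ℕ) (es : Fin n → L × G)
    (β : Fin v → G) : (lieOp act cov br e c).comp n v es β = act e (c.comp n v es β) -
    ∑ k, c.comp n v es (Function.update β k (cov e (β k))) -
      ∑ k, c.comp n v (Function.update es k (br e (es k))) β := rfl

theorem kos_zero (c : WeilRing R L G) (v : ℕ) (e : Fin 0 → L × G) (β : Fin v → G) :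
    (kos act cov br c).comp 0 v e β = 0 := rfl

theorem kos_succ (c : WeilRing R L G) (n v : ℕ) (e : Fin (n + 1) → L × G) (β : Fin v → G) :
    (kos act cov br c).comp (n + 1) v e β =
      ∑ i : Fin (n + 1), (-1) ^ (i : ℕ) * (act (e i) (c.comp n v (i.removeNth e) β) -
          ∑ k : Fin v, c.comp n v (i.removeNth e) (Function.update β k (cov (e i) (β k)))) +
        ∑ i : Fin n, ∑ j ∈ Finset.Ici i, (-1) ^ ((j : ℕ) + 1) *
          c.comp n v (j.succ.removeNth (Function.update e i.castSucc
            (br (e i.castSucc) (e j.succ)))) β := rfl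

theorem ins_lieOp (e f : L × G) (c : WeilRing R L G) :
    ins f (lieOp act cov br e c) = lieOp act cov br e (ins f c) - ins (br e f) c := by
  ext n v es β
  rw [ins_apply, lieOp_apply, Fin.sum_univ_succ, WeilRing.sub_apply, lieOp_apply]
  simp only [Matrix.cons_val_zero, Matrix.cons_val_succ, update_zero_vecCons, update_succ_vecCons,
    ins_apply]
  ring

theorem der_lieOp (e : L × G) (β : G) (c : WeilRing R L G) :
    der β (lieOp act cov br e c) = lieOp act cov br e (der β c) - der (cov e β) c := by
  ext n v es βs
  rw [der_apply, lieOp_apply, Fin.sum_univ_succ, WeilRing.sub_apply, lieOp_apply]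
  simp only [Matrix.cons_val_zero, Matrix.cons_val_succ, update_zero_vecCons, update_succ_vecCons,
    der_apply]
  ring

theorem map_neg_one_pow_mul (D : Derivation ℝ R R) (n : ℕ) (f : R) :
    D ((-1) ^ n * f) = (-1) ^ n * D f := by
  rcases neg_one_pow_eq_or R n with h | h <;> simp [h]

theorem par_lieOp (e : L × G) (c : WeilRing R L G) :
    par (lieOp act cov br e c) = lieOp act cov br e (par c) := by
  ext n v es β
  simp only [par_apply, lieOp_apply, map_neg_one_pow_mul, ← Finset.mul_sum, mul_sub]

theorem par_kos (c : WeilRing R L G) :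
    par (kos act cov br c) = - kos act cov br (par c) := by
  ext n v es β
  rw [par_apply, WeilRing.neg_apply]
  obtain _ | n := n
  · rw [kos_zero, kos_zero, mul_zero, neg_zero]
  · simp only [kos_succ, par_apply, map_neg_one_pow_mul, ← Finset.mul_sum, ← mul_sub,
      mul_left_comm _ ((-1 : R) ^ n)]
    ring

theorem lieOp_mul (e : L × G) (a b : WeilRing R L G) :
    lieOp act cov br e (a * b) = lieOp act cov br e a * b + a * lieOp act cov br e b := by
  let Δ : WeilRing R L G → WeilRing R L G → WeilRing R L G := fun a b =>
    lieOp act cov br e (a * b) - (lieOp act cov br e a * b + a * lieOp act cov br e b)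
  let S : AddSubgroup (WeilRing R L G) := AddSubgroup.closure {c | ∃ a b, c = Δ a b}
  have hΔ : ∀ a b, Δ a b ∈ S := fun a b => AddSubgroup.subset_closure ⟨a, b, rfl⟩
  refine sub_eq_zero.1 (ext_zero (S := S) ?_ ?_ ?_ (hΔ a b))
  · intro c hc es β
    induction hc using AddSubgroup.closure_induction with
    | zero => rfl
    | add x y _ _ hx hy => rw [WeilRing.add_apply, hx, hy, add_zero]
    | neg x _ hx => rw [WeilRing.neg_apply, hx, neg_zero]
    | mem x hx =>
      obtain ⟨a, b, rfl⟩ := hx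
      rw [WeilRing.sub_apply, WeilRing.add_apply, mul_apply_zero, mul_apply_zero, lieOp_apply,
        lieOp_apply, lieOp_apply, mul_apply_zero]
      simp only [Finset.univ_eq_empty, Finset.sum_empty, sub_zero, Derivation.leibniz, smul_eq_mul]
      ring
  · intro c hc f
    induction hc using AddSubgroup.closure_induction with
    | zero => rw [map_zero]; exact zero_mem _
    | add x y _ _ hx hy => rw [map_add]; exact add_mem hx hy
    | neg x _ hx => rw [map_neg]; exact neg_mem hx
    | mem x hx =>
      obtain ⟨a, b, rfl⟩ := hx
      have h : ins f (Δ a b) = Δ (ins f a) b + Δ (par a) (ins f b) := by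
        simp only [Δ, map_sub, map_add, ins_mul, ins_lieOp, par_lieOp]
        noncomm_ring
      rw [h]
      exact add_mem (hΔ _ _) (hΔ _ _)
  · intro c hc β
    induction hc using AddSubgroup.closure_induction with
    | zero => rw [map_zero]; exact zero_mem _
    | add x y _ _ hx hy => rw [map_add]; exact add_mem hx hy
    | neg x _ hx => rw [map_neg]; exact neg_mem hx
    | mem x hx =>
      obtain ⟨a, b, rfl⟩ := hx
      have h : der β (Δ a b) = Δ (der β a) b + Δ a (der β b) := by
        simp only [Δ, map_sub, map_add, der_mul, der_lieOp]
        noncomm_ring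
      rw [h]
      exact add_mem (hΔ _ _) (hΔ _ _)

theorem comp_vecCons_removeNth {c : WeilRing R L G} (hc : c ∈ altSym R L G) (n v : ℕ)
    (es : Fin (n + 1) → L × G) (β : Fin v → G) (k : Fin (n + 1)) (x : L × G) :
    (-1) ^ (k : ℕ) * c.comp (n + 1) v (Matrix.vecCons x (k.removeNth es)) β =
      c.comp (n + 1) v (Function.update es k x) β := by
  obtain ⟨F, hF⟩ := hc.1 (n + 1) v β
  rw [← hF, ← hF, ← Fin.insertNth_removeNth, AlternatingMap.map_insertNth, zsmul_eq_mul]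
  push_cast
  rfl

theorem ins_kos {c : WeilRing R L G} (hc : c ∈ altSym R L G) (e : L × G) :
    ins e (kos act cov br c) = lieOp act cov br e c - kos act cov br (ins e c) := by
  ext n v es β
  rw [ins_apply, kos_succ, WeilRing.sub_apply, lieOp_apply, Fin.sum_univ_succ]
  simp only [Matrix.cons_val_zero, Matrix.cons_val_succ, removeNth_zero_vecCons, Fin.val_zero,
    pow_zero, one_mul]
  obtain _ | n := n
  · rw [kos_zero]
    simp
  rw [kos_succ, Fin.sum_univ_succ (n := n) (f := fun i : Fin (n + 1) => ∑ j ∈ Finset.Ici i, _)]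
  have h0 : Finset.Ici (0 : Fin (n + 1)) = Finset.univ := by
    ext i
    simp
  have h1 : ∑ j ∈ Finset.Ici (0 : Fin (n + 1)), (-1) ^ ((j : ℕ) + 1) *
      c.comp (n + 1) v (j.succ.removeNth (Function.update (Matrix.vecCons e es)
        (Fin.castSucc 0) (br (Matrix.vecCons e es (Fin.castSucc 0)) (es j)))) β =
      - ∑ k, c.comp (n + 1) v (Function.update es k (br e (es k))) β := by
    rw [h0, ← Finset.sum_neg_distrib]
    refine Finset.sum_congr rfl fun k _ => ?_
    rw [Fin.castSucc_zero, update_zero_vecCons, removeNth_succ_vecCons, Matrix.cons_val_zero,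
      ← comp_vecCons_removeNth hc, pow_succ]
    ring
  have h2 : ∑ i : Fin n, ∑ j ∈ Finset.Ici (i.succ), (-1) ^ ((j : ℕ) + 1) *
      c.comp (n + 1) v (j.succ.removeNth (Function.update (Matrix.vecCons e es)
        (Fin.castSucc i.succ) (br (Matrix.vecCons e es (Fin.castSucc i.succ)) (es j)))) β =
      - ∑ i : Fin n, ∑ j ∈ Finset.Ici i, (-1) ^ ((j : ℕ) + 1) *
          (ins e c).comp n v (j.succ.removeNth (Function.update es i.castSucc
            (br (es i.castSucc) (es j.succ)))) β := by
    rw [← Finset.sum_neg_distrib]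
    refine Finset.sum_congr rfl fun i _ => ?_
    rw [← Fin.map_succEmb_Ici, Finset.sum_map, ← Finset.sum_neg_distrib]
    refine Finset.sum_congr rfl fun j _ => ?_
    rw [← Fin.succ_castSucc, update_succ_vecCons, Matrix.cons_val_succ, Fin.coe_succEmb,
      removeNth_succ_vecCons, ins_apply, Fin.val_succ, pow_succ]
    ring
  rw [h1, h2]
  simp only [removeNth_succ_vecCons, ins_apply, Fin.val_succ, pow_succ]
  simp only [mul_neg_one, neg_mul, Finset.sum_neg_distrib]
  ring

theorem kos_mul {a b : WeilRing R L G} (ha : a ∈ altSym R L G) (hb : b ∈ altSym R L G) :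
    kos act cov br (a * b) = kos act cov br a * b + par a * kos act cov br b := by
  refine sub_eq_zero.1 ?_
  ext n v es β
  rw [zero_apply]
  induction n generalizing a b with
  | zero =>
    rw [WeilRing.sub_apply, WeilRing.add_apply, kos_zero, mul_apply, mul_apply,
      Finset.sum_eq_zero, Finset.sum_eq_zero, add_zero, sub_zero]
    · intro S _
      refine Finset.sum_eq_zero fun T _ => ?_
      have : ∀ k (hk : k = 0) (e : Fin k → L × G) (β : Fin Tᶜ.card → G),
          (kos act cov br b).comp k Tᶜ.card e β = 0 := by
        rintro _ rfl e β
        rfl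
      rw [this _ (Finset.card_eq_zero.2 (Subsingleton.elim _ _)), mul_zero, smul_zero]
    · intro S _
      refine Finset.sum_eq_zero fun T _ => ?_
      have : ∀ k (hk : k = 0) (e : Fin k → L × G) (β : Fin T.card → G),
          (kos act cov br a).comp k T.card e β = 0 := by
        rintro _ rfl e β
        rfl
      rw [this _ (Finset.card_eq_zero.2 (Subsingleton.elim _ _)), zero_mul, smul_zero]
  | succ n ih =>
    rw [apply_succ]
    have h : ins (es 0) (kos act cov br (a * b) - (kos act cov br a * b +
        par a * kos act cov br b)) =
        - (kos act cov br (ins (es 0) a * b) - (kos act cov br (ins (es 0) a) * b +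
          par (ins (es 0) a) * kos act cov br b)) -
        (kos act cov br (par a * ins (es 0) b) - (kos act cov br (par a) * ins (es 0) b +
          par (par a) * kos act cov br (ins (es 0) b))) := by
      simp only [map_sub, map_add, ins_mul, ins_kos (mul_mem_altSym ha hb), ins_kos ha,
        ins_kos hb, ins_par, par_kos, par_par, lieOp_mul]
      noncomm_ring
    rw [h, WeilRing.sub_apply, WeilRing.neg_apply, ih (ins_mem_altSym ha _) hb,
      ih (par_mem_altSym ha) (ins_mem_altSym hb _), neg_zero, sub_zero]

end Koszul

end WeilRing

end WeilBRST

namespace WeilBRST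

section LieWeilDifferential

variable {𝔤 : Type*} [LieRing 𝔤] [LieAlgebra ℝ 𝔤]
  {ι : Type*} [Fintype ι] [DecidableEq ι] (b : Module.Basis ι ℝ 𝔤)

/-- A form of `neg_mul` for the negation that `LieWeil` inherits as a module. -/
theorem lieWeil_neg_mul (x y : LieWeil 𝔤) : -x * y = -(x * y) :=
  eq_neg_of_add_eq_zero_left (G := LieWeil 𝔤) (by
    rw [← add_mul, neg_add_cancel, zero_mul])

/-- A form of `mul_neg` for the negation that `LieWeil` inherits as a module. -/
theorem lieWeil_mul_neg (x y : LieWeil 𝔤) : x * -y = -(x * y) :=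
  eq_neg_of_add_eq_zero_left (G := LieWeil 𝔤) (by
    rw [← mul_add, neg_add_cancel, mul_zero])

/-- The value `μⁱ - ½ ∑ cⁱ_{jk} θʲ θᵏ` of the differential of `W(𝔤)` on `θⁱ`. -/
def dTheta (i : ι) : LieWeil 𝔤 := mu (b.coord i) - (1 / 2 : ℝ) • ∑ j, ∑ k,
  structConst b i j k • (theta (b.coord j) * theta (b.coord k))

/-- The value `- ∑ cⁱ_{jk} θʲ μᵏ` of the differential of `W(𝔤)` on `μⁱ`. -/
def dMu (i : ι) : LieWeil 𝔤 := - ∑ j, ∑ k,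
  structConst b i j k • (theta (b.coord j) * mu (b.coord k))

theorem dWeil_apply (a : LieWeil 𝔤) :
    dWeil b a = ∑ i, dTheta b i * derivTheta (b i) a + ∑ i, dMu b i * derivMu b i a := by
  simp only [dWeil, LinearMap.add_apply, LinearMap.sum_apply]
  rfl

theorem dTheta_mul_theta (i : ι) (ξ : Module.Dual ℝ 𝔤) :
    dTheta b i * theta ξ = theta ξ * dTheta b i := by
  simp only [dTheta, sub_mul, mul_sub, mu_mul_comm, smul_mul_assoc, mul_smul_comm, Finset.sum_mul,
    Finset.mul_sum]
  have h : ∀ j k, theta (b.coord j) * theta (b.coord k) * theta ξ =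
      theta ξ * (theta (b.coord j) * theta (b.coord k)) := by
    intro j k
    rw [mul_assoc, theta_mul_theta _ ξ, lieWeil_mul_neg, ← mul_assoc, theta_mul_theta _ ξ, lieWeil_neg_mul, neg_neg,
      mul_assoc]
  simp only [h]

theorem dMu_mul_theta (i : ι) (ξ : Module.Dual ℝ 𝔤) :
    dMu b i * theta ξ = - (theta ξ * dMu b i) := by
  simp only [dMu, lieWeil_neg_mul, lieWeil_mul_neg, smul_mul_assoc, mul_smul_comm, Finset.sum_mul,
    Finset.mul_sum, ← Finset.sum_neg_distrib]
  have h : ∀ j k, theta (b.coord j) * mu (b.coord k) * theta ξ =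
      - (theta ξ * (theta (b.coord j) * mu (b.coord k))) := by
    intro j k
    rw [mul_assoc, mu_mul_comm, ← mul_assoc, ← mul_assoc, theta_mul_theta _ ξ, lieWeil_neg_mul]
  simp only [h]
  exact Finset.sum_congr rfl fun j _ => Finset.sum_congr rfl fun k _ =>
    congrArg Neg.neg (smul_neg (A := LieWeil 𝔤) _ _)

theorem dWeil_theta (ξ : Module.Dual ℝ 𝔤) : dWeil b (theta ξ) = ∑ i, ξ (b i) • dTheta b i := by
  have h1 : ∀ u, derivTheta u (theta ξ) = ξ u • 1 := fun u => by
    have := derivTheta_theta_mul u ξ 1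
    rwa [mul_one, derivTheta_one, mul_zero, sub_zero] at this
  have h2 : ∀ i, derivMu b i (theta ξ) = 0 := fun i => by
    have := derivMu_theta_mul b i ξ 1
    rwa [mul_one, derivMu_one, mul_zero] at this
  simp only [dWeil_apply, h1, h2, mul_smul_comm, mul_one, mul_zero, Finset.sum_const_zero, add_zero]

theorem dWeil_mu (ξ : Module.Dual ℝ 𝔤) : dWeil b (mu ξ) = ∑ i, ξ (b i) • dMu b i := by
  have h1 : ∀ u, derivTheta u (mu ξ) = 0 := fun u => by
    have := derivTheta_mu_mul u ξ 1
    rwa [mul_one, derivTheta_one, mul_zero] at this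
  have h2 : ∀ i, derivMu b i (mu ξ) = ξ (b i) • 1 := fun i => by
    have := derivMu_mu_mul b i ξ 1
    rwa [mul_one, derivMu_one, mul_zero, add_zero] at this
  simp only [dWeil_apply, h1, h2, mul_smul_comm, mul_one, mul_zero, Finset.sum_const_zero, zero_add]

theorem dWeil_theta_mul (ξ : Module.Dual ℝ 𝔤) (a : LieWeil 𝔤) :
    dWeil b (theta ξ * a) = dWeil b (theta ξ) * a - theta ξ * dWeil b a := by
  rw [dWeil_theta, dWeil_apply, dWeil_apply]
  simp only [derivTheta_theta_mul, derivMu_theta_mul, mul_sub, mul_add, Finset.mul_sum,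
    Finset.sum_mul, ← mul_assoc, dTheta_mul_theta, dMu_mul_theta, Finset.sum_sub_distrib,
    smul_mul_assoc, mul_smul_comm, lieWeil_neg_mul]
  rw [Finset.sum_neg_distrib]
  abel

theorem dWeil_mu_mul (ξ : Module.Dual ℝ 𝔤) (a : LieWeil 𝔤) :
    dWeil b (mu ξ * a) = dWeil b (mu ξ) * a + mu ξ * dWeil b a := by
  rw [dWeil_mu, dWeil_apply, dWeil_apply]
  simp only [derivTheta_mu_mul, derivMu_mu_mul, mul_add, Finset.mul_sum,
    Finset.sum_mul, ← mul_assoc, mu_mul_comm ξ (dTheta b _), mu_mul_comm ξ (dMu b _),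
    Finset.sum_add_distrib, smul_mul_assoc, mul_smul_comm]
  abel

theorem weilParity_theta_mul (ξ : Module.Dual ℝ 𝔤) (a : LieWeil 𝔤) :
    weilParity (theta ξ * a) = - (theta ξ * weilParity a) := by
  induction a using TensorProduct.induction_on with
  | zero => simp
  | add x y hx hy => rw [mul_add, map_add, hx, hy, map_add, mul_add, neg_add]
  | tmul x y =>
    rw [theta_mul_tmul]
    change CliffordAlgebra.involute (CliffordAlgebra.ι _ ξ * x) ⊗ₜ y =
      - (theta ξ * (CliffordAlgebra.involute x ⊗ₜ y))
    rw [theta_mul_tmul, map_mul, CliffordAlgebra.involute_ι, neg_mul, TensorProduct.neg_tmul]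

theorem weilParity_mu_mul (ξ : Module.Dual ℝ 𝔤) (a : LieWeil 𝔤) :
    weilParity (mu ξ * a) = mu ξ * weilParity a := by
  induction a using TensorProduct.induction_on with
  | zero => simp
  | add x y hx hy => rw [mul_add, map_add, hx, hy, map_add, mul_add]
  | tmul x y =>
    rw [mu_mul_tmul]
    change CliffordAlgebra.involute x ⊗ₜ (_ * y) = mu ξ * (CliffordAlgebra.involute x ⊗ₜ y)
    rw [mu_mul_tmul]

theorem weilParity_one : weilParity (1 : LieWeil 𝔤) = 1 := by
  rw [Algebra.TensorProduct.one_def]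
  change CliffordAlgebra.involute 1 ⊗ₜ _ = _
  rw [map_one]
  rfl

end LieWeilDifferential

section BrstDifferential

variable {𝔤 : Type*} [LieRing 𝔤] [LieAlgebra ℝ 𝔤]
  {R L : Type*} [CommRing R] [Algebra ℝ R] [LieRing L] [Module R L] [LieAlgebra ℝ L]
  [LieRingModule L R] [LieRinehartRing R L] [LieRinehartAlgebra ℝ R L]
  {ι : Type*} [Fintype ι] [DecidableEq ι] (b : Module.Basis ι ℝ 𝔤) (ρ : 𝔤 →ₗ⁅ℝ⁆ L)

theorem brstDiff_tmul (a : LieWeil 𝔤) (w : Forms R L) :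
    brstDiff b ρ (a ⊗ₜ[ℝ] w : BRST 𝔤 R L) = dWeil b a ⊗ₜ w + weilParity a ⊗ₜ dDR w +
      ∑ i, (theta (b.coord i) * a) ⊗ₜ lieDer (ρ (b i)) w +
      ∑ i, (- mu (b.coord i) * weilParity a) ⊗ₜ contraction (ρ (b i)) w := by
  simp only [brstDiff, LinearMap.add_apply, LinearMap.sum_apply, TensorProduct.map_tmul]
  rfl

theorem brstDiff_theta (ξ : Module.Dual ℝ 𝔤) (x : BRST 𝔤 R L) :
    brstDiff b ρ (leftMul (theta ξ) x) + leftMul (theta ξ) (brstDiff b ρ x) =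
      leftMul (dWeil b (theta ξ)) x := by
  induction x using TensorProduct.induction_on with
  | zero => simp
  | add x y hx hy => simp only [map_add, ← hx, ← hy]; abel
  | tmul a w =>
    rw [leftMul_tmul, brstDiff_tmul, brstDiff_tmul, leftMul_tmul]
    simp only [map_add, map_sum, leftMul_tmul]
    have h1 : dWeil b (theta ξ) * a = dWeil b (theta ξ * a) + theta ξ * dWeil b a := by
      rw [dWeil_theta_mul, sub_add_cancel]
    have h2 : weilParity (theta ξ * a) ⊗ₜ dDR w + (theta ξ * weilParity a) ⊗ₜ dDR w =
        (0 : BRST 𝔤 R L) := by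
      rw [← TensorProduct.add_tmul, weilParity_theta_mul, neg_add_cancel, TensorProduct.zero_tmul]
    have h3 : ∑ i, (theta (b.coord i) * (theta ξ * a)) ⊗ₜ lieDer (ρ (b i)) w +
        ∑ i, (theta ξ * (theta (b.coord i) * a)) ⊗ₜ lieDer (ρ (b i)) w = (0 : BRST 𝔤 R L) := by
      rw [← Finset.sum_add_distrib]
      refine Finset.sum_eq_zero fun i _ => ?_
      rw [← TensorProduct.add_tmul, ← mul_assoc, ← mul_assoc, theta_mul_theta, lieWeil_neg_mul,
        neg_add_cancel, TensorProduct.zero_tmul]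
    have h4 : ∑ i, (- mu (b.coord i) * weilParity (theta ξ * a)) ⊗ₜ contraction (ρ (b i)) w +
        ∑ i, (theta ξ * (- mu (b.coord i) * weilParity a)) ⊗ₜ contraction (ρ (b i)) w =
          (0 : BRST 𝔤 R L) := by
      rw [← Finset.sum_add_distrib]
      refine Finset.sum_eq_zero fun i _ => ?_
      rw [← TensorProduct.add_tmul, weilParity_theta_mul, lieWeil_neg_mul, lieWeil_mul_neg, neg_neg,
        lieWeil_neg_mul, lieWeil_mul_neg, ← mul_assoc, mu_mul_comm, mul_assoc, add_neg_cancel, TensorProduct.zero_tmul]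
    rw [h1, TensorProduct.add_tmul]
    calc _ = dWeil b (theta ξ * a) ⊗ₜ w + (theta ξ * dWeil b a) ⊗ₜ w +
          (weilParity (theta ξ * a) ⊗ₜ dDR w + (theta ξ * weilParity a) ⊗ₜ dDR w) +
          (∑ i, (theta (b.coord i) * (theta ξ * a)) ⊗ₜ lieDer (ρ (b i)) w +
            ∑ i, (theta ξ * (theta (b.coord i) * a)) ⊗ₜ lieDer (ρ (b i)) w) +
          (∑ i, (- mu (b.coord i) * weilParity (theta ξ * a)) ⊗ₜ contraction (ρ (b i)) w +
            ∑ i, (theta ξ * (- mu (b.coord i) * weilParity a)) ⊗ₜ contraction (ρ (b i)) w) := by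
            abel
      _ = _ := by rw [h2, h3, h4, add_zero, add_zero, add_zero]

theorem brstDiff_mu (ξ : Module.Dual ℝ 𝔤) (x : BRST 𝔤 R L) :
    brstDiff b ρ (leftMul (mu ξ) x) =
      leftMul (dWeil b (mu ξ)) x + leftMul (mu ξ) (brstDiff b ρ x) := by
  induction x using TensorProduct.induction_on with
  | zero => simp
  | add x y hx hy => simp only [map_add, hx, hy]; abel
  | tmul a w =>
    rw [leftMul_tmul, brstDiff_tmul, brstDiff_tmul, leftMul_tmul]
    simp only [map_add, map_sum, leftMul_tmul]
    have h3 : ∀ i, theta (b.coord i) * (mu ξ * a) = mu ξ * (theta (b.coord i) * a) := fun i => by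
      rw [← mul_assoc, ← mul_assoc, mu_mul_comm]
    have h4 : ∀ i, - mu (b.coord i) * (mu ξ * weilParity a) =
        mu ξ * (- mu (b.coord i) * weilParity a) := fun i => by
      rw [← mul_assoc, ← mul_assoc, mu_mul_comm ξ]
    simp only [dWeil_mu_mul, weilParity_mu_mul, h3, h4, TensorProduct.add_tmul]
    abel

theorem brstDiff_one_tmul_lof (k : ℕ) (φ : Form R L k) :
    brstDiff b ρ (1 ⊗ₜ[ℝ] DirectSum.lof ℝ ℕ (Form R L) k φ : BRST 𝔤 R L) =
      1 ⊗ₜ DirectSum.lof ℝ ℕ (Form R L) (k + 1) (extForm φ) +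
      ∑ i, leftMul (theta (b.coord i))
        (1 ⊗ₜ DirectSum.lof ℝ ℕ (Form R L) k (lieForm (ρ (b i)) φ)) +
      ∑ i, leftMul (- mu (b.coord i))
        (1 ⊗ₜ contraction (ρ (b i)) (DirectSum.lof ℝ ℕ (Form R L) k φ)) := by
  have h1 : dWeil b 1 = 0 := by
    simp only [dWeil_apply, derivTheta_one, derivMu_one, mul_zero, Finset.sum_const_zero, add_zero]
  rw [brstDiff_tmul, h1, TensorProduct.zero_tmul, zero_add, weilParity_one, dDR,
    DirectSum.toModule_lof]
  simp only [lieDer, DirectSum.toModule_lof, leftMul_tmul]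
  rfl

end BrstDifferential

end WeilBRST

namespace WeilBRST

namespace WeilRing

section Extensionality

variable {R L G : Type*} [CommRing R] [Algebra ℝ R] [AddCommGroup L] [Module R L]
  [AddCommGroup G] [Module R G]
  {act : L × G → Derivation ℝ R R} {cov : L × G → G → G} {br : L × G → L × G → L × G}

theorem eq_of_ins {a b : WeilRing R L G} (h : ∀ e, ins e a = ins e b)
    (h0 : ∀ v e β, a.comp 0 v e β = b.comp 0 v e β) : a = b := by
  ext n v e β
  obtain _ | n := n
  · exact h0 v e β
  · rw [apply_succ, apply_succ b, h]

theorem eq_of_ins_der {a b : WeilRing R L G} (h : ∀ e, ins e a = ins e b)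
    (h' : ∀ β, der β a = der β b) (h0 : ∀ e β, a.comp 0 0 e β = b.comp 0 0 e β) : a = b := by
  refine eq_of_ins h fun v e β => ?_
  obtain _ | v := v
  · exact h0 e β
  · rw [apply_succ', apply_succ' b, h']

theorem theta_mul_comp_zero (l : G →ₗ[R] R) (c : WeilRing R L G) (v : ℕ) (e : Fin 0 → L × G)
    (β : Fin v → G) : (theta L l * c).comp 0 v e β = 0 := by
  rw [mul_apply]
  refine Finset.sum_eq_zero fun S _ => Finset.sum_eq_zero fun T _ => ?_
  have h := Finset.card_le_univ S
  rw [Fintype.card_fin] at h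
  rw [theta_comp, dif_neg (by omega), zero_mul, smul_zero]

theorem mu_mul_comp_zero (l : G →ₗ[R] R) (c : WeilRing R L G) (n : ℕ) (e : Fin n → L × G)
    (β : Fin 0 → G) : (mu L l * c).comp n 0 e β = 0 := by
  rw [mul_apply]
  refine Finset.sum_eq_zero fun S _ => Finset.sum_eq_zero fun T _ => ?_
  have h := Finset.card_le_univ T
  rw [Fintype.card_fin] at h
  rw [mu_comp, dif_neg (by omega), zero_mul, smul_zero]

/-- The contraction of a multilinear cochain, as a linear map in the contracted argument. -/
def insHom {c : WeilRing R L G} (hc : c ∈ altSym R L G) : L × G →ₗ[R] WeilRing R L G where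
  toFun e := ins e c
  map_add' := ins_add hc
  map_smul' := ins_smul hc

theorem insTerm_eq_zero {j : G → L × G} {c : WeilRing R L G} (h : ∀ β, ins (j β) c = 0) :
    insTerm j c = 0 := by
  ext n v e β
  obtain _ | v := v
  · rfl
  · rw [insTerm_succ]
    exact Finset.sum_eq_zero fun k _ => by rw [h]; rfl

theorem lieOp_smul_one (e : L × G) (f : R) :
    lieOp act cov br e (f • 1 : WeilRing R L G) = act e f • 1 := by
  ext n v es β
  rw [lieOp_apply]
  simp only [smul_apply, one_apply]
  split_ifs with h
  · obtain ⟨rfl, rfl⟩ := h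
    simp
  · simp

theorem ins_kos_smul_one (e : L × G) (f : R) :
    ins e (kos act cov br (f • 1 : WeilRing R L G)) = act e f • 1 := by
  have h : ins e (f • 1 : WeilRing R L G) = 0 := by rw [map_smul, ins_one, smul_zero]
  rw [ins_kos ((altSym R L G).smul_mem f one_mem_altSym), h, map_zero, sub_zero, lieOp_smul_one]

theorem lieOp_theta (e f : L × G) (l : G →ₗ[R] R) :
    ins f (lieOp act cov br e (theta L l)) = (act e (l f.2) - l (br e f).2) • 1 := by
  rw [ins_lieOp, ins_theta, ins_theta, lieOp_smul_one, sub_smul]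

theorem ins_ins_kos_theta (e f : L × G) (l : G →ₗ[R] R) :
    ins f (ins e (kos act cov br (theta L l))) =
      (act e (l f.2) - l (br e f).2 - act f (l e.2)) • 1 := by
  rw [ins_kos (theta_mem_altSym l), map_sub, lieOp_theta, ins_theta, ins_kos_smul_one,
    sub_smul _ (act f (l e.2))]

theorem ins_kos_theta_comp_zero (e : L × G) (l : G →ₗ[R] R) (v : ℕ) (es : Fin 0 → L × G)
    (β : Fin v → G) : (ins e (kos act cov br (theta L l))).comp 0 v es β = 0 := by
  rw [ins_kos (theta_mem_altSym l), sub_apply, lieOp_apply, kos_zero]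
  simp [theta_comp]

theorem lieOp_mu (e : L × G) (l l' : G →ₗ[R] R) (h : ∀ β, act e (l β) - l (cov e β) = l' β) :
    lieOp act cov br e (mu L l) = mu L l' := by
  refine eq_of_ins_der (fun f => ?_) (fun β => ?_) fun es β => ?_
  · rw [ins_lieOp, ins_mu, ins_mu, ins_mu, map_zero, sub_zero]
  · rw [der_lieOp, der_mu, der_mu, der_mu, lieOp_smul_one, ← sub_smul, h]
  · rw [lieOp_apply, mu_comp, mu_comp]
    simp

theorem ins_kos_mu (e : L × G) (l l' : G →ₗ[R] R) (h : ∀ β, act e (l β) - l (cov e β) = l' β) :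
    ins e (kos act cov br (mu L l)) = mu L l' := by
  rw [ins_kos (mu_mem_altSym l), lieOp_mu e l l' h, ins_mu, map_zero, sub_zero]

end Extensionality

section Values

variable {𝔤 : Type*} [LieRing 𝔤] [LieAlgebra ℝ 𝔤]
  {R L G : Type*} [CommRing R] [Algebra ℝ R] [LieRing L] [Module R L] [LieAlgebra ℝ L]
  [LieRingModule L R] [LieRinehartRing R L] [LieRinehartAlgebra ℝ R L]
  [AddCommGroup G] [Module R G]

variable (R) in
/-- The derivation `f ↦ X(f)`. -/
def vecDer (X : L) : Derivation ℝ R R where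
  toFun f := ⁅X, f⁆
  map_add' := lie_add X
  map_smul' r f := LieModule.lie_smul r X f
  map_one_eq_zero' := by
    have h := LieRinehartRing.leibniz_mul_right X (1 : R) 1
    simpa using h
  leibniz' f g := by
    change ⁅X, f * g⁆ = f • ⁅X, g⁆ + g • ⁅X, f⁆
    rw [LieRinehartRing.leibniz_mul_right]
    simp only [smul_eq_mul]
    ring

theorem vecDer_apply (X : L) (f : R) : vecDer R X f = ⁅X, f⁆ := rfl

variable (nab : L → G → G) (rho : G →ₗ[R] L) (brG : G → G → G)

/-- The covariant exterior derivative of a connection. -/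
def kosVer : WeilRing R L G →ₗ[ℝ] WeilRing R L G :=
  kos (fun e => vecDer R e.1) (fun e β => nab e.1 β)
    (fun e e' => (⁅e.1, e'.1⁆, nab e.1 e'.2 - nab e'.1 e.2))

/-- The covariant exterior derivative of the basic connections. -/
def kosHor : WeilRing R L G →ₗ[ℝ] WeilRing R L G :=
  kos (fun e => vecDer R (rho e.2)) (fun e β => nab (rho β) e.2 + brG e.2 β)
    (fun e e' => ((rho (nab e'.1 e.2) + ⁅rho e.2, e'.1⁆) - (rho (nab e.1 e'.2) + ⁅rho e'.2, e.1⁆),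
      brG e.2 e'.2))

/-- The sum of the horizontal and the vertical differential, without the contributions of the
curvatures. -/
def flatDiff : WeilRing R L G →ₗ[ℝ] WeilRing R L G :=
  (- insTerm (fun β => (rho β, 0)) + kosHor nab rho brG) +
    (insTerm (fun β => (0, β)) + kosVer nab)

theorem flatDiff_apply (c : WeilRing R L G) : flatDiff nab rho brG c =
    (- insTerm (fun β => (rho β, 0)) c + kosHor nab rho brG c) +
      (insTerm (fun β => (0, β)) c + kosVer nab c) := rfl

theorem flatDiff_mul {a c : WeilRing R L G} (ha : a ∈ altSym R L G) (hc : c ∈ altSym R L G) :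
    flatDiff nab rho brG (a * c) = flatDiff nab rho brG a * c + par a * flatDiff nab rho brG c := by
  simp only [flatDiff_apply, insTerm_mul ha hc, kosHor, kosVer, kos_mul ha hc]
  noncomm_ring

theorem kosVer_form {k : ℕ} (φ : Form R L k) :
    kosVer nab (form G φ) = form G (extForm φ) := by
  ext n v e β
  obtain _ | n := n
  · rw [kosVer, kos_zero, form_comp_of_ne _ (by omega)]
  rw [kosVer, kos_succ]
  by_cases h : n = k ∧ v = 0
  · obtain ⟨rfl, rfl⟩ := h
    rw [form_comp_self, extForm_apply, koszul]
    simp only [form_comp_self, Finset.univ_eq_empty (α := Fin 0), Finset.sum_empty, sub_zero]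
    congr 1
    refine Finset.sum_congr rfl fun i _ => Finset.sum_congr rfl fun j _ => ?_
    congr 2
    funext m
    exact congrFun (Function.comp_update (Prod.fst : L × G → L) e i.castSucc _) (j.succ.succAbove m)
  · have h0 : ∀ e β, (form G φ).comp n v e β = 0 := fun e β => form_comp_of_ne φ h e β
    rw [form_comp_of_ne _ (by omega)]
    simp only [h0, map_zero, Finset.sum_const_zero, sub_zero, mul_zero, add_zero]

variable {nab rho brG}
variable {p : Module.Dual ℝ 𝔤 →ₗ[ℝ] G →ₗ[R] R} {ι : Type*} [Fintype ι] [DecidableEq ι]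
  {b : Module.Basis ι ℝ 𝔤} {ρ : 𝔤 →ₗ⁅ℝ⁆ L}
  (hnab : ∀ ξ X α, p ξ (nab X α) = ⁅X, p ξ α⁆)
  (hrho : ∀ α, rho α = ∑ a, p (b.coord a) α • ρ (b a))
  (hbr : ∀ ξ α β, p ξ (brG α β) = ∑ i, ∑ j, ξ ⁅b i, b j⁆ • (p (b.coord i) α * p (b.coord j) β) +
    ⁅rho α, p ξ β⁆ - ⁅rho β, p ξ α⁆)

include hnab in
theorem kosVer_theta (ξ : Module.Dual ℝ 𝔤) : kosVer nab (theta L (p ξ)) = 0 := by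
  refine eq_of_ins (fun e => eq_of_ins (fun f => ?_) fun v es β => ?_) fun v es β => rfl
  · rw [kosVer, ins_ins_kos_theta, map_zero, map_zero, map_sub, hnab, hnab]
    simp only [vecDer_apply]
    rw [sub_sub, sub_add_cancel, sub_self, zero_smul]
  · rw [kosVer, ins_kos_theta_comp_zero, map_zero]
    rfl

include hnab in
theorem kosVer_mu (ξ : Module.Dual ℝ 𝔤) : kosVer nab (mu L (p ξ)) = 0 := by
  refine eq_of_ins (fun e => ?_) fun v es β => rfl
  rw [kosVer, ins_kos_mu e (p ξ) 0, map_zero]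
  · ext n v es β
    rw [mu_comp]
    simp
    rfl
  · intro β
    rw [hnab, vecDer_apply, sub_self, LinearMap.zero_apply]

theorem insTerm_theta (l : G →ₗ[R] R) : insTerm (fun β => ((0 : L), β)) (theta L l) = mu L l := by
  refine eq_of_ins_der (fun e => ?_) (fun β => ?_) fun e β => ?_
  · rw [ins_insTerm (theta_mem_altSym l), ins_mu, ins_theta, insTerm_eq_zero, neg_zero]
    intro β
    rw [map_smul, ins_one, smul_zero]
  · rw [der_insTerm, ins_theta, der_theta, map_zero, add_zero, der_mu]
  · rw [insTerm_zero, mu_comp, dif_neg (by omega)]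

theorem insTerm_inl_theta (l : G →ₗ[R] R) :
    insTerm (fun β => (rho β, (0 : G))) (theta L l) = 0 :=
  insTerm_eq_zero fun β => by rw [ins_theta, map_zero, zero_smul]

theorem insTerm_mu (j : G → L × G) (l : G →ₗ[R] R) : insTerm j (mu L l) = 0 :=
  insTerm_eq_zero fun _ => ins_mu _ _

theorem insTerm_inr_form {k : ℕ} (φ : Form R L k) :
    insTerm (fun β => ((0 : L), β)) (form G φ) = 0 :=
  insTerm_eq_zero fun _ => ins_zero_form _ _

theorem lieWeilMap_dTheta (i : ι) : lieWeilMap L p (dTheta b i) = mu L (p (b.coord i)) -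
    (1 / 2 : ℝ) • ∑ j, ∑ k, structConst b i j k •
      (theta L (p (b.coord j)) * theta L (p (b.coord k))) := by
  simp only [dTheta, map_sub, map_smul, map_sum, map_mul, lieWeilMap_theta, lieWeilMap_mu]

theorem lieWeilMap_dMu (i : ι) : lieWeilMap L p (dMu b i) =
    - ∑ j, ∑ k, structConst b i j k • (theta L (p (b.coord j)) * mu L (p (b.coord k))) := by
  simp only [dMu, map_neg, map_smul, map_sum, map_mul, lieWeilMap_theta, lieWeilMap_mu]

theorem sum_structConst (ξ : Module.Dual ℝ 𝔤) (j k : ι) :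
    ∑ i, ξ (b i) * structConst b i j k = ξ ⁅b j, b k⁆ := by
  conv_rhs => rw [← b.sum_repr ⁅b j, b k⁆, map_sum]
  exact Finset.sum_congr rfl fun i _ => by rw [map_smul, smul_eq_mul, mul_comm]; rfl

theorem lieWeilMap_dWeil_theta (ξ : Module.Dual ℝ 𝔤) :
    lieWeilMap L p (dWeil b (WeilBRST.theta ξ)) = mu L (p ξ) - (1 / 2 : ℝ) • ∑ j, ∑ k,
      ξ ⁅b j, b k⁆ • (theta L (p (b.coord j)) * theta L (p (b.coord k))) := by
  have h := congrArg (lieWeilMap L p) (mu_eq_sum b ξ)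
  simp only [map_sum, map_smul, lieWeilMap_mu] at h
  rw [dWeil_theta, h]
  simp only [map_sum, map_smul, lieWeilMap_dTheta, smul_sub, Finset.sum_sub_distrib]
  congr 1
  simp only [← sum_structConst, Finset.sum_smul, Finset.smul_sum]
  rw [Finset.sum_comm]
  refine Finset.sum_congr rfl fun j _ => ?_
  rw [Finset.sum_comm]
  refine Finset.sum_congr rfl fun k _ => Finset.sum_congr rfl fun i _ => ?_
  rw [smul_smul, smul_smul, smul_smul]
  ring_nf

theorem lieWeilMap_dWeil_mu (ξ : Module.Dual ℝ 𝔤) :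
    lieWeilMap L p (dWeil b (WeilBRST.mu ξ)) = - ∑ j, ∑ k,
      ξ ⁅b j, b k⁆ • (theta L (p (b.coord j)) * mu L (p (b.coord k))) := by
  rw [dWeil_mu]
  simp only [map_sum, map_smul, lieWeilMap_dMu, smul_neg, Finset.sum_neg_distrib]
  congr 1
  simp only [← sum_structConst, Finset.sum_smul, Finset.smul_sum]
  rw [Finset.sum_comm]
  refine Finset.sum_congr rfl fun j _ => ?_
  rw [Finset.sum_comm]
  refine Finset.sum_congr rfl fun k _ => Finset.sum_congr rfl fun i _ => ?_
  rw [smul_smul]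

end Values

end WeilRing

end WeilBRST

namespace WeilBRST

namespace WeilRing

section HorizontalValues

variable {𝔤 : Type*} [LieRing 𝔤] [LieAlgebra ℝ 𝔤]
  {R L G : Type*} [CommRing R] [Algebra ℝ R] [LieRing L] [Module R L] [LieAlgebra ℝ L]
  [LieRingModule L R] [LieRinehartRing R L] [LieRinehartAlgebra ℝ R L]
  [AddCommGroup G] [Module R G]
  {nab : L → G → G} {rho : G →ₗ[R] L} {brG : G → G → G}
  {p : Module.Dual ℝ 𝔤 →ₗ[ℝ] G →ₗ[R] R} {ι : Type*} [Fintype ι] [DecidableEq ι]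
  {b : Module.Basis ι ℝ 𝔤} {ρ : 𝔤 →ₗ⁅ℝ⁆ L}
  (hnab : ∀ ξ X α, p ξ (nab X α) = ⁅X, p ξ α⁆)
  (hrho : ∀ α, rho α = ∑ a, p (b.coord a) α • ρ (b a))
  (hbr : ∀ ξ α β, p ξ (brG α β) = ∑ i, ∑ j, ξ ⁅b i, b j⁆ • (p (b.coord i) α * p (b.coord j) β) +
    ⁅rho α, p ξ β⁆ - ⁅rho β, p ξ α⁆)

include hbr in
theorem kosHor_theta (ξ : Module.Dual ℝ 𝔤) : kosHor nab rho brG (theta L (p ξ)) =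
    - ((1 / 2 : ℝ) • ∑ j, ∑ k,
      ξ ⁅b j, b k⁆ • (theta L (p (b.coord j)) * theta L (p (b.coord k)))) := by
  have h0 : ∀ j k (e : L × G), ins e (theta L (p (b.coord j)) * theta L (p (b.coord k))) =
      p (b.coord j) e.2 • theta L (p (b.coord k)) - p (b.coord k) e.2 • theta L (p (b.coord j)) := by
    intro j k e
    rw [ins_mul, ins_theta, ins_theta, par_theta, smul_mul_assoc, one_mul, mul_smul_comm, mul_one,
      smul_neg, ← sub_eq_add_neg]
  have hins : ∀ (e : L × G) (r : ℝ) (c : WeilRing R L G), ins e (r • c) = r • ins e c :=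
    fun _ _ _ => rfl
  refine eq_of_ins (fun e => eq_of_ins (fun f => ?_) fun v es β => ?_) fun v es β => ?_
  · rw [kosHor, ins_ins_kos_theta]
    simp only [map_neg, hins, map_sum, h0, map_sub, map_smul, ins_theta, vecDer_apply, hbr]
    have h1 : ∑ i, ∑ j, ξ ⁅b i, b j⁆ • (p (b.coord j) e.2 * p (b.coord i) f.2) =
        - ∑ i, ∑ j, ξ ⁅b i, b j⁆ • (p (b.coord i) e.2 * p (b.coord j) f.2) := by
      rw [Finset.sum_comm, ← Finset.sum_neg_distrib]
      refine Finset.sum_congr rfl fun i _ => ?_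
      rw [← Finset.sum_neg_distrib]
      refine Finset.sum_congr rfl fun j _ => ?_
      rw [← lie_skew, map_neg, neg_smul]
    have h2 : ∑ i, ∑ j, ξ ⁅b i, b j⁆ • (p (b.coord i) e.2 • p (b.coord j) f.2 •
          (1 : WeilRing R L G) - p (b.coord j) e.2 • p (b.coord i) f.2 • 1) =
        (2 * ∑ i, ∑ j, ξ ⁅b i, b j⁆ • (p (b.coord i) e.2 * p (b.coord j) f.2)) • 1 := by
      have h3 : (2 * ∑ i, ∑ j, ξ ⁅b i, b j⁆ • (p (b.coord i) e.2 * p (b.coord j) f.2)) =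
          ∑ i, ∑ j, ξ ⁅b i, b j⁆ • (p (b.coord i) e.2 * p (b.coord j) f.2) -
          ∑ i, ∑ j, ξ ⁅b i, b j⁆ • (p (b.coord j) e.2 * p (b.coord i) f.2) := by
        rw [h1]
        ring
      rw [h3]
      simp only [← Finset.sum_sub_distrib, Finset.sum_smul, ← smul_sub, smul_assoc, sub_smul,
        mul_smul]
    rw [h2, ← smul_assoc, ← neg_smul]
    congr 1
    rw [two_mul, ← two_smul ℝ, smul_smul]
    norm_num
    ring
  · rw [kosHor, ins_kos_theta_comp_zero]
    simp only [map_neg, hins, map_sum, h0, neg_apply, smul_apply, sum_apply, sub_apply]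
    simp [theta_comp]
  · simp only [neg_apply, smul_apply, sum_apply, theta_mul_comp_zero, smul_zero,
      Finset.sum_const_zero, neg_zero]
    rfl

include hnab hbr in
theorem kosHor_mu (ξ : Module.Dual ℝ 𝔤) : kosHor nab rho brG (mu L (p ξ)) =
    - ∑ j, ∑ k, ξ ⁅b j, b k⁆ • (theta L (p (b.coord j)) * mu L (p (b.coord k))) := by
  refine eq_of_ins (fun e => ?_) fun v es β => ?_
  · have h1 : ins e (- ∑ j, ∑ k, ξ ⁅b j, b k⁆ •
        (theta L (p (b.coord j)) * mu L (p (b.coord k)))) =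
        mu L (- ∑ j, ∑ k, ξ ⁅b j, b k⁆ • p (b.coord j) e.2 • p (b.coord k)) := by
      have hins : ∀ (r : ℝ) (c : WeilRing R L G), ins e (r • c) = r • ins e c := fun _ _ => rfl
      let m : (G →ₗ[R] R) →ₗ[R] WeilRing R L G :=
        { toFun := mu L, map_add' := mu_add, map_smul' := mu_smul }
      change _ = m _
      have hm : ∀ (r : ℝ) (l : G →ₗ[R] R), m (r • l) = r • m l := fun r l => mu_smul r l
      simp only [map_neg, map_sum, hins, hm, map_smul, ins_mul, ins_theta, ins_mu, mul_zero,
        add_zero, smul_mul_assoc, one_mul]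
      rfl
    rw [h1, kosHor]
    refine ins_kos_mu e _ _ fun β => ?_
    rw [vecDer_apply, map_add, hnab, hbr]
    simp only [LinearMap.neg_apply, LinearMap.sum_apply, LinearMap.smul_apply, smul_eq_mul]
    ring
  · simp only [neg_apply, sum_apply, smul_apply, theta_mul_comp_zero, smul_zero,
      Finset.sum_const_zero, neg_zero]
    rfl

include hrho in
theorem ins_rho {c : WeilRing R L G} (hc : c ∈ altSym R L G) (α : G) :
    ins (rho α, 0) c = ∑ a, p (b.coord a) α • ins (ρ (b a), 0) c := by
  have h := map_sum (insHom hc ∘ₗ LinearMap.inl R L G) (fun a => p (b.coord a) α • ρ (b a))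
    Finset.univ
  simp only [map_smul] at h
  rw [hrho]
  exact h

include hrho in
theorem insTerm_inl_form {k : ℕ} (φ : Form R L k) :
    insTerm (fun β => (rho β, (0 : G))) (form G φ) =
      ∑ a, mu L (p (b.coord a)) * ins (ρ (b a), 0) (form G φ) := by
  have key : ∀ (n : ℕ) (c : WeilRing R L G) (hc : c ∈ altSym R L G) (hd : ∀ β, der β c = 0)
      v (e : Fin n → L × G) (β : Fin v → G),
      (insTerm (fun β => (rho β, (0 : G))) c).comp n v e β =
        (∑ a, mu L (p (b.coord a)) * ins (ρ (b a), 0) c).comp n v e β := by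
    intro n
    induction n with
    | zero =>
      intro c hc hd v e β
      obtain _ | v := v
      · simp only [sum_apply, mu_mul_comp_zero, Finset.sum_const_zero]
        rfl
      · rw [apply_succ', apply_succ' (∑ a, _), der_insTerm, hd, map_zero, add_zero,
          ins_rho hrho hc]
        simp only [map_sum, der_mul, der_mu, ← ins_der, hd, map_zero, mul_zero, add_zero,
          smul_mul_assoc, one_mul]
    | succ n ih =>
      intro c hc hd v e β
      rw [apply_succ, apply_succ (∑ a, _), ins_insTerm hc, neg_apply,
        ih _ (ins_mem_altSym hc _) fun β => by rw [← ins_der, hd, map_zero]]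
      simp only [map_sum, ins_mu_mul, ins_ins_comm hc (e 0), mul_neg, Finset.sum_neg_distrib,
        neg_apply]
  ext n v e β
  exact key n _ (form_mem_altSym φ) (fun β => der_form β φ) v e β

include hnab hrho in
theorem basicTangent_eq (α : G) (X : L) :
    rho (nab X α) + ⁅rho α, X⁆ = ∑ a, p (b.coord a) α • ⁅ρ (b a), X⁆ := by
  have h : ∀ (s : Finset ι), ⁅∑ a ∈ s, p (b.coord a) α • ρ (b a), X⁆ =
      ∑ a ∈ s, (p (b.coord a) α • ⁅ρ (b a), X⁆ - ⁅X, p (b.coord a) α⁆ • ρ (b a)) := by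
    intro s
    rw [sum_lie]
    refine Finset.sum_congr rfl fun a _ => ?_
    rw [← lie_skew, LieRinehartRing.leibniz_smul_right, ← lie_skew (ρ (b a)) X]
    module
  rw [hrho, hrho α, h]
  simp only [hnab, Finset.sum_sub_distrib]
  abel

theorem curryLeft_lieForm {k : ℕ} (X Y : L) (φ : Form R L (k + 1)) :
    lieForm Y (φ.curryLeft X) = (lieForm Y φ).curryLeft X + φ.curryLeft ⁅Y, X⁆ := by
  ext v
  change lieForm Y (φ.curryLeft X) v = lieForm Y φ (Matrix.vecCons X v) +
    φ (Matrix.vecCons ⁅Y, X⁆ v)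
  rw [lieForm_apply, lieForm_apply, Fin.sum_univ_succ]
  simp only [update_zero_vecCons, update_succ_vecCons, Matrix.cons_val_zero, Matrix.cons_val_succ,
    AlternatingMap.curryLeft_apply_apply]
  ring

theorem form_lieForm_curryLeft {k : ℕ} (X : L × G) (Y : L) (φ : Form R L (k + 1)) :
    form G (lieForm Y (φ.curryLeft X.1)) =
      ins X (form G (lieForm Y φ)) + ins (⁅Y, X.1⁆, 0) (form G φ) := by
  rw [curryLeft_lieForm, form_add, ins_form, ins_form]

include hnab hrho in
theorem ins_basic {c : WeilRing R L G} (hc : c ∈ altSym R L G) (hI : ∀ γ, ins (0, γ) c = 0)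
    (e f : L × G) (γ : G) :
    ins ((rho (nab f.1 e.2) + ⁅rho e.2, f.1⁆) - (rho (nab e.1 f.2) + ⁅rho f.2, e.1⁆), γ) c =
      ∑ a, p (b.coord a) e.2 • ins (⁅ρ (b a), f.1⁆, 0) c -
        ∑ a, p (b.coord a) f.2 • ins (⁅ρ (b a), e.1⁆, 0) c := by
  rw [basicTangent_eq hnab hrho, basicTangent_eq hnab hrho]
  have h := map_sub (insHom hc ∘ₗ LinearMap.inl R L G)
    (∑ a, p (b.coord a) e.2 • ⁅ρ (b a), f.1⁆) (∑ a, p (b.coord a) f.2 • ⁅ρ (b a), e.1⁆)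
  simp only [map_sum, map_smul] at h
  refine Eq.trans ?_ h
  change _ = ins (_, 0) c
  rw [← add_zero (ins (_, 0) c), ← hI γ, ← ins_add hc]
  simp

theorem vecDer_sum (s : Finset ι) (f : ι → R) (X : ι → L) (g : R) :
    ⁅∑ a ∈ s, f a • X a, g⁆ = ∑ a ∈ s, f a * ⁅X a, g⁆ := by
  induction s using Finset.cons_induction with
  | empty => simp
  | cons a s ha ih =>
    rw [Finset.sum_cons, Finset.sum_cons, add_lie, ih, LieRinehartRing.lie_smul_eq_mul]

include hnab hrho in
theorem lieOp_form {k : ℕ} (e : L × G) (φ : Form R L k) :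
    lieOp (fun e => vecDer R (rho e.2)) (fun e β => nab (rho β) e.2 + brG e.2 β)
      (fun e e' => ((rho (nab e'.1 e.2) + ⁅rho e.2, e'.1⁆) - (rho (nab e.1 e'.2) + ⁅rho e'.2, e.1⁆),
      brG e.2 e'.2)) e (form G φ) =
    ∑ a, p (b.coord a) e.2 • form G (lieForm (ρ (b a)) φ) +
      ∑ a, theta L (p (b.coord a)) * ins (⁅ρ (b a), e.1⁆, 0) (form G φ) := by
  induction k with
  | zero =>
    have h0 : ∀ f : L × G, ins f (form G φ) = 0 := fun f => ins_form_zero f φ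
    refine eq_of_ins (fun f => ?_) fun v es β => ?_
    · rw [ins_lieOp, h0, h0, map_zero, sub_zero]
      simp only [h0, mul_zero, Finset.sum_const_zero, add_zero, map_sum, map_smul, ins_form_zero,
        smul_zero]
    · simp only [h0, mul_zero, Finset.sum_const_zero, add_zero, lieOp_apply, sum_apply, smul_apply,
        vecDer_apply, Finset.univ_eq_empty (α := Fin 0), Finset.sum_empty, sub_zero]
      obtain _ | v := v
      · simp only [form_comp_self, Finset.univ_eq_empty (α := Fin 0), Finset.sum_empty, sub_zero,
          lieForm_apply, hrho, vecDer_sum, smul_eq_mul]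
      · simp [form_comp]
  | succ k ih =>
    refine eq_of_ins (fun f => ?_) fun v es β => ?_
    · rw [ins_lieOp, ins_form f φ, ih, ins_basic hnab hrho (form_mem_altSym φ)
        (fun γ => ins_zero_form γ φ)]
      simp only [form_lieForm_curryLeft, map_add, map_sum, map_smul, ins_mul, ins_theta, par_theta,
        ← ins_form, ins_ins_comm (form_mem_altSym φ) f, mul_neg, neg_mul, neg_neg, smul_mul_assoc,
        one_mul, Finset.sum_add_distrib, smul_add]
      abel
    · rw [lieOp_apply, add_apply, sum_apply, sum_apply]
      simp only [theta_mul_comp_zero, smul_apply]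
      simp [form_comp]

include hnab hrho in
theorem kosHor_form {k : ℕ} (φ : Form R L k) : kosHor nab rho brG (form G φ) =
    ∑ a, theta L (p (b.coord a)) * form G (lieForm (ρ (b a)) φ) := by
  induction k with
  | zero =>
    refine eq_of_ins (fun f => ?_) fun v es β => ?_
    · rw [kosHor, ins_kos (form_mem_altSym φ), lieOp_form (b := b) (ρ := ρ) hnab hrho,
        ins_form_zero]
      simp [ins_form_zero, ins_mul, ins_theta]
    · simp only [sum_apply, theta_mul_comp_zero, Finset.sum_const_zero]
      rfl
  | succ k ih =>
    refine eq_of_ins (fun f => ?_) fun v es β => ?_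
    · rw [kosHor, ins_kos (form_mem_altSym φ), lieOp_form (b := b) (ρ := ρ) hnab hrho, ins_form f φ,
        ← kosHor, ih]
      simp only [form_lieForm_curryLeft, map_sum, ins_mul, ins_theta, par_theta, mul_add,
        Finset.sum_add_distrib, neg_mul, smul_mul_assoc, one_mul,
        Finset.sum_neg_distrib]
      abel
    · simp only [sum_apply, theta_mul_comp_zero, Finset.sum_const_zero]
      rfl

end HorizontalValues

end WeilRing

end WeilBRST

namespace WeilBRST

open WeilRing

section Intertwining

variable {𝔤 : Type*} [LieRing 𝔤] [LieAlgebra ℝ 𝔤]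
  {R L G : Type*} [CommRing R] [Algebra ℝ R] [LieRing L] [Module R L] [LieAlgebra ℝ L]
  [LieRingModule L R] [LieRinehartRing R L] [LieRinehartAlgebra ℝ R L]
  [AddCommGroup G] [Module R G]
  {nab : L → G → G} {rho : G →ₗ[R] L} {brG : G → G → G}
  {p : Module.Dual ℝ 𝔤 →ₗ[ℝ] G →ₗ[R] R} {ι : Type*} [Fintype ι] [DecidableEq ι]
  {b : Module.Basis ι ℝ 𝔤} {ρ : 𝔤 →ₗ⁅ℝ⁆ L}

theorem brstMap_mem_altSym (x : BRST 𝔤 R L) : brstMap L p x ∈ altSym R L G :=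
  (mem_weilSubmodule.1 (brstMap_mem p x)).1

theorem par_mu (l : G →ₗ[R] R) : par (WeilRing.mu L l) = WeilRing.mu L l := by
  refine eq_of_ins (fun e => ?_) fun v e β => ?_
  · rw [ins_par, ins_mu, map_zero, neg_zero]
  · rw [par_apply, pow_zero, one_mul]

theorem contraction_lof (Y : L) (k : ℕ) (φ : Form R L k) :
    formMap R L G (contraction Y (DirectSum.lof ℝ ℕ (Form R L) k φ)) =
      ins (Y, 0) (form G φ) := by
  rw [contraction, DirectSum.toModule_lof]
  obtain _ | k := k
  · rw [ins_form_zero]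
    exact map_zero _
  · rw [ins_form]
    exact formMap_lof k _

variable (hnab : ∀ ξ X α, p ξ (nab X α) = ⁅X, p ξ α⁆)
  (hrho : ∀ α, rho α = ∑ a, p (b.coord a) α • ρ (b a))
  (hbr : ∀ ξ α β, p ξ (brG α β) = ∑ i, ∑ j, ξ ⁅b i, b j⁆ • (p (b.coord i) α * p (b.coord j) β) +
    ⁅rho α, p ξ β⁆ - ⁅rho β, p ξ α⁆)

include hnab hbr in
theorem flatDiff_theta (ξ : Module.Dual ℝ 𝔤) : flatDiff nab rho brG (WeilRing.theta L (p ξ)) =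
    lieWeilMap L p (dWeil b (theta ξ)) := by
  rw [flatDiff_apply, insTerm_inl_theta, insTerm_theta, kosVer_theta hnab, kosHor_theta hbr,
    lieWeilMap_dWeil_theta]
  abel

include hnab hbr in
theorem flatDiff_mu (ξ : Module.Dual ℝ 𝔤) : flatDiff nab rho brG (WeilRing.mu L (p ξ)) =
    lieWeilMap L p (dWeil b (mu ξ)) := by
  rw [flatDiff_apply, insTerm_mu, insTerm_mu, kosVer_mu hnab, kosHor_mu hnab hbr,
    lieWeilMap_dWeil_mu]
  abel

include hnab hrho in
theorem flatDiff_form {k : ℕ} (φ : Form R L k) : flatDiff nab rho brG (form G φ) =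
    form G (extForm φ) + ∑ a, WeilRing.theta L (p (b.coord a)) * form G (lieForm (ρ (b a)) φ) -
      ∑ a, WeilRing.mu L (p (b.coord a)) * ins (ρ (b a), 0) (form G φ) := by
  rw [flatDiff_apply, insTerm_inl_form hrho, insTerm_inr_form, kosVer_form,
    kosHor_form hnab hrho]
  abel

include hnab hrho hbr in
/-- The identification of the BRST algebra with the Weil algebra intertwines the differentials. -/
theorem brstMap_brstDiff (x : BRST 𝔤 R L) :
    brstMap L p (brstDiff b ρ x) = flatDiff nab rho brG (brstMap L p x) := by
  refine congrArg (fun h => h x) (brst_hom_ext (f := brstMap L p ∘ₗ brstDiff b ρ)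
    (g := flatDiff nab rho brG ∘ₗ brstMap L p) (fun k φ => ?_) (fun ξ x hx => ?_)
    (fun ξ x hx => ?_))
  · rw [LinearMap.comp_apply, LinearMap.comp_apply, brstDiff_one_tmul_lof, brstMap_one_tmul_lof,
      flatDiff_form hnab hrho (b := b) (ρ := ρ), map_add, map_add, map_sum, map_sum,
      brstMap_one_tmul_lof]
    simp only [brstMap_leftMul, lieWeilMap_theta, map_neg, lieWeilMap_mu, brstMap_one_tmul_lof]
    simp only [brstMap_tmul, map_one, one_mul, contraction_lof, neg_mul, Finset.sum_neg_distrib,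
      ← sub_eq_add_neg]
  · rw [LinearMap.comp_apply, LinearMap.comp_apply] at hx ⊢
    have h := congrArg (brstMap L p) (brstDiff_theta b ρ ξ x)
    rw [map_add, brstMap_leftMul_theta, brstMap_leftMul, hx] at h
    rw [brstMap_leftMul_theta, flatDiff_mul nab rho brG (theta_mem_altSym _) (brstMap_mem_altSym x),
      flatDiff_theta hnab hbr, par_theta, neg_mul, ← sub_eq_add_neg, ← h, add_sub_cancel_right]
  · rw [LinearMap.comp_apply, LinearMap.comp_apply] at hx ⊢
    rw [brstDiff_mu, map_add, brstMap_leftMul_mu, brstMap_leftMul_mu, brstMap_leftMul, hx,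
      flatDiff_mul nab rho brG (mu_mem_altSym _) (brstMap_mem_altSym x), flatDiff_mu hnab hbr, par_mu]

end Intertwining

section Action

variable {E : Type*} [NormedAddCommGroup E] [NormedSpace ℝ E] [FiniteDimensional ℝ E]
  {H : Type*} [TopologicalSpace H] {I : ModelWithCorners ℝ E H}
  {M : Type*} [TopologicalSpace M] [ChartedSpace H M] [IsManifold I ∞ M] [T2Space M]
  {𝔤 : Type*} [LieRing 𝔤] [LieAlgebra ℝ 𝔤] [FiniteDimensional ℝ 𝔤]
  {ι : Type*} [Fintype ι] [DecidableEq ι] (b : Module.Basis ι ℝ 𝔤)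
  (ρ : 𝔤 →ₗ⁅ℝ⁆ VField I M)

theorem GSection.pair_const (ξ : Module.Dual ℝ 𝔤) (u : 𝔤) :
    GSection.pair ξ (GSection.const u : GSection I M 𝔤) = algebraMap ℝ C^∞⟮I, M; ℝ⟯ (ξ u) :=
  rfl

variable (I M 𝔤) in
/-- The pairing of `𝔤*` with the sections of `M × 𝔤`. -/
def GSection.pairing :
    Module.Dual ℝ 𝔤 →ₗ[ℝ] GSection I M 𝔤 →ₗ[C^∞⟮I, M; ℝ⟯] C^∞⟮I, M; ℝ⟯ where
  toFun := GSection.pair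
  map_add' _ _ := rfl
  map_smul' _ _ := rfl

theorem GSection.pairing_smul_const (ξ : Module.Dual ℝ 𝔤) (f : C^∞⟮I, M; ℝ⟯) (u : 𝔤) :
    GSection.pairing I M 𝔤 ξ (f • GSection.const u) = ξ u • f := by
  rw [map_smul]
  change f • GSection.pair ξ (GSection.const u) = _
  rw [GSection.pair_const, smul_eq_mul, mul_comm, ← Algebra.smul_def]

theorem GSection.pairing_deriv (ξ : Module.Dual ℝ 𝔤) (X : VField I M) (α : GSection I M 𝔤) :
    GSection.pairing I M 𝔤 ξ (GSection.deriv X α) = ⁅X, GSection.pairing I M 𝔤 ξ α⁆ := by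
  induction α using GSection.induction with
  | h1 f u =>
    rw [GSection.deriv_leibniz, GSection.deriv_const, smul_zero, zero_add, pairing_smul_const,
      pairing_smul_const, LieModule.lie_smul]
  | h2 α β hα hβ => rw [GSection.deriv_add, map_add, hα, hβ, map_add, lie_add]

theorem GSection.anchor_eq_sum (α : GSection I M 𝔤) :
    GSection.anchor ρ α = ∑ a, GSection.pairing I M 𝔤 (b.coord a) α • ρ (b a) := by
  induction α using GSection.induction with
  | h1 f u =>
    have h : ρ u = ∑ a, b.repr u a • ρ (b a) := by
      conv_lhs => rw [← b.sum_repr u]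
      rw [map_sum]
      exact Finset.sum_congr rfl fun a _ => map_smul ρ _ _
    rw [map_smul, GSection.anchor_const, h, Finset.smul_sum]
    refine Finset.sum_congr rfl fun a _ => ?_
    rw [pairing_smul_const, Module.Basis.coord_apply, smul_comm, smul_assoc]
  | h2 α β hα hβ => simp only [map_add, hα, hβ, add_smul, Finset.sum_add_distrib]

theorem GSection.pairing_pointwise (ξ : Module.Dual ℝ 𝔤) (α β : GSection I M 𝔤) :
    GSection.pairing I M 𝔤 ξ (α.pointwise β) = ∑ i, ∑ j, ξ ⁅b i, b j⁆ •
      (GSection.pairing I M 𝔤 (b.coord i) α * GSection.pairing I M 𝔤 (b.coord j) β) := by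
  induction α using GSection.induction with
  | h2 α α' h h' =>
    simp only [GSection.pointwise_add_left, map_add, h, h', add_mul, smul_add,
      Finset.sum_add_distrib]
  | h1 f u =>
    induction β using GSection.induction with
    | h2 β β' h h' =>
      simp only [GSection.pointwise_add_right, map_add, h, h', mul_add, smul_add,
        Finset.sum_add_distrib]
    | h1 g v =>
      rw [GSection.pointwise_smul_left, GSection.pointwise_smul_right, GSection.pointwise_const,
        smul_smul, pairing_smul_const]
      have key : ξ ⁅u, v⁆ = ∑ i, ∑ j, ξ ⁅b i, b j⁆ * (b.repr u i * b.repr v j) := by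
        conv_lhs => rw [← b.sum_repr u, ← b.sum_repr v]
        simp only [sum_lie, lie_sum, smul_lie, lie_smul, map_sum, map_smul,
          smul_eq_mul, Finset.mul_sum]
        rw [Finset.sum_comm]
        exact Finset.sum_congr rfl fun i _ => Finset.sum_congr rfl fun j _ => by ring
      simp only [pairing_smul_const, Module.Basis.coord_apply]
      rw [key, Finset.sum_smul]
      refine Finset.sum_congr rfl fun i _ => ?_
      rw [Finset.sum_smul]
      refine Finset.sum_congr rfl fun j _ => ?_
      rw [smul_mul_smul_comm, smul_smul]

theorem GSection.pairing_actionBracket (ξ : Module.Dual ℝ 𝔤) (α β : GSection I M 𝔤) :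
    GSection.pairing I M 𝔤 ξ (GSection.actionBracket ρ α β) = ∑ i, ∑ j, ξ ⁅b i, b j⁆ •
      (GSection.pairing I M 𝔤 (b.coord i) α * GSection.pairing I M 𝔤 (b.coord j) β) +
      ⁅GSection.anchor ρ α, GSection.pairing I M 𝔤 ξ β⁆ -
      ⁅GSection.anchor ρ β, GSection.pairing I M 𝔤 ξ α⁆ := by
  rw [GSection.actionBracket, map_sub, map_add, pairing_pointwise b, pairing_deriv, pairing_deriv]

theorem GSection.const_eq_sum (u : 𝔤) :
    (GSection.const u : GSection I M 𝔤) =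
      ∑ i, algebraMap ℝ C^∞⟮I, M; ℝ⟯ (b.repr u i) • GSection.const (b i) := by
  let c : 𝔤 →ₗ[ℝ] GSection I M 𝔤 :=
    { toFun := GSection.const, map_add' := fun _ _ => rfl, map_smul' := fun _ _ => rfl }
  have h : c u = ∑ i, b.repr u i • c (b i) := by
    conv_lhs => rw [← b.sum_repr u]
    rw [map_sum]
    exact Finset.sum_congr rfl fun i _ => map_smul c _ _
  refine h.trans (Finset.sum_congr rfl fun i _ => ?_)
  rw [algebraMap_smul]
  rfl

theorem GSection.span_const : Submodule.span C^∞⟮I, M; ℝ⟯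
    (Set.range fun i => (GSection.const (b i) : GSection I M 𝔤)) = ⊤ := by
  rw [eq_top_iff]
  rintro α -
  induction α using GSection.induction with
  | h1 f u =>
    refine Submodule.smul_mem _ f ?_
    rw [GSection.const_eq_sum b u]
    exact sum_mem fun i _ => Submodule.smul_mem _ _ (Submodule.subset_span ⟨i, rfl⟩)
  | h2 α β hα hβ => exact add_mem hα hβ

theorem flatConnection_curv (X Y : VField I M) (α : GSection I M 𝔤) :
    flatConnection.curv X Y α = 0 := by
  change GSection.deriv X (GSection.deriv Y α) - GSection.deriv Y (GSection.deriv X α) -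
    GSection.deriv ⁅X, Y⁆ α = 0
  rw [GSection.deriv_lie, sub_self]

theorem actionAlgebroid_basicCurv (α β : GSection I M 𝔤) (X : VField I M) :
    (actionAlgebroid ρ).basicCurv flatConnection α β X = 0 := by
  change GSection.deriv X (GSection.actionBracket ρ α β) -
    GSection.actionBracket ρ (GSection.deriv X α) β -
    GSection.actionBracket ρ α (GSection.deriv X β) -
    GSection.deriv (GSection.anchor ρ (GSection.deriv X β) + ⁅GSection.anchor ρ β, X⁆) α +
    GSection.deriv (GSection.anchor ρ (GSection.deriv X α) + ⁅GSection.anchor ρ α, X⁆) β = 0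
  simp only [GSection.actionBracket, GSection.deriv_add, GSection.deriv_sub,
    GSection.deriv_add_left, GSection.deriv_pointwise, GSection.deriv_lie]
  abel

theorem curvatureTerm_eq_zero {R L G : Type*} [CommRing R] [Algebra ℝ R] [AddCommGroup L]
    [Module R L] [AddCommGroup G] [Module R G] {K : L × G → L × G → L × G → G}
    (hK : ∀ e e' e'', K e e' e'' = 0) {c : WeilRing R L G} (hc : c ∈ altSym R L G) :
    curvatureTerm K c = 0 := by
  have h : ∀ n v (e : Fin n → L × G) (β : Fin v → G),
      c n (v + 1) e (Matrix.vecCons 0 β) = 0 := fun n v e β =>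
    congrArg (fun c : WeilRing R L G => c.comp n v e β) (der_zero hc)
  funext n v e β
  match n, e with
  | 0, _ => rfl
  | 1, _ => rfl
  | 2, _ => rfl
  | n + 3, e =>
    simp only [curvatureTerm, hK, h, smul_zero, Finset.sum_const_zero]
    rfl

theorem dHor_add_dVer {c : WeilRing C^∞⟮I, M; ℝ⟯ (VField I M) (GSection I M 𝔤)}
    (hc : c ∈ altSym C^∞⟮I, M; ℝ⟯ (VField I M) (GSection I M 𝔤)) :
    (actionAlgebroid ρ).dHor flatConnection c + flatConnection.dVer c =
      flatDiff GSection.deriv (GSection.anchor ρ) (GSection.actionBracket ρ) c := by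
  unfold LieAlgebroid.dHor Connection.dVer
  rw [curvatureTerm_eq_zero (fun e e' e'' => actionAlgebroid_basicCurv ρ e.2 e'.2 e''.1) hc,
    curvatureTerm_eq_zero (fun e e' e'' => flatConnection_curv e.1 e'.1 e''.2) hc, add_zero,
    add_zero]
  rfl

/-- The isomorphism of the BRST algebra with the Weil algebra of the action algebroid. -/
def brstEquiv (b : Module.Basis ι ℝ 𝔤) : BRST 𝔤 C^∞⟮I, M; ℝ⟯ (VField I M) ≃ₗ[ℝ]
    AlgebroidWeil I (LieFibre 𝔤) (ActionBundle M 𝔤) :=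
  LinearEquiv.ofBijective
    ((brstMap (VField I M) (GSection.pairing I M 𝔤)).codRestrict
      (weilSubmodule C^∞⟮I, M; ℝ⟯ (VField I M) (GSection I M 𝔤)) (brstMap_mem _))
    ⟨fun x y h => brstMap_injective (κ := GSection.const) (fun _ _ => rfl) b
      (congrArg Subtype.val h), fun c => by
      obtain ⟨x, hx⟩ := weilSubmodule_le_range (κ := GSection.const)
        (p := GSection.pairing I M 𝔤) (fun _ _ => rfl) b (GSection.span_const b) c.2
      exact ⟨x, Subtype.ext hx⟩⟩

theorem brstEquiv_apply (b : Module.Basis ι ℝ 𝔤) (x : BRST 𝔤 C^∞⟮I, M; ℝ⟯ (VField I M)) :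
    (brstEquiv b x).1 = brstMap (VField I M) (GSection.pairing I M 𝔤) x := rfl

end Action

end WeilBRST

end

theorem mainTheorem10
    {E : Type*} [NormedAddCommGroup E] [NormedSpace ℝ E] [FiniteDimensional ℝ E]
    {H : Type*} [TopologicalSpace H] (I : ModelWithCorners ℝ E H)
    {M : Type*} [TopologicalSpace M] [ChartedSpace H M] [IsManifold I ∞ M] [T2Space M]
    {𝔤 : Type*} [LieRing 𝔤] [LieAlgebra ℝ 𝔤] [FiniteDimensional ℝ 𝔤]
    {ι : Type*} [Fintype ι] [DecidableEq ι] (b : Module.Basis ι ℝ 𝔤)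
    (ρ : 𝔤 →ₗ⁅ℝ⁆ WeilBRST.VField I M) :
    ∃ Φ : WeilBRST.BRST 𝔤 C^∞⟮I, M; ℝ⟯ (WeilBRST.VField I M) ≃ₗ[ℝ]
        WeilBRST.AlgebroidWeil I (WeilBRST.LieFibre 𝔤) (WeilBRST.ActionBundle M 𝔤),
      (∀ (k : ℕ) (φ : WeilBRST.Form C^∞⟮I, M; ℝ⟯ (WeilBRST.VField I M) k),
        (Φ (1 ⊗ₜ DirectSum.lof ℝ ℕ (WeilBRST.Form C^∞⟮I, M; ℝ⟯ (WeilBRST.VField I M)) k φ)).1 =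
          WeilBRST.weilForm φ) ∧
      (∀ ξ : Module.Dual ℝ 𝔤, (Φ (WeilBRST.theta ξ ⊗ₜ WeilBRST.oneForm)).1 =
        WeilBRST.weilTheta (WeilBRST.GSection.pair ξ)) ∧
      (∀ ξ : Module.Dual ℝ 𝔤, (Φ (WeilBRST.mu ξ ⊗ₜ WeilBRST.oneForm)).1 =
        WeilBRST.weilMu (WeilBRST.GSection.pair ξ)) ∧
      (∀ x y, (Φ (WeilBRST.brstMul x y)).1 = WeilBRST.weilMul (Φ x).1 (Φ y).1) ∧
      (∀ p q x, x ∈ WeilBRST.brstBidegree p q ↔ WeilBRST.HasWeilBidegree p q (Φ x).1) ∧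
      (∀ x, (Φ (WeilBRST.brstDiff b ρ x)).1 =
        (WeilBRST.actionAlgebroid ρ).dHor WeilBRST.flatConnection (Φ x).1 +
          WeilBRST.flatConnection.dVer (Φ x).1) := by
  refine ⟨WeilBRST.brstEquiv b, fun k φ => ?_, fun ξ => ?_, fun ξ => ?_, fun x y => ?_,
    fun p q x => ?_, fun x => ?_⟩
  · rw [WeilBRST.brstEquiv_apply, WeilBRST.brstMap_one_tmul_lof]
    rfl
  · rw [WeilBRST.brstEquiv_apply, WeilBRST.brstMap_tmul, WeilBRST.lieWeilMap_theta,
      WeilBRST.formMap_oneForm, mul_one]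
    rfl
  · rw [WeilBRST.brstEquiv_apply, WeilBRST.brstMap_tmul, WeilBRST.lieWeilMap_mu,
      WeilBRST.formMap_oneForm, mul_one]
    rfl
  · rw [WeilBRST.brstEquiv_apply, WeilBRST.brstMap_brstMul]
    rfl
  · rw [WeilBRST.brstEquiv_apply]
    exact WeilBRST.mem_brstBidegree_iff
      (WeilBRST.brstMap_injective (κ := WeilBRST.GSection.const) (fun _ _ => rfl) b)
  · rw [WeilBRST.brstEquiv_apply, WeilBRST.brstEquiv_apply]
    refine Eq.trans ?_ (WeilBRST.dHor_add_dVer ρ (WeilBRST.brstMap_mem_altSym x)).symm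
    exact WeilBRST.brstMap_brstDiff (WeilBRST.GSection.pairing_deriv)
      (WeilBRST.GSection.anchor_eq_sum b ρ) (WeilBRST.GSection.pairing_actionBracket b ρ) x
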